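/- Let $d\in\mathbb N$ and $A\in \mathrm{GL}(2d,\mathbb R)$ with $d\times d$ blocks $A_{ij}$. Notation: $\pi(x,\omega)f(t)=M_\omega T_xf(t)=e^{2\pi i t\cdot\omega}f(t-x)$ and $V_\varphi u(x,\omega)=\langle u,\pi(x,\omega)\varphi\rangle$ is the short-time Fourier transform; for a fixed nonzero Schwartz window $\varphi$ and $p\in\{1,\infty\}$, $M^p(\mathbb R^n)$ is the modulation space of tempered distributions $u$ with $V_\varphi u\in L^p(\mathbb R^{2n})$, normed by $\|V_\varphi u\|_{L^p}$; the elements of $M^1$ are identified with their continuous representatives. The bracket $\langle\cdot,\cdot\rangle$ is the sesquilinear duality between $M^\infty$ and $M^1$ that extends $\int f\bar g$. For functions $\Phi$ on $\mathbb R^{2d}$ put $\mathfrak T_A\Phi(z)=\Phi(Az)$ and $\mathcal F_2\Phi(x,\omega)=\int_{\mathbb R^d}e^{-2\pi i\omega\cdot t}\Phi(x,t)\,dt$; both operators extend by duality to tempered distributions. Put $(f\otimes g)(x,y)=f(x)g(y)$, $$\mathcal B_A(f,g)(x,\omega)=\mathcal F_2\mathfrak T_A(f\otimes\bar g)(x,\omega)=\int_{\mathbb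 R^d}e^{-2\pi i\omega\cdot y}f(A_{11}x+A_{12}y)\overline{g(A_{21}x+A_{22}y)}\,dy ,\qquad A_{ST}=\begin{pmatrix}0&I\\-I&I\end{pmatrix}.$$ **Theorem.** Let $T:M^1(\mathbb R^d)\to M^\infty(\mathbb R^d)$ be a continuous linear operator. There exist $k,\sigma,F\in M^\infty(\mathbb R^{2d})$ such that $T$ admits the following representations: 1. (integral operator with kernel $k$) $\langle Tf,g\rangle=\langle k,g\otimes\bar f\rangle$ for all $f,g\in M^1(\mathbb R^d)$; 2. (pseudodifferential operator with symbol $\sigma$) $T=\sigma^A$, that is, $\langle Tf,g\rangle=\langle\sigma,\mathcal B_A(g,f)\rangle$ for all $f,g\in M^1(\mathbb R^d)$; 3. (superposition of time-frequency shifts with spreading function $F$) $T=\iint_{\mathbb R^{2d}}F(x,\omega)\,M_\omega T_x\,dx\,d\omega$ in the weak sense, that is, $\langle Tf,g\rangle=\langle F,V_fg\rangle$ for all $f,g\in M^1(\mathbb R^d)$, where $V_fg(x,\omega)=\overline{\langle \pi(x,\omega)f,g\rangle}$. Whenever $k,\sigma,F\in M^\infty(\mathbb R^{2d})$ represent $T$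 in the senses 1, 2 and 3, they are related by $$\sigma=|\det A|\,\mathcal F_2\mathfrak T_Ak,\qquad F=\mathcal F_2\mathfrak T_{A_{ST}}k .$$ -/

import Mathlib

open MeasureTheory SchwartzMap
open scoped FourierTransform ComplexConjugate ENNReal

noncomputable section

namespace MatrixWigner

variable {ι : Type} [Fintype ι]

/-- The point `(x, y)` of `ℝ²ᵈ`. -/
def pair (x y : EuclideanSpace ℝ ι) : EuclideanSpace ℝ (ι ⊕ ι) :=
  WithLp.toLp 2 (Sum.elim x y)

/-- The projection `(x, y) ↦ x`. -/
def fstL : EuclideanSpace ℝ (ι ⊕ ι) →L[ℝ] EuclideanSpace ℝ ι :=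
  LinearMap.toContinuousLinearMap
    { toFun := fun z => WithLp.toLp 2 fun i => z (Sum.inl i)
      map_add' := fun _ _ => rfl
      map_smul' := fun _ _ => rfl }

/-- The projection `(x, y) ↦ y`. -/
def sndL : EuclideanSpace ℝ (ι ⊕ ι) →L[ℝ] EuclideanSpace ℝ ι :=
  LinearMap.toContinuousLinearMap
    { toFun := fun z => WithLp.toLp 2 fun i => z (Sum.inr i)
      map_add' := fun _ _ => rfl
      map_smul' := fun _ _ => rfl }

/-- The embedding `x ↦ (x, 0)`. -/
def inlL : EuclideanSpace ℝ ι →L[ℝ] EuclideanSpace ℝ (ι ⊕ ι) :=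
  LinearMap.toContinuousLinearMap
    { toFun := fun x => pair x 0
      map_add' := fun x y => by ext i; rcases i with i | i <;> simp [pair]
      map_smul' := fun c x => by ext i; rcases i with i | i <;> simp [pair] }

/-- The embedding `y ↦ (0, y)`. -/
def inrL : EuclideanSpace ℝ ι →L[ℝ] EuclideanSpace ℝ (ι ⊕ ι) :=
  LinearMap.toContinuousLinearMap
    { toFun := fun y => pair 0 y
      map_add' := fun x y => by ext i; rcases i with i | i <;> simp [pair]
      map_smul' := fun c x => by ext i; rcases i with i | i <;> simp [pair] }

theorem pair_eq (x y : EuclideanSpace ℝ ι) : pair x y = inlL x + inrL y := by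
  ext i; rcases i with i | i <;> simp [pair, inlL, inrL]

@[simp] theorem fstL_pair (x y : EuclideanSpace ℝ ι) : fstL (pair x y) = x := rfl

@[simp] theorem sndL_pair (x y : EuclideanSpace ℝ ι) : sndL (pair x y) = y := rfl

theorem norm_pair_sq (x y : EuclideanSpace ℝ ι) : ‖pair x y‖ ^ 2 = ‖x‖ ^ 2 + ‖y‖ ^ 2 := by
  simp [EuclideanSpace.norm_sq_eq, pair]

theorem norm_fst_le (x y : EuclideanSpace ℝ ι) : ‖x‖ ≤ ‖pair x y‖ := by

  have := norm_pair_sq x y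
  nlinarith [norm_nonneg x, norm_nonneg (pair x y), sq_nonneg ‖y‖]
theorem norm_snd_le (x y : EuclideanSpace ℝ ι) : ‖y‖ ≤ ‖pair x y‖ := by
  have := norm_pair_sq x y
  nlinarith [norm_nonneg y, norm_nonneg (pair x y), sq_nonneg ‖x‖]

theorem norm_pair_le (x y : EuclideanSpace ℝ ι) : ‖pair x y‖ ≤ ‖x‖ + ‖y‖ := by
  have := norm_pair_sq x y
  nlinarith [norm_nonneg x, norm_nonneg y, norm_nonneg (pair x y)]

theorem pair_fst_snd (z : EuclideanSpace ℝ (ι ⊕ ι)) : pair (fstL z) (sndL z) = z := by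
  ext i; rcases i with i | i <;> rfl

theorem norm_inrL_le : ‖(inrL : EuclideanSpace ℝ ι →L[ℝ] _)‖ ≤ 1 := by
  refine ContinuousLinearMap.opNorm_le_bound _ zero_le_one fun y => ?_
  have h := norm_pair_le (0 : EuclideanSpace ℝ ι) y
  rw [norm_zero, zero_add] at h
  rw [one_mul]
  exact h

/-- The partial Fourier transform `(𝓕₂ F)(x, ω) = ∫ e^{-2πi ω·t} F(x, t) dt` of a function. -/
def partialFourier {W : Type} [NormedAddCommGroup W] [NormedSpace ℂ W]
    (F : EuclideanSpace ℝ (ι ⊕ ι) → W) (z : EuclideanSpace ℝ (ι ⊕ ι)) : W :=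
  𝓕 (fun t : EuclideanSpace ℝ ι => F (pair (fstL z) t)) (sndL z)

section PartialFourierSchwartz

variable {W : Type} [NormedAddCommGroup W] [NormedSpace ℂ W]

theorem seminorm_section (x : EuclideanSpace ℝ ι) (Ψ : 𝓢(EuclideanSpace ℝ (ι ⊕ ι), W))
    (j k n : ℕ) (t : EuclideanSpace ℝ ι) :
    ‖x‖ ^ j * (‖t‖ ^ k * ‖iteratedFDeriv ℝ n (fun t => Ψ (pair x t)) t‖) ≤
      SchwartzMap.seminorm ℂ (j + k) n Ψ := by
  have h1 : iteratedFDeriv ℝ n (fun t => Ψ (pair x t)) t =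
      (iteratedFDeriv ℝ n Ψ (pair x t)).compContinuousLinearMap fun _ => inrL := by
    have := ContinuousLinearMap.iteratedFDeriv_comp_right (𝕜 := ℝ) (inrL : EuclideanSpace ℝ ι →L[ℝ] _)
      (f := fun w => Ψ (inlL x + w)) (i := n) (n := ((⊤ : ℕ∞) : WithTop ℕ∞))
      ((Ψ.smooth ⊤).comp (contDiff_const.add contDiff_id)) t (by exact_mod_cast le_top)
    rw [iteratedFDeriv_comp_add_left] at this
    simp only [pair_eq]
    exact this
  have h2 : ‖iteratedFDeriv ℝ n (fun t => Ψ (pair x t)) t‖ ≤ ‖iteratedFDeriv ℝ n Ψ (pair x t)‖ := by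
    rw [h1]
    refine (ContinuousMultilinearMap.norm_compContinuousLinearMap_le _ _).trans ?_
    refine mul_le_of_le_one_right (norm_nonneg _) ?_
    exact Finset.prod_le_one (fun _ _ => norm_nonneg _) (fun _ _ => norm_inrL_le)
  calc _ ≤ ‖pair x t‖ ^ j * (‖pair x t‖ ^ k * ‖iteratedFDeriv ℝ n Ψ (pair x t)‖) := by
        gcongr
        · exact norm_fst_le x t
        · exact norm_snd_le x t
    _ = ‖pair x t‖ ^ (j + k) * ‖iteratedFDeriv ℝ n Ψ (pair x t)‖ := by rw [pow_add, mul_assoc]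
    _ ≤ _ := le_seminorm ℂ (j + k) n Ψ (pair x t)

/-- The section `t ↦ Ψ(x, t)` of a Schwartz function. -/
def sectionS (x : EuclideanSpace ℝ ι) (Ψ : 𝓢(EuclideanSpace ℝ (ι ⊕ ι), W)) :
    𝓢(EuclideanSpace ℝ ι, W) where
  toFun t := Ψ (pair x t)
  smooth' := by
    simp only [pair_eq]
    exact (Ψ.smooth ⊤).comp (contDiff_const.add (ContinuousLinearMap.contDiff (inrL : EuclideanSpace ℝ ι →L[ℝ] _)))
  decay' := by
    intro k n
    exact ⟨_, fun t => by simpa using seminorm_section x Ψ 0 k n t⟩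


theorem sup_seminorm_section (s : Finset (ℕ × ℕ)) (x : EuclideanSpace ℝ ι)
    (Ψ : 𝓢(EuclideanSpace ℝ (ι ⊕ ι), W)) (j : ℕ) :
    ‖x‖ ^ j * s.sup (schwartzSeminormFamily ℂ (EuclideanSpace ℝ ι) W) (sectionS x Ψ) ≤
      (s.image fun p => (j + p.1, p.2)).sup
        (schwartzSeminormFamily ℂ (EuclideanSpace ℝ (ι ⊕ ι)) W) Ψ := by
  classical
  set M := (s.image fun p => (j + p.1, p.2)).sup
        (schwartzSeminormFamily ℂ (EuclideanSpace ℝ (ι ⊕ ι)) W) Ψ with hM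
  have hM0 : 0 ≤ M := apply_nonneg _ _
  by_cases hx : ‖x‖ ^ j = 0
  · rw [hx, zero_mul]; exact hM0
  have hx' : 0 < ‖x‖ ^ j := lt_of_le_of_ne (by positivity) (Ne.symm hx)
  rw [← le_div_iff₀' hx']
  refine Seminorm.finset_sup_apply_le (by positivity) fun p hp => ?_
  refine seminorm_le_bound ℂ p.1 p.2 _ (by positivity) fun t => ?_
  rw [le_div_iff₀' hx']
  refine (seminorm_section x Ψ j p.1 p.2 t).trans ?_
  have : (j + p.1, p.2) ∈ s.image fun p => (j + p.1, p.2) := Finset.mem_image_of_mem _ hp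
  exact Seminorm.le_def.mp (Finset.le_sup (f := schwartzSeminormFamily ℂ _ W) this) Ψ

/-- Decay of the partial Fourier transform, uniformly in terms of Schwartz seminorms. -/
theorem partialFourier_bound (W : Type) [NormedAddCommGroup W] [NormedSpace ℂ W] (k : ℕ) :
    ∃ (s : Finset (ℕ × ℕ)) (C : ℝ), 0 ≤ C ∧ ∀ (Ψ : 𝓢(EuclideanSpace ℝ (ι ⊕ ι), W))
      (z : EuclideanSpace ℝ (ι ⊕ ι)), ‖z‖ ^ k * ‖partialFourier Ψ z‖ ≤
        C * s.sup (schwartzSeminormFamily ℂ (EuclideanSpace ℝ (ι ⊕ ι)) W) Ψ := by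
  classical
  have key : ∀ m : ℕ, ∃ (s : Finset (ℕ × ℕ)) (C : ℝ), 0 ≤ C ∧
      ∀ (h : 𝓢(EuclideanSpace ℝ ι, W)) (ω : EuclideanSpace ℝ ι), ‖ω‖ ^ m * ‖𝓕 (h : _ → W) ω‖ ≤
        C * s.sup (schwartzSeminormFamily ℂ (EuclideanSpace ℝ ι) W) h := by
    intro m
    have hc : Continuous ((SchwartzMap.seminorm ℂ m 0).comp
        (fourierTransformCLM ℂ : 𝓢(EuclideanSpace ℝ ι, W) →L[ℂ] 𝓢(EuclideanSpace ℝ ι, W)).toLinearMap) :=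
      ((schwartz_withSeminorms ℂ (EuclideanSpace ℝ ι) W).continuous_seminorm (m, 0)).comp
        (fourierTransformCLM ℂ : 𝓢(EuclideanSpace ℝ ι, W) →L[ℂ] 𝓢(EuclideanSpace ℝ ι, W)).continuous
    obtain ⟨s, C, -, hC⟩ := Seminorm.bound_of_continuous
      (schwartz_withSeminorms ℂ (EuclideanSpace ℝ ι) W) _ hc
    refine ⟨s, C, C.2, fun h ω => ?_⟩
    have h1 := norm_pow_mul_le_seminorm ℂ (fourierTransformCLM ℂ h) m ω
    exact h1.trans (hC h)
  obtain ⟨s₁, C₁, hC₁, h₁⟩ := key 0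
  obtain ⟨s₂, C₂, hC₂, h₂⟩ := key k
  refine ⟨s₁.image (fun p => (k + p.1, p.2)) ∪ s₂.image (fun p => (0 + p.1, p.2)),
    2 ^ k * (C₁ + C₂), by positivity, fun Ψ z => ?_⟩
  set S := (s₁.image (fun p => (k + p.1, p.2)) ∪ s₂.image (fun p => (0 + p.1, p.2))).sup
    (schwartzSeminormFamily ℂ (EuclideanSpace ℝ (ι ⊕ ι)) W) Ψ
  have e1 : ‖fstL z‖ ^ k * ‖partialFourier Ψ z‖ ≤ C₁ * S := by
    have a := h₁ (sectionS (fstL z) Ψ) (sndL z)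
    rw [pow_zero, one_mul] at a
    have b := sup_seminorm_section s₁ (fstL z) Ψ k
    have c := Seminorm.le_def.mp (Finset.sup_mono
      (f := schwartzSeminormFamily ℂ (EuclideanSpace ℝ (ι ⊕ ι)) W)
      (Finset.subset_union_left (s₁ := s₁.image (fun p => (k + p.1, p.2)))
        (s₂ := s₂.image (fun p => (0 + p.1, p.2))))) Ψ
    calc _ ≤ ‖fstL z‖ ^ k * (C₁ * s₁.sup (schwartzSeminormFamily ℂ _ W) (sectionS (fstL z) Ψ)) := by
          gcongr; exact a
      _ = C₁ * (‖fstL z‖ ^ k * s₁.sup (schwartzSeminormFamily ℂ _ W) (sectionS (fstL z) Ψ)) := by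
          ring
      _ ≤ C₁ * S := by gcongr; exact b.trans c
  have e2 : ‖sndL z‖ ^ k * ‖partialFourier Ψ z‖ ≤ C₂ * S := by
    have a := h₂ (sectionS (fstL z) Ψ) (sndL z)
    have b := sup_seminorm_section s₂ (fstL z) Ψ 0
    rw [pow_zero, one_mul] at b
    have c := Seminorm.le_def.mp (Finset.sup_mono
      (f := schwartzSeminormFamily ℂ (EuclideanSpace ℝ (ι ⊕ ι)) W)
      (Finset.subset_union_right (s₁ := s₁.image (fun p => (k + p.1, p.2)))
        (s₂ := s₂.image (fun p => (0 + p.1, p.2))))) Ψ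
    refine a.trans ?_
    gcongr
    exact b.trans c
  have hz : ‖z‖ ^ k ≤ 2 ^ k * (‖fstL z‖ ^ k + ‖sndL z‖ ^ k) := by
    have h0 : ‖z‖ ≤ ‖fstL z‖ + ‖sndL z‖ := by
      have := norm_pair_le (fstL z) (sndL z)
      rwa [pair_fst_snd] at this
    have h3 : ‖z‖ ≤ 2 * max ‖fstL z‖ ‖sndL z‖ := by
      linarith [le_max_left ‖fstL z‖ ‖sndL z‖, le_max_right ‖fstL z‖ ‖sndL z‖]
    calc ‖z‖ ^ k ≤ (2 * max ‖fstL z‖ ‖sndL z‖) ^ k := by gcongr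
      _ = 2 ^ k * (max ‖fstL z‖ ‖sndL z‖) ^ k := mul_pow _ _ _
      _ ≤ _ := by
        gcongr
        rcases max_choice ‖fstL z‖ ‖sndL z‖ with h | h <;> rw [h]
        · linarith [pow_nonneg (norm_nonneg (sndL z)) k]
        · linarith [pow_nonneg (norm_nonneg (fstL z)) k]
  calc _ ≤ 2 ^ k * (‖fstL z‖ ^ k + ‖sndL z‖ ^ k) * ‖partialFourier Ψ z‖ := by gcongr
    _ = 2 ^ k * (‖fstL z‖ ^ k * ‖partialFourier Ψ z‖ + ‖sndL z‖ ^ k * ‖partialFourier Ψ z‖) := by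
      ring
    _ ≤ 2 ^ k * (C₁ * S + C₂ * S) := by gcongr
    _ = _ := by ring

/-- The symbol map with `D (𝓕₂ Ψ) = 𝓕₂ (sharp Ψ)`. -/
def sharp (W : Type) [NormedAddCommGroup W] [NormedSpace ℂ W] :
    𝓢(EuclideanSpace ℝ (ι ⊕ ι), W) →L[ℂ]
      𝓢(EuclideanSpace ℝ (ι ⊕ ι), EuclideanSpace ℝ (ι ⊕ ι) →L[ℝ] W) :=
  (postcompCLM
      { toFun := fun l : EuclideanSpace ℝ (ι ⊕ ι) →L[ℝ] W => l.comp (inlL.comp fstL)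
        map_add' := fun _ _ => rfl
        map_smul' := fun _ _ => rfl
        cont := (ContinuousLinearMap.precomp W (inlL.comp fstL)).continuous }).comp
      (fderivCLM ℂ (EuclideanSpace ℝ (ι ⊕ ι)) W) +
    (-(2 * Real.pi * Complex.I)) •
      smulRightCLM ℂ W (((innerSL ℝ).bilinearComp sndL sndL))

theorem sharp_apply (Ψ : 𝓢(EuclideanSpace ℝ (ι ⊕ ι), W)) (w h : EuclideanSpace ℝ (ι ⊕ ι)) :
    sharp W Ψ w h = fderiv ℝ Ψ w (inlL (fstL h)) +
      (-(2 * Real.pi * Complex.I)) • (inner ℝ (sndL w) (sndL h) • Ψ w) := by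
  simp [sharp]
  rfl

theorem partialFourier_eq (F : EuclideanSpace ℝ (ι ⊕ ι) → W) (z : EuclideanSpace ℝ (ι ⊕ ι)) :
    partialFourier F z = ∫ t : EuclideanSpace ℝ ι,
      Complex.exp (-(2 * Real.pi * Complex.I) * (inner ℝ t (sndL z) : ℝ)) •
        F (pair (fstL z) t) := by
  rw [partialFourier, Real.fourier_eq']
  congr 1
  ext t
  congr 2
  push_cast
  ring

theorem norm_exp_neg (a : ℝ) : ‖Complex.exp (-(2 * Real.pi * Complex.I) * (a : ℝ))‖ = 1 := by
  rw [Complex.norm_exp]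
  simp

theorem norm_schwartz_pair_le (Ψ : 𝓢(EuclideanSpace ℝ (ι ⊕ ι), W)) (N : ℕ) :
    ∃ C : ℝ, ∀ x t : EuclideanSpace ℝ ι, ‖Ψ (pair x t)‖ ≤ C * (1 + ‖t‖) ^ (-(N : ℝ)) := by
  refine ⟨2 ^ N * ((Finset.Iic (N, 0)).sup fun m => SchwartzMap.seminorm ℂ m.1 m.2) Ψ,
    fun x t => ?_⟩
  have h := one_add_le_sup_seminorm_apply (𝕜 := ℂ) (m := (N, 0)) le_rfl le_rfl Ψ (pair x t)
  rw [norm_iteratedFDeriv_zero] at h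
  rw [Real.rpow_neg (by positivity), Real.rpow_natCast, ← div_eq_mul_inv, le_div_iff₀ (by positivity),
    mul_comm]
  refine le_trans ?_ h
  gcongr
  exact norm_snd_le x t

theorem continuous_pair (x : EuclideanSpace ℝ ι) : Continuous (pair x) := by
  have : pair x = fun t => inlL x + inrL t := funext fun t => pair_eq x t
  rw [this]
  fun_prop

theorem hasFDerivAt_partialFourier (Ψ : 𝓢(EuclideanSpace ℝ (ι ⊕ ι), W))
    (z : EuclideanSpace ℝ (ι ⊕ ι)) :
    HasFDerivAt (partialFourier Ψ) (partialFourier (sharp W Ψ) z) z := by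
  obtain ⟨C, hC⟩ := norm_schwartz_pair_le (sharp W Ψ) (Measure.integrablePower (volume : Measure (EuclideanSpace ℝ ι)))
  obtain ⟨C', hC'⟩ := norm_schwartz_pair_le Ψ (Measure.integrablePower (volume : Measure (EuclideanSpace ℝ ι)))
  have hint := Measure.integrable_pow_neg_integrablePower (volume : Measure (EuclideanSpace ℝ ι))
  have e : partialFourier Ψ = fun z => ∫ t : EuclideanSpace ℝ ι,
      Complex.exp (-(2 * Real.pi * Complex.I) * (inner ℝ t (sndL z) : ℝ)) •
        Ψ (pair (fstL z) t) := funext (partialFourier_eq _)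
  have hcont : ∀ z : EuclideanSpace ℝ (ι ⊕ ι), Continuous fun t : EuclideanSpace ℝ ι =>
      Complex.exp (-(2 * Real.pi * Complex.I) * (inner ℝ t (sndL z) : ℝ)) := by
    intro z; fun_prop
  rw [e, partialFourier_eq]
  refine hasFDerivAt_integral_of_dominated_of_fderiv_le (s := Set.univ)
    (F' := fun z t => Complex.exp (-(2 * Real.pi * Complex.I) * (inner ℝ t (sndL z) : ℝ)) •
        sharp W Ψ (pair (fstL z) t)) Filter.univ_mem
    (bound := fun t => C * (1 + ‖t‖) ^ (-(Measure.integrablePower (volume : Measure (EuclideanSpace ℝ ι)) : ℝ)))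
    ?_ ?_ ?_ ?_ ?_ ?_
  · refine Filter.Eventually.of_forall fun z => Continuous.aestronglyMeasurable ?_
    exact (hcont z).smul (Ψ.continuous.comp (continuous_pair _))
  · refine Integrable.mono' (hint.const_mul C') ?_ (Filter.Eventually.of_forall fun t => ?_)
    · exact ((hcont z).smul (Ψ.continuous.comp (continuous_pair _))).aestronglyMeasurable
    · rw [norm_smul, norm_exp_neg, one_mul]
      exact hC' _ _
  · exact ((hcont z).smul ((sharp W Ψ).continuous.comp (continuous_pair _))).aestronglyMeasurable
  · refine Filter.Eventually.of_forall fun t z _ => ?_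
    rw [norm_smul, norm_exp_neg, one_mul]
    exact hC _ _
  · exact hint.const_mul C
  · refine Filter.Eventually.of_forall fun t z _ => ?_
    have h1 : HasFDerivAt (fun z : EuclideanSpace ℝ (ι ⊕ ι) => (inner ℝ t (sndL z) : ℝ))
        ((innerSL ℝ t).comp sndL) z := ((innerSL ℝ t).comp sndL).hasFDerivAt
    have h2 := (((Complex.ofRealCLM.hasFDerivAt).comp z h1).const_mul
      (-(2 * Real.pi * Complex.I))).cexp
    have h3 : HasFDerivAt (fun z : EuclideanSpace ℝ (ι ⊕ ι) => pair (fstL z) t)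
        (inlL.comp fstL) z := by
      simp only [pair_eq]
      exact ((inlL.comp fstL : EuclideanSpace ℝ (ι ⊕ ι) →L[ℝ] _).hasFDerivAt).add_const _
    have h4 := (Ψ.hasFDerivAt (pair (fstL z) t)).comp z h3
    refine HasFDerivAt.congr_fderiv (h2.smul h4) (ContinuousLinearMap.ext fun h => Eq.symm ?_)
    have e1 : (Complex.exp (-(2 * Real.pi * Complex.I) * (inner ℝ t (sndL z) : ℝ)) •
        sharp W Ψ (pair (fstL z) t)) h =
        Complex.exp (-(2 * Real.pi * Complex.I) * (inner ℝ t (sndL z) : ℝ)) •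
          (fderiv ℝ Ψ (pair (fstL z) t) (inlL (fstL h)) +
      (-(2 * Real.pi * Complex.I)) • ((inner ℝ t (sndL h) : ℝ) • Ψ (pair (fstL z) t))) := by
      rw [smul_apply, sharp_apply, sndL_pair]
    refine e1.trans ?_
    rw [smul_add]
    simp [smul_smul]
    rw [mul_smul _ ((inner ℝ t (sndL h) : ℝ) : ℂ)]
    rfl

theorem contDiff_partialFourier (n : ℕ) : ∀ (W : Type) [NormedAddCommGroup W] [NormedSpace ℂ W]
    (Ψ : 𝓢(EuclideanSpace ℝ (ι ⊕ ι), W)), ContDiff ℝ n (partialFourier Ψ) := by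
  induction n with
  | zero =>
    intro W _ _ Ψ
    exact contDiff_zero.2 (continuous_iff_continuousAt.2 fun z =>
      (hasFDerivAt_partialFourier Ψ z).continuousAt)
  | succ n ih =>
    intro W _ _ Ψ
    have : fderiv ℝ (partialFourier Ψ) = partialFourier (sharp W Ψ) :=
      funext fun z => (hasFDerivAt_partialFourier Ψ z).fderiv
    push_cast
    refine contDiff_succ_iff_fderiv.2 ⟨fun z => (hasFDerivAt_partialFourier Ψ z).differentiableAt,
      by simp, ?_⟩
    rw [this]
    exact ih _ _

theorem partialFourier_iteratedFDeriv_bound (k n : ℕ) :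
    ∀ (W : Type) [NormedAddCommGroup W] [NormedSpace ℂ W],
    ∃ (s : Finset (ℕ × ℕ)) (C : ℝ), 0 ≤ C ∧ ∀ (Ψ : 𝓢(EuclideanSpace ℝ (ι ⊕ ι), W))
      (z : EuclideanSpace ℝ (ι ⊕ ι)), ‖z‖ ^ k * ‖iteratedFDeriv ℝ n (partialFourier Ψ) z‖ ≤
        C * s.sup (schwartzSeminormFamily ℂ (EuclideanSpace ℝ (ι ⊕ ι)) W) Ψ := by
  induction n with
  | zero =>
    intro W _ _
    obtain ⟨s, C, hC, h⟩ := partialFourier_bound (ι := ι) W k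
    exact ⟨s, C, hC, fun Ψ z => by rw [norm_iteratedFDeriv_zero]; exact h Ψ z⟩
  | succ n ih =>
    intro W _ _
    obtain ⟨s, C, hC, h⟩ := ih (EuclideanSpace ℝ (ι ⊕ ι) →L[ℝ] W)
    have hs : Continuous (s.sup (schwartzSeminormFamily ℂ (EuclideanSpace ℝ (ι ⊕ ι))
        (EuclideanSpace ℝ (ι ⊕ ι) →L[ℝ] W)) : Seminorm ℂ _) := by
      refine Finset.sup_induction
        (p := fun q : Seminorm ℂ 𝓢(EuclideanSpace ℝ (ι ⊕ ι), EuclideanSpace ℝ (ι ⊕ ι) →L[ℝ] W) =>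
          Continuous q) continuous_const (fun a ha b hb => ha.sup hb) fun p _ =>
          (schwartz_withSeminorms ℂ (EuclideanSpace ℝ (ι ⊕ ι)) _).continuous_seminorm p
    have hc : Continuous ((s.sup (schwartzSeminormFamily ℂ (EuclideanSpace ℝ (ι ⊕ ι))
        (EuclideanSpace ℝ (ι ⊕ ι) →L[ℝ] W))).comp (sharp (ι := ι) W).toLinearMap) :=
      hs.comp (sharp (ι := ι) W).continuous
    obtain ⟨s', C', -, h'⟩ := Seminorm.bound_of_continuous
      (schwartz_withSeminorms ℂ (EuclideanSpace ℝ (ι ⊕ ι)) W) _ hc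
    refine ⟨s', C * C', mul_nonneg hC C'.2, fun Ψ z => ?_⟩
    have : fderiv ℝ (partialFourier Ψ) = partialFourier (sharp W Ψ) :=
      funext fun z => (hasFDerivAt_partialFourier Ψ z).fderiv
    rw [← norm_iteratedFDeriv_fderiv, this, mul_assoc]
    refine (h (sharp W Ψ) z).trans ?_
    gcongr
    exact h' Ψ

/-- The partial Fourier transform `𝓕₂` on the Schwartz space of `ℝ²ᵈ`. -/
def partialFourierCLM : 𝓢(EuclideanSpace ℝ (ι ⊕ ι), ℂ) →L[ℂ] 𝓢(EuclideanSpace ℝ (ι ⊕ ι), ℂ) :=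
  mkCLM (fun Ψ => partialFourier Ψ)
    (fun f g x => by
      have := FourierTransform.fourier_add (sectionS (fstL x) f) (sectionS (fstL x) g)
      exact DFunLike.congr_fun this (sndL x))
    (fun a f x => by
      have := FourierTransform.fourier_smul a (sectionS (fstL x) f)
      exact DFunLike.congr_fun this (sndL x))
    (fun f => contDiff_infty.2 fun n => contDiff_partialFourier n ℂ f)
    (fun n => partialFourier_iteratedFDeriv_bound n.1 n.2 ℂ)

theorem partialFourierCLM_apply (Ψ : 𝓢(EuclideanSpace ℝ (ι ⊕ ι), ℂ))
    (z : EuclideanSpace ℝ (ι ⊕ ι)) : partialFourierCLM Ψ z = partialFourier Ψ z := rfl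

end PartialFourierSchwartz

theorem hasTemperateGrowth_cexp :
    Function.HasTemperateGrowth fun s : ℝ => Complex.exp (2 * Real.pi * Complex.I * (s : ℂ)) := by
  refine ⟨(contDiff_const.mul Complex.ofRealCLM.contDiff).cexp, fun n => ⟨0, (2 * Real.pi) ^ n, fun x => ?_⟩⟩
  have h : ∀ n : ℕ, iteratedDeriv n
      (fun s : ℝ => Complex.exp (2 * Real.pi * Complex.I * (s : ℂ))) = fun s : ℝ =>
        (2 * Real.pi * Complex.I) ^ n * Complex.exp (2 * Real.pi * Complex.I * (s : ℂ)) := by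
    intro n
    induction n with
    | zero => simp
    | succ n ih =>
      rw [iteratedDeriv_succ, ih]
      ext s
      have h1 : HasDerivAt (fun s : ℝ => (s : ℂ)) 1 s := Complex.ofRealCLM.hasDerivAt
      have h2 := (((h1.const_mul (2 * Real.pi * Complex.I)).cexp).const_mul
        ((2 * Real.pi * Complex.I) ^ n)).deriv
      rw [h2]
      ring
  rw [norm_iteratedFDeriv_eq_norm_iteratedDeriv, h, norm_mul, Complex.norm_exp]
  simp [abs_of_pos Real.pi_pos]

theorem hasTemperateGrowth_modulation (ω : EuclideanSpace ℝ ι) :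
    Function.HasTemperateGrowth fun t : EuclideanSpace ℝ ι =>
      Complex.exp (2 * Real.pi * Complex.I * ((inner ℝ t ω : ℝ) : ℂ)) :=
  hasTemperateGrowth_cexp.comp (Function.hasTemperateGrowth_inner_left ω)

/-- The time-frequency shift `π(x, ω) f = M_ω T_x f`, i.e. `t ↦ e^{2πi t·ω} f(t - x)`. -/
def tfShift (z : EuclideanSpace ℝ ι × EuclideanSpace ℝ ι) (f : EuclideanSpace ℝ ι → ℂ)
    (t : EuclideanSpace ℝ ι) : ℂ :=
  Complex.exp (2 * Real.pi * Complex.I * ((inner ℝ t z.2 : ℝ) : ℂ)) * f (t - z.1)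

/-- The time-frequency shift `π(x, ω)` on the Schwartz space. -/
def tfShiftS (z : EuclideanSpace ℝ ι × EuclideanSpace ℝ ι) :
    𝓢(EuclideanSpace ℝ ι, ℂ) →L[ℂ] 𝓢(EuclideanSpace ℝ ι, ℂ) :=
  (SchwartzMap.smulLeftCLM ℂ fun t : EuclideanSpace ℝ ι =>
      Complex.exp (2 * Real.pi * Complex.I * ((inner ℝ t z.2 : ℝ) : ℂ))).comp
    (SchwartzMap.compSubConstCLM ℂ z.1)

theorem tfShiftS_apply (z : EuclideanSpace ℝ ι × EuclideanSpace ℝ ι)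
    (φ : 𝓢(EuclideanSpace ℝ ι, ℂ)) (t : EuclideanSpace ℝ ι) :
    tfShiftS z φ t = tfShift z φ t := by
  simp only [tfShiftS, tfShift, ContinuousLinearMap.comp_apply]
  rw [SchwartzMap.smulLeftCLM_apply_apply (hasTemperateGrowth_modulation z.2)]
  simp

/-- Complex conjugation on the Schwartz space. -/
def conjS : 𝓢(EuclideanSpace ℝ ι, ℂ) →L[ℝ] 𝓢(EuclideanSpace ℝ ι, ℂ) :=
  SchwartzMap.postcompCLM (𝕜 := ℝ) (Complex.conjCLE : ℂ →L[ℝ] ℂ)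

theorem conjS_apply (φ : 𝓢(EuclideanSpace ℝ ι, ℂ)) (t : EuclideanSpace ℝ ι) :
    conjS φ t = conj (φ t) := rfl

/-- The short-time Fourier transform `V_φ f(x, ω) = ⟨f, π(x, ω) φ⟩` of a function. -/
def stftFun (φ f : EuclideanSpace ℝ ι → ℂ) (z : EuclideanSpace ℝ ι × EuclideanSpace ℝ ι) : ℂ :=
  ∫ t, f t * conj (tfShift z φ t)

/-- The short-time Fourier transform `V_φ u(x, ω) = ⟨u, π(x, ω) φ⟩` of a tempered distribution;
the bracket is conjugate linear in the second argument, whereas Mathlib's evaluation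
`u φ` of a tempered distribution is linear in `φ`. -/
def stft (φ : 𝓢(EuclideanSpace ℝ ι, ℂ)) (u : 𝓢'(EuclideanSpace ℝ ι, ℂ))
    (z : EuclideanSpace ℝ ι × EuclideanSpace ℝ ι) : ℂ :=
  u (conjS (tfShiftS z φ))

theorem gaussian_decay (k n : ℕ) : ∃ C : ℝ, ∀ x : EuclideanSpace ℝ ι,
    ‖x‖ ^ k * ‖iteratedFDeriv ℝ n (fun t : EuclideanSpace ℝ ι => Real.exp (-Real.pi * ‖t‖ ^ 2)) x‖
      ≤ C := by
  have hf : Function.HasTemperateGrowth fun t : EuclideanSpace ℝ ι => -Real.pi * ‖t‖ ^ 2 :=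
    (Function.HasTemperateGrowth.const (-Real.pi)).mul (Function.hasTemperateGrowth_norm_sq _)
  obtain ⟨m, B, hB, hD⟩ := hf.norm_iteratedFDeriv_le_uniform n
  -- `x ↦ (1 + x) ^ N e^{-π x²}` is bounded
  have hbd : ∀ N : ℕ, ∃ K : ℝ, ∀ r : ℝ, 0 ≤ r → (1 + r) ^ N * Real.exp (-Real.pi * r ^ 2) ≤ K := by
    intro N
    refine ⟨N.factorial * Real.exp 2, fun r hr => ?_⟩
    have h1 : (1 + r) ^ N / N.factorial ≤ Real.exp (1 + r) :=
      Real.pow_div_factorial_le_exp (1 + r) (by positivity) N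
    rw [div_le_iff₀ (by positivity)] at h1
    have h2 : Real.exp (1 + r) * Real.exp (-Real.pi * r ^ 2) ≤ Real.exp 2 := by
      rw [← Real.exp_add]
      apply Real.exp_le_exp.2
      nlinarith [Real.pi_gt_three, sq_nonneg (r - 1), sq_nonneg r]
    calc _ ≤ Real.exp (1 + r) * N.factorial * Real.exp (-Real.pi * r ^ 2) := by gcongr
      _ = N.factorial * (Real.exp (1 + r) * Real.exp (-Real.pi * r ^ 2)) := by ring
      _ ≤ _ := by gcongr
  obtain ⟨K, hK⟩ := hbd (k + m * n)
  refine ⟨n.factorial * (1 + B) ^ n * K, fun x => ?_⟩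
  have h1 := norm_iteratedFDeriv_comp_le (𝕜 := ℝ) (g := Real.exp)
    (f := fun t : EuclideanSpace ℝ ι => -Real.pi * ‖t‖ ^ 2) (n := n) (N := ((⊤ : ℕ∞) : WithTop ℕ∞))
    (C := Real.exp (-Real.pi * ‖x‖ ^ 2)) (D := (1 + B) * (1 + ‖x‖) ^ m)
    Real.contDiff_exp hf.1 (by exact_mod_cast le_top) x
    (fun i _ => by
      rw [norm_iteratedFDeriv_eq_norm_iteratedDeriv, iteratedDeriv_eq_iterate, Real.iter_deriv_exp,
        Real.norm_eq_abs, abs_of_pos (Real.exp_pos _)])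
    (fun i hi hi' => by
      have hone : 1 ≤ (1 + B) * (1 + ‖x‖) ^ m :=
        one_le_mul_of_one_le_of_one_le (by linarith) (one_le_pow₀ (by linarith [norm_nonneg x]))
      refine (hD i hi' x).trans (le_trans ?_ (le_self_pow₀ hone (by omega)))
      gcongr
      linarith)
  have h2 : (Real.exp ∘ fun t : EuclideanSpace ℝ ι => -Real.pi * ‖t‖ ^ 2) =
    fun t : EuclideanSpace ℝ ι => Real.exp (-Real.pi * ‖t‖ ^ 2) := rfl
  rw [h2] at h1
  have h3 : ‖x‖ ^ k ≤ (1 + ‖x‖) ^ k := by gcongr; linarith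
  calc _ ≤ (1 + ‖x‖) ^ k * (n.factorial * Real.exp (-Real.pi * ‖x‖ ^ 2) *
          ((1 + B) * (1 + ‖x‖) ^ m) ^ n) := by gcongr
    _ = n.factorial * (1 + B) ^ n *
          ((1 + ‖x‖) ^ (k + m * n) * Real.exp (-Real.pi * ‖x‖ ^ 2)) := by
        rw [mul_pow, ← pow_mul, pow_add]; ring
    _ ≤ _ := by gcongr; exact hK _ (norm_nonneg x)

/-- The real Gaussian `e^{-π |t|²}` as a Schwartz function. -/
def realGaussian (ι : Type) [Fintype ι] : 𝓢(EuclideanSpace ℝ ι, ℝ) where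
  toFun t := Real.exp (-Real.pi * ‖t‖ ^ 2)
  smooth' := Real.contDiff_exp.comp (contDiff_const.mul (contDiff_norm_sq ℝ))
  decay' := gaussian_decay

/-- The window: the Gaussian `2^{d/4} e^{-π |t|²}` on `ℝᵈ`, normalized in `L²`. -/
def gaussian (ι : Type) [Fintype ι] : 𝓢(EuclideanSpace ℝ ι, ℂ) :=
  ((2 : ℝ) ^ ((Fintype.card ι : ℝ) / 4)) •
    SchwartzMap.postcompCLM (𝕜 := ℝ) Complex.ofRealCLM (realGaussian ι)

theorem gaussian_apply (t : EuclideanSpace ℝ ι) :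
    gaussian ι t = ((2 : ℝ) ^ ((Fintype.card ι : ℝ) / 4) * Real.exp (-Real.pi * ‖t‖ ^ 2) : ℝ) := by
  have h : realGaussian ι t = Real.exp (-Real.pi * ‖t‖ ^ 2) := rfl
  simp [gaussian, h]


theorem stft_add (φ : 𝓢(EuclideanSpace ℝ ι, ℂ)) (u v : 𝓢'(EuclideanSpace ℝ ι, ℂ)) :
    stft φ (u + v) = stft φ u + stft φ v := rfl

theorem stft_smul (φ : 𝓢(EuclideanSpace ℝ ι, ℂ)) (c : ℂ) (u : 𝓢'(EuclideanSpace ℝ ι, ℂ)) :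
    stft φ (c • u) = c • stft φ u := rfl

/-- The set of tempered distributions `u` with `V_φ u ∈ Lᵖ`, where `φ` is the Gaussian. -/
def modulationSubmodule (p : ℝ≥0∞) (ι : Type) [Fintype ι] :
    Submodule ℂ 𝓢'(EuclideanSpace ℝ ι, ℂ) where
  carrier := {u | MemLp (stft (gaussian ι) u) p volume}
  add_mem' := fun hu hv => MemLp.add hu hv
  zero_mem' := MemLp.zero
  smul_mem' := fun c _ hu => MemLp.const_smul hu c

/-- The modulation space `Mᵖ(ℝᵈ)`, with the norm `‖u‖ = ‖V_φ u‖_{Lᵖ}`. -/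
def ModulationSpace (p : ℝ≥0∞) (ι : Type) [Fintype ι] : Type := modulationSubmodule p ι

namespace ModulationSpace

variable {p : ℝ≥0∞}

instance : AddCommGroup (ModulationSpace p ι) :=
  inferInstanceAs (AddCommGroup (modulationSubmodule p ι))

instance : Module ℂ (ModulationSpace p ι) :=
  inferInstanceAs (Module ℂ (modulationSubmodule p ι))

/-- The tempered distribution underlying an element of `Mᵖ`. -/
def toDist : ModulationSpace p ι →ₗ[ℂ] 𝓢'(EuclideanSpace ℝ ι, ℂ) :=
  (modulationSubmodule p ι).subtype

theorem memLp (u : ModulationSpace p ι) : MemLp (stft (gaussian ι) u.toDist) p volume := u.2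

/-- The `Mᵖ` norm, as a seminorm. -/
def normM [hp : Fact (1 ≤ p)] : Seminorm ℂ (ModulationSpace p ι) :=
  Seminorm.of (fun u => (eLpNorm (stft (gaussian ι) u.toDist) p volume).toReal)
    (fun u v => by
      rw [map_add, stft_add, ← ENNReal.toReal_add u.memLp.2.ne v.memLp.2.ne]
      exact ENNReal.toReal_mono (ENNReal.add_ne_top.2 ⟨u.memLp.2.ne, v.memLp.2.ne⟩)
        (eLpNorm_add_le u.memLp.1 v.memLp.1 hp.out))
    (fun c u => by
      rw [map_smul, stft_smul, eLpNorm_const_smul, ENNReal.toReal_mul]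
      simp)

instance [Fact (1 ≤ p)] : SeminormedAddCommGroup (ModulationSpace p ι) :=
  normM.toAddGroupSeminorm.toSeminormedAddCommGroup

theorem norm_def [Fact (1 ≤ p)] (u : ModulationSpace p ι) :
    ‖u‖ = (eLpNorm (stft (gaussian ι) u.toDist) p volume).toReal := rfl

instance [Fact (1 ≤ p)] : NormedSpace ℂ (ModulationSpace p ι) where
  norm_smul_le c u := (map_smul_eq_mul normM c u).le

end ModulationSpace

theorem norm_tfShift (z : EuclideanSpace ℝ ι × EuclideanSpace ℝ ι) (f : EuclideanSpace ℝ ι → ℂ)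
    (t : EuclideanSpace ℝ ι) : ‖tfShift z f t‖ = ‖f (t - z.1)‖ := by
  rw [tfShift, norm_mul, Complex.norm_exp]
  simp

theorem integrable_stftFun {f : EuclideanSpace ℝ ι → ℂ} (hf : Integrable f)
    (z : EuclideanSpace ℝ ι × EuclideanSpace ℝ ι) :
    Integrable fun t => f t * conj (tfShift z (gaussian ι) t) := by
  have h : (fun t => conj (tfShift z (gaussian ι) t)) = conjS (tfShiftS z (gaussian ι)) := by
    ext t; rw [conjS_apply, tfShiftS_apply]
  have h' := hf.mul_bdd (g := conjS (tfShiftS z (gaussian ι)))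
    (c := SchwartzMap.seminorm ℂ 0 0 (conjS (tfShiftS z (gaussian ι))))
    (conjS (tfShiftS z (gaussian ι))).continuous.aestronglyMeasurable
    (Filter.Eventually.of_forall fun t => norm_le_seminorm ℂ _ t)
  rwa [← h] at h'

/-- The functions `f` that are continuous and integrable with `V_φ f ∈ L¹`, where `φ` is the
Gaussian. -/
def feichtingerSubmodule (ι : Type) [Fintype ι] : Submodule ℂ (EuclideanSpace ℝ ι → ℂ) where
  carrier := {f | Continuous f ∧ Integrable f ∧ Integrable (stftFun (gaussian ι) f)}
  add_mem' := by
    rintro f g ⟨hf, hf', hf''⟩ ⟨hg, hg', hg''⟩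
    refine ⟨hf.add hg, hf'.add hg', (hf''.add hg'').congr (Filter.Eventually.of_forall fun z => ?_)⟩
    simp only [Pi.add_apply, stftFun, add_mul]
    exact (integral_add (integrable_stftFun hf' z) (integrable_stftFun hg' z)).symm
  zero_mem' := by
    refine ⟨continuous_const, integrable_zero _ _ _, ?_⟩
    have : stftFun (gaussian ι) 0 = 0 := by ext z; simp [stftFun]
    rw [this]
    exact integrable_zero _ _ _
  smul_mem' := by
    rintro c f ⟨hf, hf', hf''⟩
    refine ⟨hf.const_smul c, hf'.smul c,
      (hf''.smul c).congr (Filter.Eventually.of_forall fun z => ?_)⟩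
    simp only [Pi.smul_apply, stftFun, smul_eq_mul, mul_assoc]
    exact (integral_const_mul _ _).symm

/-- The Feichtinger algebra `M¹(ℝᵈ)`, with the norm `‖f‖ = ‖V_φ f‖_{L¹}`. Every element of `M¹`
is integrable and has a unique continuous representative, so that `M¹` is regarded as a space of
functions. -/
def M1 (ι : Type) [Fintype ι] : Type := feichtingerSubmodule ι

namespace M1

instance : AddCommGroup (M1 ι) := inferInstanceAs (AddCommGroup (feichtingerSubmodule ι))

instance : Module ℂ (M1 ι) := inferInstanceAs (Module ℂ (feichtingerSubmodule ι))

instance : CoeFun (M1 ι) fun _ => EuclideanSpace ℝ ι → ℂ := ⟨fun f => f.1⟩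

theorem integrable (f : M1 ι) : Integrable f := f.2.2.1

theorem integrable_stft (f : M1 ι) : Integrable (stftFun (gaussian ι) f) := f.2.2.2

/-- The `M¹` norm, as a seminorm. -/
def normM : Seminorm ℂ (M1 ι) :=
  Seminorm.of (fun f => ∫ z, ‖stftFun (gaussian ι) f z‖)
    (fun f g => by
      rw [← integral_add f.integrable_stft.norm g.integrable_stft.norm]
      refine integral_mono (f + g).integrable_stft.norm
        (f.integrable_stft.norm.add g.integrable_stft.norm) fun z => ?_
      have : stftFun (gaussian ι) (f + g : M1 ι) z =
          stftFun (gaussian ι) f z + stftFun (gaussian ι) g z := by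
        have h := integral_add (integrable_stftFun f.integrable z)
          (integrable_stftFun g.integrable z)
        simp only [← add_mul] at h
        exact h
      change ‖stftFun (gaussian ι) (f + g : M1 ι) z‖ ≤ _
      rw [this]
      exact norm_add_le _ _)
    (fun c f => by
      rw [← integral_const_mul]
      congr 1
      ext z
      have : stftFun (gaussian ι) (c • f : M1 ι) z = c * stftFun (gaussian ι) f z := by
        have h := integral_const_mul (μ := volume) c
          (fun t => f t * conj (tfShift z (gaussian ι) t))
        simp only [← mul_assoc] at h
        exact h
      rw [this, norm_mul])

instance : SeminormedAddCommGroup (M1 ι) := normM.toAddGroupSeminorm.toSeminormedAddCommGroup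

theorem norm_def (f : M1 ι) : ‖f‖ = ∫ z, ‖stftFun (gaussian ι) f z‖ := rfl

instance : NormedSpace ℂ (M1 ι) where
  norm_smul_le c u := (map_smul_eq_mul normM c u).le

/-- The tempered distribution `φ ↦ ∫ φ f` of an element `f` of `M¹`. -/
def toDist (f : M1 ι) : 𝓢'(EuclideanSpace ℝ ι, ℂ) := 
  Lp.toTemperedDistribution (f.integrable.toL1 f)

theorem toDist_apply (f : M1 ι) (φ : 𝓢(EuclideanSpace ℝ ι, ℂ)) : f.toDist φ = ∫ t, φ t * f t := by
  rw [toDist, Lp.toTemperedDistribution_apply]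
  refine integral_congr_ae ?_
  filter_upwards [f.integrable.coeFn_toL1] with t ht
  rw [ht, smul_eq_mul]

theorem stft_toDist (f : M1 ι) (φ : 𝓢(EuclideanSpace ℝ ι, ℂ)) :
    stft φ f.toDist = stftFun φ f := by
  ext z
  rw [stft, toDist_apply, stftFun]
  refine integral_congr_ae (Filter.Eventually.of_forall fun t => ?_)
  change conjS (tfShiftS z φ) t * f t = f t * conj (tfShift z φ t)
  rw [conjS_apply, tfShiftS_apply, mul_comm]

theorem toDist_mem (f : M1 ι) : f.toDist ∈ modulationSubmodule 1 ι := by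
  change MemLp _ _ _
  rw [stft_toDist, memLp_one_iff_integrable]
  exact f.integrable_stft

end M1

/-- The duality bracket `⟨u, Φ⟩ = ∬ V_φ u(x, ω) conj (V_φ Φ(x, ω)) dx dω` between `u ∈ M^∞` and
`Φ ∈ M¹`, which extends the inner product `∫ u(t) conj (Φ(t)) dt` of `L²` (the Gaussian `φ` has
norm one in `L²`). -/
def bracket (u : 𝓢'(EuclideanSpace ℝ ι, ℂ)) (Φ : EuclideanSpace ℝ ι → ℂ) : ℂ :=
  ∫ z : EuclideanSpace ℝ ι × EuclideanSpace ℝ ι,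
    stft (gaussian ι) u z * conj (stftFun (gaussian ι) Φ z)

/-- The partial Fourier transform `𝓕₂` of a tempered distribution on `ℝ²ᵈ`, extending that of
functions: `(𝓕₂ k)(Ψ) = k(𝓕₂ Ψ)`. -/
def partialFourierDist (k : 𝓢'(EuclideanSpace ℝ (ι ⊕ ι), ℂ)) :
    𝓢'(EuclideanSpace ℝ (ι ⊕ ι), ℂ) :=
  PointwiseConvergenceCLM.precomp ℂ partialFourierCLM k

theorem partialFourierDist_apply (k : 𝓢'(EuclideanSpace ℝ (ι ⊕ ι), ℂ))
    (Ψ : 𝓢(EuclideanSpace ℝ (ι ⊕ ι), ℂ)) :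
    partialFourierDist k Ψ = k (partialFourierCLM Ψ) := rfl

/-- The tensor product `(f ⊗ g)(x, y) = f(x) g(y)`. -/
def tensor (f g : EuclideanSpace ℝ ι → ℂ) (z : EuclideanSpace ℝ (ι ⊕ ι)) : ℂ :=
  f (fstL z) * g (sndL z)

/-- `T` is the integral operator with kernel `k`: `⟨T f, g⟩ = ⟨k, g ⊗ conj f⟩`. -/
def IsIntegralOp (T : M1 ι →L[ℂ] ModulationSpace ∞ ι) (k : ModulationSpace ∞ (ι ⊕ ι)) : Prop :=
  ∀ f g : M1 ι, bracket (T f).toDist g = bracket k.toDist (tensor g fun t => conj (f t))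

/-- `T = ∬ F(x, ω) π(x, ω) dx dω` in the weak sense: `⟨T f, g⟩ = "∬ F(x, ω) ⟨π(x, ω) f, g⟩ dx dω"`,
that is, `⟨T f, g⟩ = ⟨F, Φ⟩` with `Φ(x, ω) = conj ⟨π(x, ω) f, g⟩`, which is `V_f g(x, ω)`. -/
def IsSpreadingOp (T : M1 ι →L[ℂ] ModulationSpace ∞ ι) (F : ModulationSpace ∞ (ι ⊕ ι)) : Prop :=
  ∀ f g : M1 ι, bracket (T f).toDist g =
    bracket F.toDist fun z => conj (∫ t, tfShift (fstL z, sndL z) f t * conj (g t))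

variable [DecidableEq ι]

/-- The invertible linear map `z ↦ A z` of `ℝⁿ`. -/
def matrixEquiv (A : GL ι ℝ) : EuclideanSpace ℝ ι ≃L[ℝ] EuclideanSpace ℝ ι :=
  ContinuousLinearEquiv.unitsEquiv ℝ (EuclideanSpace ℝ ι)
    (Units.map (Matrix.toEuclideanCLM (n := ι) (𝕜 := ℝ)).toMonoidHom A)

theorem matrixEquiv_apply (A : GL ι ℝ) (z : EuclideanSpace ℝ ι) (i : ι) :
    matrixEquiv A z i = ∑ j, (A : Matrix ι ι ℝ) i j * z j := rfl

theorem matrixEquiv_inv (A : GL ι ℝ) : matrixEquiv A⁻¹ = (matrixEquiv A).symm := by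
  simp only [matrixEquiv, map_inv]
  rfl

/-- The coordinate change `(𝔗_A F)(z) = F(A z)` of a function. -/
def coordChange (A : GL ι ℝ) (F : EuclideanSpace ℝ ι → ℂ) (z : EuclideanSpace ℝ ι) : ℂ :=
  F (matrixEquiv A z)

/-- The coordinate change `𝔗_A` of a tempered distribution, extending that of functions:
`(𝔗_A k)(Ψ) = |det A|⁻¹ k(𝔗_{A⁻¹} Ψ)`. -/
def coordChangeDist (A : GL ι ℝ) (k : 𝓢'(EuclideanSpace ℝ ι, ℂ)) : 𝓢'(EuclideanSpace ℝ ι, ℂ) :=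
  ((|(A : Matrix ι ι ℝ).det|⁻¹ : ℝ) : ℂ) • PointwiseConvergenceCLM.precomp ℂ
    (SchwartzMap.compCLMOfContinuousLinearEquiv ℂ (matrixEquiv A⁻¹)) k

theorem coordChangeDist_apply (A : GL ι ℝ) (k : 𝓢'(EuclideanSpace ℝ ι, ℂ))
    (Ψ : 𝓢(EuclideanSpace ℝ ι, ℂ)) :
    coordChangeDist A k Ψ = ((|(A : Matrix ι ι ℝ).det|⁻¹ : ℝ) : ℂ) *
      k (SchwartzMap.compCLMOfContinuousLinearEquiv ℂ (matrixEquiv A⁻¹) Ψ) := rfl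

/-- The matrix-Wigner distribution `𝓑_A(f, g) = 𝓕₂ 𝔗_A (f ⊗ conj g)`. -/
def matrixWigner (A : GL (ι ⊕ ι) ℝ) (f g : EuclideanSpace ℝ ι → ℂ) :
    EuclideanSpace ℝ (ι ⊕ ι) → ℂ :=
  partialFourier (coordChange A (tensor f fun t => conj (g t)))

/-- The matrix `A_ST = [[0, I], [-I, I]]`. -/
def matrixST (ι : Type) [Fintype ι] [DecidableEq ι] : GL (ι ⊕ ι) ℝ :=
  Matrix.GeneralLinearGroup.mkOfDetNeZero (Matrix.fromBlocks 0 1 (-1) 1)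
    (by rw [Matrix.det_fromBlocks_one₂₂]; simp)

/-- `T = σ^A`, where `σ^A` is the pseudodifferential operator with symbol `σ` associated with `𝓑_A`:
`⟨T f, g⟩ = ⟨σ, 𝓑_A(g, f)⟩`. -/
def IsPseudodiffOp (A : GL (ι ⊕ ι) ℝ) (T : M1 ι →L[ℂ] ModulationSpace ∞ ι)
    (σ : ModulationSpace ∞ (ι ⊕ ι)) : Prop :=
  ∀ f g : M1 ι, bracket (T f).toDist g = bracket σ.toDist (matrixWigner A g f)

end MatrixWigner

end

open MatrixWigner

noncomputable section

namespace MatrixWigner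

variable {ι : Type} [Fintype ι]

/-! The shifts `π(z)φ` of the Gaussian act as a continuous basis. Every `f` in `M¹` is the
superposition `∫ Vf(z) π(z)φ dz` with integrable coefficients, and a functional bounded in a
(weighted) `M¹` norm may be applied under this integral (`functional_inversion`). With polynomial
weights this covers all tempered distributions: they are determined by their short-time Fourier
transform, and the bracket with a Schwartz function is evaluation at its conjugate
(`bracket_schwartz`).

Kernel: `T` is described by the coefficients `V(T π(z)φ)(w)`, which are bounded because all the
`π(z)φ` have the same `M¹` norm. Integrating such a bounded function against short-time Fourier
transforms defines an element `k` of `M^∞` (`synthesis`). The Gaussian of `ℝ²ᵈ` is a product, so the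
transform of a tensor product factors, and `⟨k, g ⊗ conj f⟩` collapses to `⟨Tf, g⟩` by inversion in
`z` (`exists_isIntegralOp`).

Symbol: `𝓑_A(g, f)` is the image of `g ⊗ conj f` under `𝓕₂ 𝔗_A`, which carries time-frequency shifts
to time-frequency shifts up to unimodular factors. Composition with such covariant operators
preserves `M^∞`, and adjoint relations valid on Schwartz functions extend to `M¹` by superposition
(`bracket_compModulation`). Hence `σ = k ∘ 𝔗_{A⁻¹} 𝓕₂` is a symbol, and it equals `|det A| 𝓕₂ 𝔗_A
k`.

Relations: every shift of the Gaussian of `ℝ²ᵈ` has itself the form `g ⊗ conj f`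
(`exists_shift_tensor`), so the representing identities determine `σ` from `k` (`symbol_unique`).
The spreading function is the special case `A = A_ST`, because `𝓑_{A_ST}(g, f) = V_f g`; here the
determinant is one. -/

/-- The phase space `ℝᵈ × ℝᵈ` of time-frequency shifts. -/
abbrev Phase (ι : Type) : Type := EuclideanSpace ℝ ι × EuclideanSpace ℝ ι

/-! ### Fubini's theorem with bounded kernels. -/

section Fubini

variable {α β : Type*} [MeasurableSpace α] [MeasurableSpace β] {μ : Measure α} {ν : Measure β}


theorem integrable_prod_bounded_kernel {c : α → ℂ} {ψ : β → ℂ} {K : α → β → ℂ} {M : ℝ}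
    (hc : Integrable c μ) (hψ : Integrable ψ ν)
    (hK : AEStronglyMeasurable (Function.uncurry K) (μ.prod ν)) (hM : ∀ x y, ‖K x y‖ ≤ M) :
    Integrable (fun p : α × β => c p.1 * (K p.1 p.2 * ψ p.2)) (μ.prod ν) := by
  have h := (hc.mul_prod hψ).bdd_mul (c := M) hK (Filter.Eventually.of_forall fun p => hM p.1 p.2)
  refine h.congr (Filter.Eventually.of_forall fun p => ?_)
  simp only [Function.uncurry]
  ring

theorem integral_integral_bounded_kernel [SFinite μ] [SFinite ν] {c : α → ℂ} {ψ : β → ℂ} {K : α → β → ℂ} {M : ℝ}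
    (hc : Integrable c μ) (hψ : Integrable ψ ν)
    (hK : AEStronglyMeasurable (Function.uncurry K) (μ.prod ν)) (hM : ∀ x y, ‖K x y‖ ≤ M) :
    ∫ y, (∫ x, c x * K x y ∂μ) * ψ y ∂ν = ∫ x, c x * ∫ y, K x y * ψ y ∂ν ∂μ := by
  have h := integrable_prod_bounded_kernel hc hψ hK hM
  calc _ = ∫ y, ∫ x, c x * (K x y * ψ y) ∂μ ∂ν := by
        congr 1; ext y; rw [← integral_mul_const]; congr 1; ext x; ring
    _ = ∫ x, ∫ y, c x * (K x y * ψ y) ∂ν ∂μ := (integral_integral_swap h).symm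
    _ = _ := by congr 1; ext x; rw [integral_const_mul]

end Fubini

/-! ### Inversion and reproducing formulas for the short-time Fourier transform. -/

theorem conj_gaussian (t : EuclideanSpace ℝ ι) : conj (gaussian ι t) = gaussian ι t := by
  rw [gaussian_apply, Complex.conj_ofReal]

theorem integral_gaussian_sq : ∫ t, gaussian ι t * gaussian ι t = 1 := by
  have h1 : ∀ t : EuclideanSpace ℝ ι, gaussian ι t * gaussian ι t =
      (((2 : ℝ) ^ ((Fintype.card ι : ℝ) / 2) * Real.exp (-(2 * Real.pi) * ‖t‖ ^ 2) : ℝ) : ℂ) := by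
    intro t
    rw [gaussian_apply, ← Complex.ofReal_mul]
    congr 1
    rw [mul_mul_mul_comm, ← Real.rpow_add two_pos, ← Real.exp_add]
    congr 2 <;> ring
  simp_rw [h1]
  rw [integral_complex_ofReal, integral_const_mul,
    GaussianFourier.integral_rexp_neg_mul_sq_norm (by positivity)]
  have h2 : Real.pi / (2 * Real.pi) = (2 : ℝ)⁻¹ := by field_simp
  rw [h2, finrank_euclideanSpace, Real.inv_rpow two_pos.le, mul_inv_cancel₀ (by positivity)]
  simp

theorem integral_gaussian_sub_sq (t : EuclideanSpace ℝ ι) :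
    ∫ x, gaussian ι (t - x) * gaussian ι (t - x) = 1 := by
  rw [integral_sub_left_eq_self (fun x => gaussian ι x * gaussian ι x) volume t]
  exact integral_gaussian_sq

theorem continuous_tfShift {φ : EuclideanSpace ℝ ι → ℂ} (hφ : Continuous φ) :
    Continuous fun p : Phase ι × EuclideanSpace ℝ ι => tfShift p.1 φ p.2 := by
  unfold tfShift
  fun_prop

theorem continuous_tfShift_left {φ : EuclideanSpace ℝ ι → ℂ} (hφ : Continuous φ)
    (t : EuclideanSpace ℝ ι) : Continuous fun z : Phase ι => tfShift z φ t := by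
  unfold tfShift
  fun_prop

theorem norm_tfShift_le (z : Phase ι) (φ : 𝓢(EuclideanSpace ℝ ι, ℂ)) (t : EuclideanSpace ℝ ι) :
    ‖tfShift z φ t‖ ≤ SchwartzMap.seminorm ℂ 0 0 φ := by
  rw [norm_tfShift]
  exact norm_le_seminorm ℂ φ _

theorem integrable_conj_tfShift (z : Phase ι) (φ : 𝓢(EuclideanSpace ℝ ι, ℂ)) :
    Integrable (fun t => conj (tfShift z φ t)) := by
  have h : (fun t => conj (tfShift z φ t)) = conjS (tfShiftS z φ) := by
    ext t; rw [conjS_apply, tfShiftS_apply]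
  rw [h]
  exact (conjS (tfShiftS z φ)).integrable

theorem stftFun_eq_fourier (f : EuclideanSpace ℝ ι → ℂ) (x ω : EuclideanSpace ℝ ι) :
    stftFun (gaussian ι) f (x, ω) = 𝓕 (fun t => f t * gaussian ι (t - x)) ω := by
  rw [stftFun, Real.fourier_eq']
  congr 1
  ext t
  rw [tfShift, map_mul, conj_gaussian, ← Complex.exp_conj, smul_eq_mul]
  simp only [map_mul, Complex.conj_ofReal, Complex.conj_I, map_ofNat]
  have : 2 * (Real.pi : ℂ) * -Complex.I * ((inner ℝ t ω : ℝ) : ℂ) =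
      ((-2 * Real.pi * inner ℝ t ω : ℝ) : ℂ) * Complex.I := by push_cast; ring
  rw [this]
  ring

/-- Pointwise inversion of the short-time Fourier transform. -/
theorem stftFun_inversion {f : EuclideanSpace ℝ ι → ℂ} (hc : Continuous f) (hi : Integrable f)
    (hV : Integrable (stftFun (gaussian ι) f)) (t : EuclideanSpace ℝ ι) :
    ∫ z, stftFun (gaussian ι) f z * tfShift z (gaussian ι) t = f t := by
  have hcont : Continuous fun z : Phase ι => tfShift z (gaussian ι) t :=
    continuous_tfShift_left (gaussian ι).continuous t
  have hint : Integrable (fun z => stftFun (gaussian ι) f z * tfShift z (gaussian ι) t) :=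
    hV.mul_bdd (c := SchwartzMap.seminorm ℂ 0 0 (gaussian ι)) hcont.aestronglyMeasurable
      (Filter.Eventually.of_forall fun z => norm_tfShift_le z _ t)
  have h1 : ∫ z, stftFun (gaussian ι) f z * tfShift z (gaussian ι) t =
      ∫ x, ∫ ω, stftFun (gaussian ι) f (x, ω) * tfShift (x, ω) (gaussian ι) t :=
    integral_prod _ hint
  rw [h1]
  -- For almost every `x` the section `Vf(x, ·)` is integrable. It is the Fourier transform of the
  -- continuous integrable function `f φ(· - x)`, so Fourier inversion holds at the given point `t`.
  -- The remaining integral over `x` is the squared `L²` norm of `φ`, which is one.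
  have h2 : ∀ᵐ x : EuclideanSpace ℝ ι, ∫ ω, stftFun (gaussian ι) f (x, ω) *
      tfShift (x, ω) (gaussian ι) t = f t * (gaussian ι (t - x) * gaussian ι (t - x)) := by
    filter_upwards [Integrable.prod_right_ae (μ := volume) (ν := volume) hV] with x hx
    have e : (fun ω => stftFun (gaussian ι) f (x, ω)) =
        𝓕 (fun t => f t * gaussian ι (t - x)) := funext fun ω => stftFun_eq_fourier f x ω
    have hg : Continuous fun t => gaussian ι (t - x) :=
      (gaussian ι).continuous.comp (continuous_id.sub continuous_const)
    have hh : Integrable fun t => f t * gaussian ι (t - x) :=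
      hi.mul_bdd (c := SchwartzMap.seminorm ℂ 0 0 (gaussian ι)) hg.aestronglyMeasurable
        (Filter.Eventually.of_forall fun s => norm_le_seminorm ℂ _ _)
    rw [e] at hx
    have hcg : Continuous fun t => f t * gaussian ι (t - x) := hc.mul hg
    have h3 := congrFun (hcg.fourierInv_fourier_eq hh hx) t
    rw [Real.fourierInv_eq', ← e] at h3
    rw [← mul_assoc, ← h3, ← integral_mul_const]
    congr 1
    ext ω
    rw [tfShift, smul_eq_mul, real_inner_comm]
    have : 2 * (Real.pi : ℂ) * Complex.I * ((inner ℝ ω t : ℝ) : ℂ) =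
      ((2 * Real.pi * inner ℝ ω t : ℝ) : ℂ) * Complex.I := by push_cast; ring
    rw [this]
    ring
  rw [integral_congr_ae h2, integral_const_mul, integral_gaussian_sub_sq, mul_one]

theorem stftFun_integral {α : Type*} [MeasurableSpace α] {μ : Measure α} [SFinite μ]
    {c : α → ℂ} {K : α → EuclideanSpace ℝ ι → ℂ} {M : ℝ} (hc : Integrable c μ)
    (hK : AEStronglyMeasurable (Function.uncurry K) (μ.prod volume)) (hM : ∀ x y, ‖K x y‖ ≤ M)
    (w : Phase ι) :
    stftFun (gaussian ι) (fun t => ∫ a, c a * K a t ∂μ) w =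
      ∫ a, c a * stftFun (gaussian ι) (K a) w ∂μ :=
  integral_integral_bounded_kernel hc (integrable_conj_tfShift w (gaussian ι)) hK hM

/-- The reproducing formula for the short-time Fourier transform. -/
theorem stftFun_reproducing {f : EuclideanSpace ℝ ι → ℂ} (hc : Continuous f) (hi : Integrable f)
    (hV : Integrable (stftFun (gaussian ι) f)) (w : Phase ι) :
    ∫ z, stftFun (gaussian ι) f z * stftFun (gaussian ι) (tfShift z (gaussian ι)) w =
      stftFun (gaussian ι) f w := by
  have h := stftFun_integral (K := fun z : Phase ι => tfShift z (gaussian ι)) hV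
    (continuous_tfShift (gaussian ι).continuous).aestronglyMeasurable
    (fun z t => norm_tfShift_le z (gaussian ι) t) w
  rw [← h]
  congr 1
  ext t
  exact stftFun_inversion hc hi hV t

/-! ### The short-time Fourier transform of Schwartz functions and its decay. -/

theorem norm_fstL_le : ‖(fstL : EuclideanSpace ℝ (ι ⊕ ι) →L[ℝ] _)‖ ≤ 1 := by
  refine ContinuousLinearMap.opNorm_le_bound _ zero_le_one fun z => ?_
  have h := norm_fst_le (fstL z) (sndL z)
  rwa [pair_fst_snd, ← one_mul ‖z‖] at h

theorem norm_sndL_le : ‖(sndL : EuclideanSpace ℝ (ι ⊕ ι) →L[ℝ] _)‖ ≤ 1 := by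
  refine ContinuousLinearMap.opNorm_le_bound _ zero_le_one fun z => ?_
  have h := norm_snd_le (fstL z) (sndL z)
  rwa [pair_fst_snd, ← one_mul ‖z‖] at h

theorem norm_iteratedFDeriv_comp_contraction
    (L : EuclideanSpace ℝ (ι ⊕ ι) →L[ℝ] EuclideanSpace ℝ ι) (hL : ‖L‖ ≤ 1)
    (φ : 𝓢(EuclideanSpace ℝ ι, ℂ)) (n : ℕ) (z : EuclideanSpace ℝ (ι ⊕ ι)) :
    ‖iteratedFDeriv ℝ n (fun z => φ (L z)) z‖ ≤ ‖iteratedFDeriv ℝ n φ (L z)‖ := by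
  have h := L.iteratedFDeriv_comp_right (f := φ) (n := ((⊤ : ℕ∞) : WithTop ℕ∞)) (φ.smooth ⊤) z
    (i := n) (by exact_mod_cast le_top)
  have h' : (fun z => φ (L z)) = φ ∘ L := rfl
  rw [h', h]
  refine (ContinuousMultilinearMap.norm_compContinuousLinearMap_le _ _).trans ?_
  exact mul_le_of_le_one_right (norm_nonneg _)
    (Finset.prod_le_one (fun _ _ => norm_nonneg _) (fun _ _ => hL))

theorem norm_pow_le_fst_snd (z : EuclideanSpace ℝ (ι ⊕ ι)) (k : ℕ) :
    ‖z‖ ^ k ≤ 2 ^ k * (‖fstL z‖ ^ k + ‖sndL z‖ ^ k) := by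
  have h0 : ‖z‖ ≤ ‖fstL z‖ + ‖sndL z‖ := by
    have := norm_pair_le (fstL z) (sndL z)
    rwa [pair_fst_snd] at this
  have h1 : ‖z‖ ≤ 2 * max ‖fstL z‖ ‖sndL z‖ := by
    linarith [le_max_left ‖fstL z‖ ‖sndL z‖, le_max_right ‖fstL z‖ ‖sndL z‖]
  calc ‖z‖ ^ k ≤ (2 * max ‖fstL z‖ ‖sndL z‖) ^ k := by gcongr
    _ = 2 ^ k * (max ‖fstL z‖ ‖sndL z‖) ^ k := mul_pow _ _ _
    _ ≤ _ := by
      gcongr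
      rcases max_choice ‖fstL z‖ ‖sndL z‖ with h | h <;> rw [h]
      · linarith [pow_nonneg (norm_nonneg (sndL z)) k]
      · linarith [pow_nonneg (norm_nonneg (fstL z)) k]

/-- Leibniz' rule; the polynomial weight splits over the two variables, and each part is absorbed by
the factor depending on that variable. The dependence on `φ` is kept as one supremum of seminorms
because continuity is needed in `φ` alone, for fixed `ψ`. -/
theorem tensor_decay (φ ψ : 𝓢(EuclideanSpace ℝ ι, ℂ)) (k n : ℕ) (z : EuclideanSpace ℝ (ι ⊕ ι)) :
    ‖z‖ ^ k * ‖iteratedFDeriv ℝ n (tensor φ ψ) z‖ ≤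
      (2 ^ k * ∑ i ∈ Finset.range (n + 1), (n.choose i : ℝ) *
        (SchwartzMap.seminorm ℂ 0 (n - i) ψ + SchwartzMap.seminorm ℂ k (n - i) ψ)) *
        (Finset.Iic (k, n)).sup (schwartzSeminormFamily ℂ (EuclideanSpace ℝ ι) ℂ) φ := by
  have hle : ∀ a b, a ≤ k → b ≤ n → SchwartzMap.seminorm ℂ a b φ ≤
      (Finset.Iic (k, n)).sup (schwartzSeminormFamily ℂ (EuclideanSpace ℝ ι) ℂ) φ := fun a b ha hb =>
    Seminorm.le_def.mp (Finset.le_sup (f := schwartzSeminormFamily ℂ (EuclideanSpace ℝ ι) ℂ)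
      (Finset.mem_Iic.2 (Prod.mk_le_mk.2 ⟨ha, hb⟩) : (a, b) ∈ Finset.Iic (k, n))) φ
  generalize (Finset.Iic (k, n)).sup (schwartzSeminormFamily ℂ (EuclideanSpace ℝ ι) ℂ) φ = S at hle ⊢
  have hφ : ContDiff ℝ ((⊤ : ℕ∞) : WithTop ℕ∞) fun z : EuclideanSpace ℝ (ι ⊕ ι) => φ (fstL z) :=
    (φ.smooth ⊤).comp (fstL : EuclideanSpace ℝ (ι ⊕ ι) →L[ℝ] _).contDiff
  have hψ : ContDiff ℝ ((⊤ : ℕ∞) : WithTop ℕ∞) fun z : EuclideanSpace ℝ (ι ⊕ ι) => ψ (sndL z) :=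
    (ψ.smooth ⊤).comp (sndL : EuclideanSpace ℝ (ι ⊕ ι) →L[ℝ] _).contDiff
  have h1 := norm_iteratedFDeriv_mul_le hφ hψ z (n := n) (by exact_mod_cast le_top)
  have h2 : ∀ i ∈ Finset.range (n + 1), (‖fstL z‖ ^ k + ‖sndL z‖ ^ k) *
      ((n.choose i : ℝ) * ‖iteratedFDeriv ℝ i (fun z : EuclideanSpace ℝ (ι ⊕ ι) => φ (fstL z)) z‖ *
        ‖iteratedFDeriv ℝ (n - i) (fun z : EuclideanSpace ℝ (ι ⊕ ι) => ψ (sndL z)) z‖) ≤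
      (n.choose i : ℝ) *
        (SchwartzMap.seminorm ℂ 0 (n - i) ψ + SchwartzMap.seminorm ℂ k (n - i) ψ) * S := by
    intro i hi
    have hi' : i ≤ n := by simpa [Nat.lt_succ_iff] using hi
    have ha := norm_iteratedFDeriv_comp_contraction fstL norm_fstL_le φ i z
    have hb := norm_iteratedFDeriv_comp_contraction sndL norm_sndL_le ψ (n - i) z
    have ha0 := norm_nonneg
      (iteratedFDeriv ℝ i (fun z : EuclideanSpace ℝ (ι ⊕ ι) => φ (fstL z)) z)
    have hb0 := norm_nonneg
      (iteratedFDeriv ℝ (n - i) (fun z : EuclideanSpace ℝ (ι ⊕ ι) => ψ (sndL z)) z)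
    generalize ‖iteratedFDeriv ℝ i (fun z : EuclideanSpace ℝ (ι ⊕ ι) => φ (fstL z)) z‖ = a at *
    generalize
      ‖iteratedFDeriv ℝ (n - i) (fun z : EuclideanSpace ℝ (ι ⊕ ι) => ψ (sndL z)) z‖ = b at *
    have ha1 : a ≤ S := ha.trans
      ((norm_iteratedFDeriv_le_seminorm ℂ φ i (fstL z)).trans (hle 0 i (Nat.zero_le _) hi'))
    have ha2 : ‖fstL z‖ ^ k * a ≤ S := by
      refine le_trans ?_ ((le_seminorm ℂ k i φ (fstL z)).trans (hle k i le_rfl hi'))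
      gcongr
    have hb1 : b ≤ SchwartzMap.seminorm ℂ 0 (n - i) ψ := hb.trans
      (norm_iteratedFDeriv_le_seminorm ℂ ψ (n - i) (sndL z))
    have hb2 : ‖sndL z‖ ^ k * b ≤ SchwartzMap.seminorm ℂ k (n - i) ψ := by
      refine le_trans ?_ (le_seminorm ℂ k (n - i) ψ (sndL z))
      gcongr
    have hS0 : 0 ≤ S := ha0.trans ha1
    calc _ = (n.choose i : ℝ) * ((‖fstL z‖ ^ k * a) * b + a * (‖sndL z‖ ^ k * b)) := by ring
      _ ≤ (n.choose i : ℝ) * (S * SchwartzMap.seminorm ℂ 0 (n - i) ψ +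
          S * SchwartzMap.seminorm ℂ k (n - i) ψ) := by
        gcongr
      _ = _ := by ring
  have h3 := Finset.sum_le_sum h2
  rw [← Finset.mul_sum, ← Finset.sum_mul] at h3
  calc ‖z‖ ^ k * ‖iteratedFDeriv ℝ n (tensor φ ψ) z‖
      ≤ (2 ^ k * (‖fstL z‖ ^ k + ‖sndL z‖ ^ k)) * ‖iteratedFDeriv ℝ n (tensor φ ψ) z‖ := by
        gcongr; exact norm_pow_le_fst_snd z k
    _ = 2 ^ k * ((‖fstL z‖ ^ k + ‖sndL z‖ ^ k) * ‖iteratedFDeriv ℝ n (tensor φ ψ) z‖) :=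
        mul_assoc _ _ _
    _ ≤ 2 ^ k * _ := by
        refine mul_le_mul_of_nonneg_left (le_trans ?_ h3) (by positivity)
        exact mul_le_mul_of_nonneg_left h1 (by positivity)
    _ = _ := by rw [mul_assoc]

/-- The tensor product `φ ↦ φ ⊗ ψ` on Schwartz spaces. -/
def tensorCLM (ψ : 𝓢(EuclideanSpace ℝ ι, ℂ)) :
    𝓢(EuclideanSpace ℝ ι, ℂ) →L[ℂ] 𝓢(EuclideanSpace ℝ (ι ⊕ ι), ℂ) :=
  mkCLM (fun φ => tensor φ ψ) (fun f g x => add_mul _ _ _) (fun a f x => mul_assoc _ _ _)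
    (fun φ => ((φ.smooth ⊤).comp (fstL : EuclideanSpace ℝ (ι ⊕ ι) →L[ℝ] _).contDiff).mul
      ((ψ.smooth ⊤).comp (sndL : EuclideanSpace ℝ (ι ⊕ ι) →L[ℝ] _).contDiff))
    (fun n => ⟨Finset.Iic (n.1, n.2), 2 ^ n.1 * ∑ i ∈ Finset.range (n.2 + 1),
      (n.2.choose i : ℝ) * (SchwartzMap.seminorm ℂ 0 (n.2 - i) ψ +
        SchwartzMap.seminorm ℂ n.1 (n.2 - i) ψ),
      by
        refine mul_nonneg (by positivity) (Finset.sum_nonneg fun i _ => mul_nonneg (by positivity)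
          (add_nonneg (apply_nonneg _ _) (apply_nonneg _ _))),
      fun φ z => tensor_decay φ ψ n.1 n.2 z⟩)

theorem tensorCLM_apply (φ ψ : 𝓢(EuclideanSpace ℝ ι, ℂ)) (z : EuclideanSpace ℝ (ι ⊕ ι)) :
    tensorCLM ψ φ z = φ (fstL z) * ψ (sndL z) := rfl

/-- The linear map `(x, t) ↦ (t, t - x)`. -/
def shearEquiv (ι : Type) [Fintype ι] :
    EuclideanSpace ℝ (ι ⊕ ι) ≃L[ℝ] EuclideanSpace ℝ (ι ⊕ ι) :=
  LinearEquiv.toContinuousLinearEquiv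
    { toFun := fun z => inlL (sndL z) + inrL (sndL z - fstL z)
      invFun := fun z => inlL (fstL z - sndL z) + inrL (fstL z)
      map_add' := fun x y => by simp only [map_add, map_sub]; abel
      map_smul' := fun c x => by simp [smul_sub]
      left_inv := fun z => by
        simp only [← pair_eq, fstL_pair, sndL_pair, sub_sub_cancel, pair_fst_snd]
      right_inv := fun z => by
        simp only [← pair_eq, fstL_pair, sndL_pair, sub_sub_cancel, pair_fst_snd] }

theorem shearEquiv_apply (z : EuclideanSpace ℝ (ι ⊕ ι)) :
    shearEquiv ι z = pair (sndL z) (sndL z - fstL z) := (pair_eq _ _).symm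

/-- The short-time Fourier transform as an operator between Schwartz spaces. -/
def stftS (ι : Type) [Fintype ι] :
    𝓢(EuclideanSpace ℝ ι, ℂ) →L[ℂ] 𝓢(EuclideanSpace ℝ (ι ⊕ ι), ℂ) :=
  partialFourierCLM.comp ((SchwartzMap.compCLMOfContinuousLinearEquiv ℂ (shearEquiv ι)).comp
    (tensorCLM (gaussian ι)))

/-- The window is real, so `Vφ(x, ·)` is the Fourier transform in `t` of `φ(t)` times the window at
`t - x`, a sheared tensor product. Thus `Vφ` is a Schwartz function on `ℝ²ᵈ`, which supplies the
decay used below. -/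
theorem stftS_apply (φ : 𝓢(EuclideanSpace ℝ ι, ℂ)) (z : EuclideanSpace ℝ (ι ⊕ ι)) :
    stftS ι φ z = stftFun (gaussian ι) φ (fstL z, sndL z) := by
  rw [stftFun_eq_fourier]
  change partialFourier _ z = _
  rw [partialFourier]
  refine congrArg (fun h : EuclideanSpace ℝ ι → ℂ => 𝓕 h (sndL z)) (funext fun t => ?_)
  change tensorCLM (gaussian ι) φ (shearEquiv ι (pair (fstL z) t)) = _
  rw [tensorCLM_apply, shearEquiv_apply]
  simp

theorem stftFun_eq_stftS (φ : 𝓢(EuclideanSpace ℝ ι, ℂ)) (z : Phase ι) :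
    stftFun (gaussian ι) φ z = stftS ι φ (pair z.1 z.2) := by
  rw [stftS_apply, fstL_pair, sndL_pair]

theorem continuous_uncurry_pair :
    Continuous fun z : Phase ι => pair z.1 z.2 := by
  simp only [pair_eq]
  fun_prop

theorem norm_le_norm_pair (z : Phase ι) : ‖z‖ ≤ ‖pair z.1 z.2‖ :=
  max_le (norm_fst_le z.1 z.2) (norm_snd_le z.1 z.2)

theorem continuous_stftFun (φ : 𝓢(EuclideanSpace ℝ ι, ℂ)) :
    Continuous (stftFun (gaussian ι) φ) := by
  have : stftFun (gaussian ι) φ = fun z => stftS ι φ (pair z.1 z.2) :=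
    funext (stftFun_eq_stftS φ)
  rw [this]
  exact (stftS ι φ).continuous.comp continuous_uncurry_pair

theorem stftFun_decay (φ : 𝓢(EuclideanSpace ℝ ι, ℂ)) (M : ℕ) :
    ∃ C : ℝ, 0 ≤ C ∧ ∀ z, (1 + ‖z‖) ^ M * ‖stftFun (gaussian ι) φ z‖ ≤ C := by
  refine ⟨2 ^ M * ((Finset.Iic (M, 0)).sup fun m => SchwartzMap.seminorm ℂ m.1 m.2) (stftS ι φ),
    mul_nonneg (by positivity) (apply_nonneg _ _), fun z => ?_⟩
  have h := one_add_le_sup_seminorm_apply (𝕜 := ℂ) (m := (M, 0)) le_rfl le_rfl (stftS ι φ)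
    (pair z.1 z.2)
  rw [norm_iteratedFDeriv_zero] at h
  rw [stftFun_eq_stftS]
  refine le_trans ?_ h
  gcongr
  exact norm_le_norm_pair z

instance : (volume : Measure (Phase ι)).IsAddHaarMeasure :=
  Measure.prod.instIsAddHaarMeasure _ _

/-- The decay exponent `K` for which `(1 + ‖z‖)⁻ᴷ` is integrable on phase space. -/
def phasePower (ι : Type) [Fintype ι] : ℕ :=
  Measure.integrablePower (volume : Measure (Phase ι))

theorem integrable_phasePower :
    Integrable fun z : Phase ι => ((1 + ‖z‖) ^ phasePower ι)⁻¹ := by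
  have h := Measure.integrable_pow_neg_integrablePower (volume : Measure (Phase ι))
  refine h.congr (Filter.Eventually.of_forall fun z => ?_)
  simp only
  rw [Real.rpow_neg (by positivity), Real.rpow_natCast]
  rfl

theorem stftFun_decay' (φ : 𝓢(EuclideanSpace ℝ ι, ℂ)) (N : ℕ) :
    ∃ C : ℝ, 0 ≤ C ∧ ∀ z, (1 + ‖z‖) ^ N * ‖stftFun (gaussian ι) φ z‖ ≤
      C * ((1 + ‖z‖) ^ phasePower ι)⁻¹ := by
  -- The additional `phasePower ι` powers of decay are traded for an integrable majorant.
  obtain ⟨C, hC, h⟩ := stftFun_decay φ (phasePower ι + N)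
  refine ⟨C, hC, fun z => ?_⟩
  rw [← div_eq_mul_inv, le_div_iff₀ (by positivity)]
  refine le_trans (le_of_eq ?_) (h z)
  ring

theorem integrable_weight_stftFun (φ : 𝓢(EuclideanSpace ℝ ι, ℂ)) (N : ℕ) :
    Integrable fun z => ((1 + ‖z‖) ^ N : ℝ) * ‖stftFun (gaussian ι) φ z‖ := by
  obtain ⟨C, -, h⟩ := stftFun_decay' φ N
  refine (integrable_phasePower.const_mul C).mono'
    (Continuous.aestronglyMeasurable ?_) (Filter.Eventually.of_forall fun z => ?_)
  · exact ((continuous_const.add continuous_norm).pow N).mul (continuous_stftFun φ).norm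
  · rw [Real.norm_of_nonneg (by positivity)]
    exact h z

theorem integrable_stftFun_schwartz (φ : 𝓢(EuclideanSpace ℝ ι, ℂ)) :
    Integrable (stftFun (gaussian ι) φ) := by
  have h := integrable_weight_stftFun φ 0
  simp only [pow_zero, one_mul] at h
  exact (integrable_norm_iff (continuous_stftFun φ).aestronglyMeasurable).1 h

/-- Phase space `ℝᵈ × ℝᵈ` as `ℝ²ᵈ`. -/
def pairEquiv (ι : Type) [Fintype ι] : Phase ι ≃ᵐ EuclideanSpace ℝ (ι ⊕ ι) where
  toFun z := pair z.1 z.2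
  invFun z := (fstL z, sndL z)
  left_inv _ := rfl
  right_inv z := pair_fst_snd z
  measurable_toFun := continuous_uncurry_pair.measurable
  measurable_invFun := (fstL.continuous.prodMk sndL.continuous).measurable

theorem measurePreserving_pairEquiv : MeasurePreserving (pairEquiv ι) := by
  have h1 : MeasurePreserving (Prod.map (WithLp.ofLp (p := 2)) (WithLp.ofLp (p := 2)) :
      Phase ι → (ι → ℝ) × (ι → ℝ)) volume volume :=
    (PiLp.volume_preserving_ofLp ι).prod (PiLp.volume_preserving_ofLp ι)
  have h2 : MeasurePreserving (MeasurableEquiv.sumPiEquivProdPi fun _ : ι ⊕ ι => ℝ).symm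
      volume volume := (volume_measurePreserving_sumPiEquivProdPi fun _ : ι ⊕ ι => ℝ).symm _
  have h3 := PiLp.volume_preserving_toLp (ι ⊕ ι)
  have h4 := (h3.comp h2).comp h1
  have h5 : (pairEquiv ι : Phase ι → EuclideanSpace ℝ (ι ⊕ ι)) =
      (WithLp.toLp 2 ∘ (MeasurableEquiv.sumPiEquivProdPi fun _ : ι ⊕ ι => ℝ).symm) ∘
        Prod.map WithLp.ofLp WithLp.ofLp := by
    funext z
    refine PiLp.ext fun i => ?_
    rcases i with i | i <;> rfl
  rw [h5]
  exact h4

/-! ### Hahn–Banach factorization and Bochner integrals in `L¹`. -/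

section L1

/-- A functional dominated by `‖J x‖` factors through `J` (Hahn–Banach). -/
theorem exists_clm_factor {X Y : Type*} [AddCommGroup X] [Module ℂ X] [NormedAddCommGroup Y]
    [NormedSpace ℂ Y] (J : X →ₗ[ℂ] Y) (l : X →ₗ[ℂ] ℂ) (C : ℝ) (h : ∀ x, ‖l x‖ ≤ C * ‖J x‖) :
    ∃ L : Y →L[ℂ] ℂ, ∀ x, L (J x) = l x := by
  -- `X` carries no topology, so only a linear section of `J` is chosen. The choice is immaterial:
  -- the bound forces `l` to vanish on the kernel of `J`.
  obtain ⟨s, hs⟩ := J.rangeRestrict.exists_rightInverse_of_surjective J.range_rangeRestrict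
  have hs' : ∀ y, J (s y) = y := fun y =>
    congrArg Subtype.val (LinearMap.congr_fun hs y : J.rangeRestrict (s y) = y)
  obtain ⟨L, hL, -⟩ := exists_extension_norm_eq (LinearMap.range J)
    ((l.comp s).mkContinuous C fun y => by
      have := h (s y)
      rw [hs'] at this
      exact this)
  refine ⟨L, fun x => ?_⟩
  have h1 := hL (J.rangeRestrict x)
  have h2 : L (J x) = l (s (J.rangeRestrict x)) := h1
  have h3 : ‖l (s (J.rangeRestrict x) - x)‖ ≤ C * ‖J (s (J.rangeRestrict x) - x)‖ := h _
  have h4 : J (s (J.rangeRestrict x) - x) = 0 := by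
    rw [map_sub, hs']
    exact sub_self (J x)
  rw [h4, norm_zero, mul_zero, norm_le_zero_iff, map_sub, sub_eq_zero] at h3
  rw [h2, h3]

variable {α β : Type*} [MeasurableSpace α] [MeasurableSpace β] {μ : Measure α} {ν : Measure β}

/-- Dominated convergence for `‖K x - K x₀‖₁`. The majorant is only required near each `x₀`, since a
family of translates has in general no integrable majorant valid for all parameters. -/
theorem continuous_toL1_of_dominated {T : Type*} [TopologicalSpace T] [FirstCountableTopology T]
    {K : T → β → ℂ} (hK : ∀ x, Integrable (K x) ν) (hc : ∀ y, Continuous fun x => K x y)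
    (hb : ∀ x₀, ∃ b : β → ℝ, Integrable b ν ∧ ∀ᶠ x in nhds x₀, ∀ y, ‖K x y‖ ≤ b y) :
    Continuous fun x => (hK x).toL1 (K x) := by
  refine continuous_iff_continuousAt.2 fun x₀ => ?_
  rw [ContinuousAt, tendsto_iff_norm_sub_tendsto_zero]
  obtain ⟨b, hbi, hb⟩ := hb x₀
  have h1 : ∀ x, ‖(hK x).toL1 (K x) - (hK x₀).toL1 (K x₀)‖ = ∫ y, ‖K x y - K x₀ y‖ ∂ν := by
    intro x
    rw [← Integrable.toL1_sub, L1.norm_eq_integral_norm]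
    refine integral_congr_ae ?_
    filter_upwards [((hK x).sub (hK x₀)).coeFn_toL1] with y hy
    rw [hy]
    rfl
  simp_rw [h1]
  have h2 := tendsto_integral_filter_of_dominated_convergence (μ := ν) (l := nhds x₀)
    (F := fun x y => ‖K x y - K x₀ y‖) (f := fun _ => 0) (fun y => b y + b y)
    (Filter.Eventually.of_forall fun x => ((hK x).sub (hK x₀)).1.norm)
    (by
      filter_upwards [hb] with x hx
      refine Filter.Eventually.of_forall fun y => ?_
      rw [norm_norm]
      exact (norm_sub_le _ _).trans (add_le_add (hx y) (hb.self_of_nhds y)))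
    (hbi.add hbi)
    (Filter.Eventually.of_forall fun y => by
      have := ((hc y).tendsto x₀).sub_const (K x₀ y)
      rw [sub_self] at this
      simpa using this.norm)
  simpa using h2

theorem integrable_prod_kernel [SFinite μ] [SFinite ν] {c : α → ℂ} {K : α → β → ℂ} {B : α → ℝ}
    (hc : AEStronglyMeasurable c μ)
    (hK : AEStronglyMeasurable (Function.uncurry K) (μ.prod ν)) (hKi : ∀ x, Integrable (K x) ν)
    (hB : ∀ x, ∫ y, ‖K x y‖ ∂ν ≤ B x) (hcB : Integrable (fun x => ‖c x‖ * B x) μ) :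
    Integrable (fun p : α × β => c p.1 * K p.1 p.2) (μ.prod ν) := by
  have hm : AEStronglyMeasurable (fun p : α × β => c p.1 * K p.1 p.2) (μ.prod ν) :=
    hc.comp_fst.mul hK
  rw [integrable_prod_iff hm]
  refine ⟨Filter.Eventually.of_forall fun x => (hKi x).const_mul (c x), ?_⟩
  refine hcB.mono' hm.norm.integral_prod_right' (Filter.Eventually.of_forall fun x => ?_)
  rw [Real.norm_of_nonneg (integral_nonneg fun _ => norm_nonneg _)]
  simp only [norm_mul, integral_const_mul]
  gcongr
  exact hB x

/-- The Bochner integral of an `L¹`-valued function is given by pointwise integrals. -/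
theorem integral_toL1_kernel [SigmaFinite μ] [SigmaFinite ν] {c : α → ℂ} {K : α → β → ℂ}
    {B : α → ℝ} (hc : AEStronglyMeasurable c μ)
    (hK : AEStronglyMeasurable (Function.uncurry K) (μ.prod ν)) (hKi : ∀ x, Integrable (K x) ν)
    (hKm : AEStronglyMeasurable (fun x => (hKi x).toL1 (K x)) μ)
    (hB : ∀ x, ∫ y, ‖K x y‖ ∂ν ≤ B x) (hcB : Integrable (fun x => ‖c x‖ * B x) μ)
    {f : β → ℂ} (hf : Integrable f ν) (hcK : ∀ y, ∫ x, c x * K x y ∂μ = f y) :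
    Integrable (fun x => c x • (hKi x).toL1 (K x)) μ ∧
      ∫ x, c x • (hKi x).toL1 (K x) ∂μ = hf.toL1 f := by
  have hnorm : ∀ x, ‖(hKi x).toL1 (K x)‖ = ∫ y, ‖K x y‖ ∂ν := fun x => by
    rw [L1.norm_eq_integral_norm]
    refine integral_congr_ae ?_
    filter_upwards [(hKi x).coeFn_toL1] with y hy
    rw [hy]
  have hint : Integrable (fun x => c x • (hKi x).toL1 (K x)) μ := by
    refine hcB.mono' (hc.smul hKm) (Filter.Eventually.of_forall fun x => ?_)
    rw [norm_smul, hnorm]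
    gcongr
    exact hB x
  refine ⟨hint, Lp.ext ?_⟩
  refine Integrable.ae_eq_of_forall_setIntegral_eq _ _ (L1.integrable_coeFn _)
    (L1.integrable_coeFn _) fun s hs _ => ?_
  -- It suffices to compare integrals over measurable sets `s`. Integration over `s` is a continuous
  -- functional on `L¹`, so it commutes with the Bochner integral, and Fubini identifies the result
  -- with the integral of `f` over `s`.
  let Ls : (β →₁[ν] ℂ) →L[ℂ] ℂ := LinearMap.mkContinuous
    { toFun := fun g => ∫ y in s, g y ∂ν
      map_add' := fun g h => by
        rw [← integral_add (L1.integrable_coeFn g).integrableOn (L1.integrable_coeFn h).integrableOn]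
        exact integral_congr_ae (ae_restrict_of_ae (Lp.coeFn_add g h))
      map_smul' := fun a g => by
        rw [RingHom.id_apply, smul_eq_mul, ← integral_const_mul]
        exact integral_congr_ae (ae_restrict_of_ae (Lp.coeFn_smul a g)) } 1
    (fun g => by
      rw [one_mul, L1.norm_eq_integral_norm]
      exact (norm_integral_le_integral_norm _).trans (setIntegral_le_integral
        (L1.integrable_coeFn g).norm (Filter.Eventually.of_forall fun _ => norm_nonneg _)))
  have h1 : ∫ y in s, (∫ x, c x • (hKi x).toL1 (K x) ∂μ : β →₁[ν] ℂ) y ∂ν =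
      ∫ x, c x * ∫ y in s, K x y ∂ν ∂μ := by
    change Ls _ = _
    rw [← Ls.integral_comp_comm hint]
    refine integral_congr_ae (Filter.Eventually.of_forall fun x => ?_)
    simp only
    rw [map_smul, smul_eq_mul]
    congr 1
    exact integral_congr_ae (ae_restrict_of_ae (hKi x).coeFn_toL1)
  have h2 : Integrable (fun p : α × β => c p.1 * K p.1 p.2) (μ.prod (ν.restrict s)) := by
    refine integrable_prod_kernel hc (hK.mono_ac ?_) (fun x => (hKi x).integrableOn)
      (fun x => ?_) hcB
    · exact (Measure.AbsolutelyContinuous.refl μ).prod Measure.absolutelyContinuous_restrict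
    · exact (setIntegral_le_integral (hKi x).norm
        (Filter.Eventually.of_forall fun _ => norm_nonneg _)).trans (hB x)
  rw [h1]
  calc _ = ∫ x, ∫ y in s, c x * K x y ∂ν ∂μ := by simp_rw [integral_const_mul]
    _ = ∫ y in s, ∫ x, c x * K x y ∂μ ∂ν := integral_integral_swap h2
    _ = ∫ y in s, f y ∂ν := by simp_rw [hcK]
    _ = _ := (integral_congr_ae (ae_restrict_of_ae hf.coeFn_toL1)).symm

end L1

/-! ### Covariance of the short-time Fourier transform and polynomial weights. -/

/-- Covariance of the short-time Fourier transform. -/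
theorem stftFun_tfShift (φ : EuclideanSpace ℝ ι → ℂ) (z w : Phase ι) :
    stftFun (gaussian ι) (tfShift z φ) w =
      Complex.exp (2 * Real.pi * Complex.I * ((inner ℝ z.1 (z.2 - w.2) : ℝ) : ℂ)) *
        stftFun (gaussian ι) φ (w - z) := by
  rw [stftFun, stftFun, ← integral_const_mul,
    ← integral_add_right_eq_self _ z.1]
  congr 1
  ext t
  simp only [tfShift, map_mul, conj_gaussian, ← Complex.exp_conj, Complex.conj_ofReal,
    Complex.conj_I, map_ofNat, add_sub_cancel_right, Prod.fst_sub, Prod.snd_sub]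
  have h1 : t + z.1 - w.1 = t - (w.1 - z.1) := by abel
  rw [h1]
  have h2 : Complex.exp (2 * Real.pi * Complex.I * ((inner ℝ (t + z.1) z.2 : ℝ) : ℂ)) *
      Complex.exp (2 * Real.pi * -Complex.I * ((inner ℝ (t + z.1) w.2 : ℝ) : ℂ)) =
      Complex.exp (2 * Real.pi * Complex.I * ((inner ℝ z.1 (z.2 - w.2) : ℝ) : ℂ)) *
      Complex.exp (2 * Real.pi * -Complex.I * ((inner ℝ t (w.2 - z.2) : ℝ) : ℂ)) := by
    rw [← Complex.exp_add, ← Complex.exp_add]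
    congr 1
    simp only [inner_add_left, inner_sub_right]
    push_cast
    ring
  linear_combination (φ t * gaussian ι (t - (w.1 - z.1))) * h2

theorem norm_exp_two_pi (a : ℝ) : ‖Complex.exp (2 * Real.pi * Complex.I * (a : ℂ))‖ = 1 := by
  rw [Complex.norm_exp]
  simp

theorem norm_stftFun_tfShift (φ : EuclideanSpace ℝ ι → ℂ) (z w : Phase ι) :
    ‖stftFun (gaussian ι) (tfShift z φ) w‖ = ‖stftFun (gaussian ι) φ (w - z)‖ := by
  rw [stftFun_tfShift, norm_mul, norm_exp_two_pi, one_mul]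

theorem continuous_stftFun_tfShift (φ : 𝓢(EuclideanSpace ℝ ι, ℂ)) :
    Continuous fun p : Phase ι × Phase ι => stftFun (gaussian ι) (tfShift p.1 φ) p.2 := by
  simp_rw [stftFun_tfShift]
  refine Continuous.mul (by fun_prop) ?_
  exact (continuous_stftFun φ).comp (continuous_snd.sub continuous_fst)

/-- Submultiplicativity of the weight: a power of `1 + ‖w‖` can be replaced by one of `1 + ‖w - z‖`
at a cost depending only on `z`. -/
theorem one_add_norm_le_mul {V : Type*} [NormedAddCommGroup V] (z w : V) :
    1 + ‖w‖ ≤ (1 + ‖z‖) * (1 + ‖w - z‖) := by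
  have : ‖w‖ ≤ ‖w - z‖ + ‖z‖ := by simpa using norm_add_le (w - z) z
  nlinarith [norm_nonneg z, norm_nonneg (w - z)]

theorem stftFun_add {f g : EuclideanSpace ℝ ι → ℂ} (hf : Integrable f) (hg : Integrable g) :
    stftFun (gaussian ι) (f + g) = stftFun (gaussian ι) f + stftFun (gaussian ι) g := by
  funext z
  have h := integral_add (integrable_stftFun hf z) (integrable_stftFun hg z)
  simp only [← add_mul] at h
  exact h

theorem stftFun_smul (c : ℂ) (f : EuclideanSpace ℝ ι → ℂ) :
    stftFun (gaussian ι) (c • f) = c • stftFun (gaussian ι) f := by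
  funext z
  have h := integral_const_mul (μ := volume) c (fun t => f t * conj (tfShift z (gaussian ι) t))
  simp only [← mul_assoc] at h
  exact h

/-- The polynomial weight `(1 + ‖z‖)ᴺ` as a complex-valued function. -/
def weight (N : ℕ) (z : Phase ι) : ℂ := ((1 + ‖z‖ : ℝ) : ℂ) ^ N

theorem norm_weight (N : ℕ) (z : Phase ι) : ‖weight N z‖ = (1 + ‖z‖) ^ N := by
  rw [weight, norm_pow, Complex.norm_real, Real.norm_of_nonneg (by positivity)]

theorem continuous_weight (N : ℕ) : Continuous (weight (ι := ι) N) := by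
  unfold weight
  fun_prop

theorem integrable_weight_mul_stftFun (φ : 𝓢(EuclideanSpace ℝ ι, ℂ)) (N : ℕ) :
    Integrable fun z => weight N z * stftFun (gaussian ι) φ z := by
  refine (integrable_norm_iff ?_).1 ?_
  · exact ((continuous_weight N).mul (continuous_stftFun φ)).aestronglyMeasurable
  · simpa only [norm_mul, norm_weight] using integrable_weight_stftFun φ N

/-- In modulus the kernel is a translate by `z` of a rapidly decaying function. On the ball `‖z‖ <
‖z₀‖ + 1` each power of the weight moved across this translation costs a factor `2 + ‖z₀‖`: `N`
powers for the weight itself and `phasePower ι` for the integrable majorant. -/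
theorem weighted_kernel_dominated (N : ℕ) (z₀ : Phase ι) :
    ∃ b : Phase ι → ℝ, Integrable b ∧ ∀ᶠ z in nhds z₀, ∀ w,
      ‖weight N w * stftFun (gaussian ι) (tfShift z (gaussian ι)) w‖ ≤ b w := by
  obtain ⟨C, hC, h⟩ := stftFun_decay' (gaussian ι) N
  refine ⟨fun w => (2 + ‖z₀‖) ^ (N + phasePower ι) * C * ((1 + ‖w‖) ^ phasePower ι)⁻¹,
    integrable_phasePower.const_mul _, ?_⟩
  have h1 : ∀ᶠ z in nhds z₀, ‖z‖ < ‖z₀‖ + 1 :=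
    continuous_norm.continuousAt.eventually (gt_mem_nhds (lt_add_one ‖z₀‖))
  filter_upwards [h1] with z hz w
  rw [norm_mul, norm_weight, norm_stftFun_tfShift]
  have hz' : 1 + ‖z‖ ≤ 2 + ‖z₀‖ := by linarith
  have hw := one_add_norm_le_mul z w
  set r := 1 + ‖w - z‖ with hr
  have hr0 : 0 < r := by positivity
  have h3 : (1 + ‖w‖) ^ phasePower ι * (r ^ phasePower ι)⁻¹ ≤ (2 + ‖z₀‖) ^ phasePower ι := by
    rw [← div_eq_mul_inv, ← div_pow]
    gcongr
    rw [div_le_iff₀ hr0]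
    exact hw.trans (by gcongr)
  rw [← div_eq_mul_inv, le_div_iff₀ (by positivity)]
  calc (1 + ‖w‖) ^ N * ‖stftFun (gaussian ι) (gaussian ι) (w - z)‖ * (1 + ‖w‖) ^ phasePower ι
      ≤ ((2 + ‖z₀‖) * r) ^ N * ‖stftFun (gaussian ι) (gaussian ι) (w - z)‖ *
        (1 + ‖w‖) ^ phasePower ι := by
        gcongr
        exact hw.trans (by gcongr)
    _ = (2 + ‖z₀‖) ^ N * (r ^ N * ‖stftFun (gaussian ι) (gaussian ι) (w - z)‖) *
        (1 + ‖w‖) ^ phasePower ι := by rw [mul_pow]; ring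
    _ ≤ (2 + ‖z₀‖) ^ N * (C * (r ^ phasePower ι)⁻¹) * (1 + ‖w‖) ^ phasePower ι := by
        exact mul_le_mul_of_nonneg_right (mul_le_mul_of_nonneg_left (h (w - z)) (by positivity))
          (by positivity)
    _ = (2 + ‖z₀‖) ^ N * C * ((1 + ‖w‖) ^ phasePower ι * (r ^ phasePower ι)⁻¹) := by ring
    _ ≤ (2 + ‖z₀‖) ^ N * C * (2 + ‖z₀‖) ^ phasePower ι := by gcongr
    _ = _ := by rw [pow_add]; ring

theorem tfShiftS_coe (z : Phase ι) (φ : 𝓢(EuclideanSpace ℝ ι, ℂ)) :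
    ⇑(tfShiftS z φ) = tfShift z φ := funext fun t => tfShiftS_apply z φ t

theorem integral_weighted_kernel_le (N : ℕ) (z : Phase ι) :
    ∫ w, ‖weight N w * stftFun (gaussian ι) (tfShift z (gaussian ι)) w‖ ≤
      (1 + ‖z‖) ^ N * ∫ w, (1 + ‖w‖) ^ N * ‖stftFun (gaussian ι) (gaussian ι) w‖ := by
  rw [← integral_const_mul, ← integral_sub_right_eq_self (fun w : Phase ι => (1 + ‖z‖) ^ N *
    ((1 + ‖w‖) ^ N * ‖stftFun (gaussian ι) (gaussian ι) w‖)) z]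
  refine integral_mono ?_ ?_ fun w => ?_
  · have := (integrable_weight_mul_stftFun (tfShiftS z (gaussian ι)) N).norm
    rwa [tfShiftS_coe] at this
  · exact ((integrable_weight_stftFun (gaussian ι) N).const_mul _).comp_sub_right z
  · simp only [norm_mul, norm_weight, norm_stftFun_tfShift]
    rw [← mul_assoc, ← mul_pow]
    gcongr
    exact one_add_norm_le_mul z w

/-! ### Functionals dominated by an `L¹` norm. -/

section Functional

variable {X : Type*} [AddCommGroup X] [Module ℂ X] {β : Type*} [MeasurableSpace β] {ν : Measure β}

/-- A linear map into integrable functions, as a linear map into `L¹`. -/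
def toL1Lin (F : X →ₗ[ℂ] β → ℂ) (hF : ∀ x, Integrable (F x) ν) : X →ₗ[ℂ] (β →₁[ν] ℂ) where
  toFun x := (hF x).toL1 (F x)
  map_add' x y := by
    rw [← Integrable.toL1_add]
    congr 1
    exact map_add F x y
  map_smul' a x := by
    rw [RingHom.id_apply, ← Integrable.toL1_smul]
    congr 1
    exact map_smul F a x

theorem norm_toL1Lin (F : X →ₗ[ℂ] β → ℂ) (hF : ∀ x, Integrable (F x) ν) (x : X) :
    ‖toL1Lin F hF x‖ = ∫ y, ‖F x y‖ ∂ν := by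
  rw [L1.norm_eq_integral_norm]
  refine integral_congr_ae ?_
  filter_upwards [(hF x).coeFn_toL1] with y hy
  rw [← hy]
  rfl

/-- By Hahn–Banach, `l` is the pullback of a continuous functional on all of `L¹`. Continuity of the
curve then only has to be checked in `L¹`, so no topology on `X` is needed. -/
theorem continuous_functional {T : Type*} [TopologicalSpace T] [FirstCountableTopology T]
    (F : X →ₗ[ℂ] β → ℂ) (hF : ∀ x, Integrable (F x) ν)
    (l : X →ₗ[ℂ] ℂ) (C : ℝ) (hl : ∀ x, ‖l x‖ ≤ C * ∫ y, ‖F x y‖ ∂ν) (e : T → X)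
    (hc : ∀ y, Continuous fun z => F (e z) y)
    (hb : ∀ z₀, ∃ b : β → ℝ, Integrable b ν ∧ ∀ᶠ z in nhds z₀, ∀ y, ‖F (e z) y‖ ≤ b y) :
    Continuous fun z => l (e z) := by
  obtain ⟨L, hL⟩ := exists_clm_factor (toL1Lin F hF) l C fun x => by
    rw [norm_toL1Lin]; exact hl x
  simp_rw [← hL]
  exact L.continuous.comp (continuous_toL1_of_dominated (fun z => hF (e z)) hc hb)

/-- The extension of `l` to `L¹` commutes with the Bochner integral of the curve `z ↦ c z • F (e
z)`. By `hx` this Bochner integral, computed pointwise, is `F x`. -/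
theorem integral_functional {α : Type*} [MeasurableSpace α] {μ : Measure α} [SigmaFinite μ]
    [SigmaFinite ν] [TopologicalSpace α] [FirstCountableTopology α] [OpensMeasurableSpace α]
    [SecondCountableTopology α]
    (F : X →ₗ[ℂ] β → ℂ) (hF : ∀ x, Integrable (F x) ν)
    (l : X →ₗ[ℂ] ℂ) (C : ℝ) (hl : ∀ x, ‖l x‖ ≤ C * ∫ y, ‖F x y‖ ∂ν) (e : α → X)
    (hm : AEStronglyMeasurable (fun p : α × β => F (e p.1) p.2) (μ.prod ν))
    (hc : ∀ y, Continuous fun z => F (e z) y)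
    (hb : ∀ z₀, ∃ b : β → ℝ, Integrable b ν ∧ ∀ᶠ z in nhds z₀, ∀ y, ‖F (e z) y‖ ≤ b y)
    (B : α → ℝ) (hB : ∀ z, ∫ y, ‖F (e z) y‖ ∂ν ≤ B z) (c : α → ℂ) (x : X)
    (hcm : AEStronglyMeasurable c μ) (hcB : Integrable (fun z => ‖c z‖ * B z) μ)
    (hx : ∀ y, ∫ z, c z * F (e z) y ∂μ = F x y) :
    ∫ z, c z * l (e z) ∂μ = l x := by
  obtain ⟨L, hL⟩ := exists_clm_factor (toL1Lin F hF) l C fun x => by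
    rw [norm_toL1Lin]; exact hl x
  have hcont := continuous_toL1_of_dominated (fun z => hF (e z)) hc hb
  obtain ⟨h1, h2⟩ := integral_toL1_kernel hcm hm (fun z => hF (e z))
    hcont.aestronglyMeasurable hB hcB (hF x) hx
  rw [← hL x]
  change _ = L ((hF x).toL1 (F x))
  rw [← h2, ← L.integral_comp_comm h1]
  refine integral_congr_ae (Filter.Eventually.of_forall fun z => ?_)
  simp only
  rw [map_smul, ← hL, smul_eq_mul]
  rfl

end Functional

/-- The weighted short-time Fourier transform, as a linear map. -/
def weightedStftLin (N : ℕ) {X : Type*} [AddCommGroup X] [Module ℂ X]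
    (I : X →ₗ[ℂ] EuclideanSpace ℝ ι → ℂ) (hi : ∀ x, Integrable (I x)) :
    X →ₗ[ℂ] Phase ι → ℂ where
  toFun x z := weight N z * stftFun (gaussian ι) (I x) z
  map_add' x y := by
    funext z
    rw [map_add, stftFun_add (hi x) (hi y)]
    exact mul_add _ _ _
  map_smul' a x := by
    funext z
    rw [map_smul, stftFun_smul]
    simp only [Pi.smul_apply, smul_eq_mul, RingHom.id_apply]
    ring

/-- A functional that is bounded in a weighted `M¹` norm is determined by its values on the
time-frequency shifts of the Gaussian. -/
theorem functional_inversion (N : ℕ) {X : Type*} [AddCommGroup X] [Module ℂ X]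
    (I : X →ₗ[ℂ] EuclideanSpace ℝ ι → ℂ) (hc : ∀ x, Continuous (I x)) (hi : ∀ x, Integrable (I x))
    (hw : ∀ x, Integrable fun z => weight N z * stftFun (gaussian ι) (I x) z)
    (hV : ∀ x, Integrable (stftFun (gaussian ι) (I x)))
    (e : Phase ι → X) (he : ∀ z, I (e z) = tfShift z (gaussian ι)) (l : X →ₗ[ℂ] ℂ) (C : ℝ)
    (hl : ∀ x, ‖l x‖ ≤ C * ∫ z, (1 + ‖z‖) ^ N * ‖stftFun (gaussian ι) (I x) z‖) :
    (Continuous fun z => l (e z)) ∧ ∀ x, ∫ z, stftFun (gaussian ι) (I x) z * l (e z) = l x := by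
  have hF : ∀ z w, weightedStftLin N I hi (e z) w =
      weight N w * stftFun (gaussian ι) (tfShift z (gaussian ι)) w := fun z w => by
    rw [← he]; rfl
  have hl' : ∀ x, ‖l x‖ ≤ C * ∫ z, ‖weightedStftLin N I hi x z‖ := fun x => by
    refine (hl x).trans (le_of_eq ?_)
    congr 2
    funext z
    rw [← norm_weight, ← norm_mul]
    rfl
  have hKc : Continuous fun p : Phase ι × Phase ι =>
      weight N p.2 * stftFun (gaussian ι) (tfShift p.1 (gaussian ι)) p.2 :=
    ((continuous_weight N).comp continuous_snd).mul (continuous_stftFun_tfShift (gaussian ι))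
  have hKc' : ∀ w, Continuous fun z => weightedStftLin N I hi (e z) w := fun w => by
    simp_rw [hF]
    have h := hKc.along_fst (y := w)
    exact h
  have hb : ∀ z₀, ∃ b : Phase ι → ℝ, Integrable b ∧ ∀ᶠ z in nhds z₀, ∀ w,
      ‖weightedStftLin N I hi (e z) w‖ ≤ b w := fun z₀ => by
    simp_rw [hF]
    exact weighted_kernel_dominated N z₀
  refine ⟨continuous_functional (weightedStftLin N I hi) hw l C hl' e hKc' hb, fun x => ?_⟩
  refine integral_functional (weightedStftLin N I hi) hw l C hl' e ?_ hKc' hb (fun z =>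
    (1 + ‖z‖) ^ N * ∫ w, (1 + ‖w‖) ^ N * ‖stftFun (gaussian ι) (gaussian ι) w‖) ?_ _ x
    (hV x).1 ?_ ?_
  · simp_rw [hF]
    exact hKc.aestronglyMeasurable
  · intro z
    simp_rw [hF]
    exact integral_weighted_kernel_le N z
  · refine ((hw x).norm.mul_const
      (∫ w, (1 + ‖w‖) ^ N * ‖stftFun (gaussian ι) (gaussian ι) w‖)).congr
      (Filter.Eventually.of_forall fun z => ?_)
    simp only [norm_mul, norm_weight]
    ring
  · intro w
    simp_rw [hF]
    change _ = weight N w * stftFun (gaussian ι) (I x) w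
    -- The superposition identity in `L¹` is the reproducing formula multiplied by the weight at
    -- `w`, which is constant in the integration variable `z`.
    rw [← stftFun_reproducing (hc x) (hi x) (hV x) w, ← integral_const_mul]
    congr 1
    funext z
    ring

/-! ### Schwartz seminorms in terms of weighted short-time Fourier transforms. -/

theorem norm_iteratedFDeriv_cexp (n : ℕ) (x : ℝ) :
    ‖iteratedFDeriv ℝ n (fun s : ℝ => Complex.exp (2 * Real.pi * Complex.I * (s : ℂ))) x‖ =
      (2 * Real.pi) ^ n := by
  have h : ∀ n : ℕ, iteratedDeriv n
      (fun s : ℝ => Complex.exp (2 * Real.pi * Complex.I * (s : ℂ))) = fun s : ℝ =>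
        (2 * Real.pi * Complex.I) ^ n * Complex.exp (2 * Real.pi * Complex.I * (s : ℂ)) := by
    intro n
    induction n with
    | zero => simp
    | succ n ih =>
      rw [iteratedDeriv_succ, ih]
      ext s
      have h1 : HasDerivAt (fun s : ℝ => (s : ℂ)) 1 s := Complex.ofRealCLM.hasDerivAt
      have h2 := (((h1.const_mul (2 * Real.pi * Complex.I)).cexp).const_mul
        ((2 * Real.pi * Complex.I) ^ n)).deriv
      rw [h2]
      ring
  rw [norm_iteratedFDeriv_eq_norm_iteratedDeriv, h, norm_mul, Complex.norm_exp]
  simp [abs_of_pos Real.pi_pos]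

theorem contDiff_cexp :
    ContDiff ℝ ((⊤ : ℕ∞) : WithTop ℕ∞) fun s : ℝ =>
      Complex.exp (2 * Real.pi * Complex.I * (s : ℂ)) :=
  (contDiff_const.mul Complex.ofRealCLM.contDiff).cexp

theorem norm_iteratedFDeriv_modulation_le (ω : EuclideanSpace ℝ ι) (n : ℕ)
    (t : EuclideanSpace ℝ ι) :
    ‖iteratedFDeriv ℝ n (fun t : EuclideanSpace ℝ ι =>
      Complex.exp (2 * Real.pi * Complex.I * ((inner ℝ t ω : ℝ) : ℂ))) t‖ ≤
      (2 * Real.pi) ^ n * ‖ω‖ ^ n := by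
  have h := (innerSL ℝ ω).iteratedFDeriv_comp_right contDiff_cexp t (i := n)
    (by exact_mod_cast le_top)
  have h' : (fun t : EuclideanSpace ℝ ι =>
      Complex.exp (2 * Real.pi * Complex.I * ((inner ℝ t ω : ℝ) : ℂ))) =
      (fun s : ℝ => Complex.exp (2 * Real.pi * Complex.I * (s : ℂ))) ∘ innerSL ℝ ω := by
    funext t
    simp [real_inner_comm]
  rw [h', h]
  refine (ContinuousMultilinearMap.norm_compContinuousLinearMap_le _ _).trans ?_
  rw [norm_iteratedFDeriv_cexp]
  simp

/-- Leibniz' rule: undoing the translation in the weight costs `k` powers of `1 + ‖z‖`, and each of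
the at most `n` derivatives falling on the modulation costs a factor `2π‖ω‖`. -/
theorem tfShift_seminorm_bound (φ : 𝓢(EuclideanSpace ℝ ι, ℂ)) (k n : ℕ) :
    ∃ C : ℝ, 0 ≤ C ∧ ∀ (z : Phase ι) (t : EuclideanSpace ℝ ι),
      ‖t‖ ^ k * ‖iteratedFDeriv ℝ n (tfShift z φ) t‖ ≤ C * (1 + ‖z‖) ^ (k + n) := by
  set D : ℝ := 2 ^ k * ((Finset.Iic (k, n)).sup fun m => SchwartzMap.seminorm ℂ m.1 m.2) φ with hD
  have hD0 : 0 ≤ D := mul_nonneg (by positivity) (apply_nonneg _ _)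
  refine ⟨∑ i ∈ Finset.range (n + 1), (n.choose i : ℝ) * (2 * Real.pi) ^ i * D,
    Finset.sum_nonneg fun i _ => by positivity, fun z t => ?_⟩
  have hg : ContDiff ℝ ((⊤ : ℕ∞) : WithTop ℕ∞) fun t => φ (t - z.1) :=
    (φ.smooth ⊤).comp (contDiff_id.sub contDiff_const)
  have hf : ContDiff ℝ ((⊤ : ℕ∞) : WithTop ℕ∞) fun t : EuclideanSpace ℝ ι =>
      Complex.exp (2 * Real.pi * Complex.I * ((inner ℝ t z.2 : ℝ) : ℂ)) :=
    contDiff_cexp.comp (contDiff_id.inner ℝ contDiff_const)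
  have h1 := norm_iteratedFDeriv_mul_le hf hg t (n := n) (by exact_mod_cast le_top)
  have h2 : ∀ i ∈ Finset.range (n + 1), ‖t‖ ^ k * ((n.choose i : ℝ) *
      ‖iteratedFDeriv ℝ i (fun t : EuclideanSpace ℝ ι =>
        Complex.exp (2 * Real.pi * Complex.I * ((inner ℝ t z.2 : ℝ) : ℂ))) t‖ *
      ‖iteratedFDeriv ℝ (n - i) (fun t => φ (t - z.1)) t‖) ≤
      (n.choose i : ℝ) * (2 * Real.pi) ^ i * D * (1 + ‖z‖) ^ (k + n) := by
    intro i hi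
    have hi' : i ≤ n := by simpa [Nat.lt_succ_iff] using hi
    have a1 := norm_iteratedFDeriv_modulation_le z.2 i t
    have a2 : (1 + ‖t - z.1‖) ^ k * ‖iteratedFDeriv ℝ (n - i) (fun t => φ (t - z.1)) t‖ ≤ D := by
      rw [iteratedFDeriv_comp_sub]
      exact one_add_le_sup_seminorm_apply (𝕜 := ℂ) (m := (k, n)) le_rfl (Nat.sub_le n i) φ _
    have a3 : ‖t‖ ^ k ≤ (1 + ‖z‖) ^ k * (1 + ‖t - z.1‖) ^ k := by
      rw [← mul_pow]
      have := one_add_norm_le_mul z.1 t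
      have hz : ‖z.1‖ ≤ ‖z‖ := _root_.norm_fst_le z
      gcongr
      calc ‖t‖ ≤ 1 + ‖t‖ := by linarith
        _ ≤ _ := this
        _ ≤ _ := by gcongr
    have a4 : ‖z.2‖ ^ i ≤ (1 + ‖z‖) ^ n := by
      have hz : ‖z.2‖ ≤ ‖z‖ := _root_.norm_snd_le z
      calc ‖z.2‖ ^ i ≤ (1 + ‖z‖) ^ i := by gcongr; linarith
        _ ≤ _ := pow_le_pow_right₀ (by linarith [norm_nonneg z]) hi'
    have b1 := norm_nonneg (iteratedFDeriv ℝ i (fun t : EuclideanSpace ℝ ι =>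
        Complex.exp (2 * Real.pi * Complex.I * ((inner ℝ t z.2 : ℝ) : ℂ))) t)
    have b2 := norm_nonneg (iteratedFDeriv ℝ (n - i) (fun t => φ (t - z.1)) t)
    generalize ‖iteratedFDeriv ℝ i (fun t : EuclideanSpace ℝ ι =>
        Complex.exp (2 * Real.pi * Complex.I * ((inner ℝ t z.2 : ℝ) : ℂ))) t‖ = a at *
    generalize ‖iteratedFDeriv ℝ (n - i) (fun t => φ (t - z.1)) t‖ = b at *
    calc _ ≤ ((1 + ‖z‖) ^ k * (1 + ‖t - z.1‖) ^ k) * ((n.choose i : ℝ) *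
          ((2 * Real.pi) ^ i * (1 + ‖z‖) ^ n) * b) := by
          gcongr
          exact a1.trans (by gcongr)
      _ = (n.choose i : ℝ) * (2 * Real.pi) ^ i * ((1 + ‖t - z.1‖) ^ k * b) *
          (1 + ‖z‖) ^ (k + n) := by rw [pow_add]; ring
      _ ≤ _ := by gcongr
  have h3 := Finset.sum_le_sum h2
  rw [← Finset.mul_sum, ← Finset.sum_mul] at h3
  exact (mul_le_mul_of_nonneg_left h1 (by positivity)).trans h3

section Differentiation

variable {V : Type} [NormedAddCommGroup V] [NormedSpace ℝ V] {Z : Type} [NormedAddCommGroup Z]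
  [NormedSpace ℝ Z] [MeasurableSpace Z] [BorelSpace Z] [SecondCountableTopology Z] {μ : Measure Z}

/-- Differentiation under the integral sign: the polynomial growth of `F` and its derivative in `z`
is compensated by the integrability of `c` against every polynomial weight. -/
theorem hasFDerivAt_integral_param {W : Type} [NormedAddCommGroup W] [NormedSpace ℂ W]
    {c : Z → ℂ} (hc : AEStronglyMeasurable c μ)
    (hcN : ∀ N : ℕ, Integrable (fun z => ‖c z‖ * (1 + ‖z‖) ^ N) μ) {F : Z → V → W}
    (hF : ContDiff ℝ ((⊤ : ℕ∞) : WithTop ℕ∞) (Function.uncurry F))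
    (hb : ∀ m : ℕ, ∃ (C : ℝ) (N : ℕ), ∀ z t, ‖iteratedFDeriv ℝ m (F z) t‖ ≤ C * (1 + ‖z‖) ^ N)
    (hF' : Continuous (Function.uncurry fun z t => fderiv ℝ (F z) t)) (t : V) :
    HasFDerivAt (fun t => ∫ z, c z • F z t ∂μ) (∫ z, c z • fderiv ℝ (F z) t ∂μ) t := by
  obtain ⟨C₀, N₀, h₀⟩ := hb 0
  obtain ⟨C₁, N₁, h₁⟩ := hb 1
  have hFz : ∀ z, ContDiff ℝ ((⊤ : ℕ∞) : WithTop ℕ∞) (F z) := fun z =>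
    hF.comp (contDiff_const.prodMk contDiff_id)
  have hm : ∀ t, AEStronglyMeasurable (fun z => c z • F z t) μ := fun t =>
    hc.smul (hF.continuous.comp (continuous_id.prodMk continuous_const) :
      Continuous fun z => F z t).aestronglyMeasurable
  refine hasFDerivAt_integral_of_dominated_of_fderiv_le (s := Set.univ) Filter.univ_mem
    (bound := fun z => C₁ * (‖c z‖ * (1 + ‖z‖) ^ N₁))
    (F' := fun t z => c z • fderiv ℝ (F z) t)
    (Filter.Eventually.of_forall hm) ?_ ?_ ?_ ((hcN N₁).const_mul _) ?_
  · refine ((hcN N₀).const_mul C₀).mono' (hm t) (Filter.Eventually.of_forall fun z => ?_)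
    rw [norm_smul]
    have := h₀ z t
    rw [norm_iteratedFDeriv_zero] at this
    calc _ ≤ ‖c z‖ * (C₀ * (1 + ‖z‖) ^ N₀) := by gcongr
      _ = _ := by ring
  · exact hc.smul (hF'.comp (continuous_id.prodMk continuous_const) :
      Continuous fun z => fderiv ℝ (F z) t).aestronglyMeasurable
  · refine Filter.Eventually.of_forall fun z t _ => ?_
    rw [norm_smul]
    have := h₁ z t
    rw [norm_iteratedFDeriv_one] at this
    calc _ ≤ ‖c z‖ * (C₁ * (1 + ‖z‖) ^ N₁) := by gcongr
      _ = _ := by ring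
  · exact Filter.Eventually.of_forall fun z t _ =>
      (((hFz z).differentiable (by simp)) t).hasFDerivAt.const_smul (c z)

/-- Derivatives of a parameter integral are dominated by the integrals of the derivatives. -/
theorem norm_iteratedFDeriv_integral_le {c : Z → ℂ} (hc : AEStronglyMeasurable c μ)
    (hcN : ∀ N : ℕ, Integrable (fun z => ‖c z‖ * (1 + ‖z‖) ^ N) μ) (n : ℕ) :
    ∀ (W : Type) [NormedAddCommGroup W] [NormedSpace ℂ W] (F : Z → V → W),
      ContDiff ℝ ((⊤ : ℕ∞) : WithTop ℕ∞) (Function.uncurry F) →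
      (∀ m : ℕ, ∃ (C : ℝ) (N : ℕ), ∀ z t, ‖iteratedFDeriv ℝ m (F z) t‖ ≤ C * (1 + ‖z‖) ^ N) →
      ∀ (t : V) (B : Z → ℝ), (∀ z, ‖iteratedFDeriv ℝ n (F z) t‖ ≤ B z) →
        Integrable (fun z => ‖c z‖ * B z) μ →
        ‖iteratedFDeriv ℝ n (fun t => ∫ z, c z • F z t ∂μ) t‖ ≤ ∫ z, ‖c z‖ * B z ∂μ := by
  -- The target `W` remains general because each differentiation replaces it by the linear maps from
  -- `V` to `W`.
  induction n with
  | zero =>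
    intro W _ _ F _ _ t B hB hcB
    rw [norm_iteratedFDeriv_zero]
    refine norm_integral_le_of_norm_le hcB (Filter.Eventually.of_forall fun z => ?_)
    rw [norm_smul]
    have := hB z
    rw [norm_iteratedFDeriv_zero] at this
    gcongr
  | succ n ih =>
    intro W _ _ F hF hb t B hB hcB
    have hF' : ContDiff ℝ ((⊤ : ℕ∞) : WithTop ℕ∞)
        (Function.uncurry fun z t => fderiv ℝ (F z) t) := by
      have h : ContDiff ℝ ((⊤ : ℕ∞) : WithTop ℕ∞)
          (Function.uncurry fun (p : Z × V) (s : V) => F p.1 s) :=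
        hF.comp (contDiff_fst.fst.prodMk contDiff_snd)
      exact ContDiff.fderiv h contDiff_snd (by simp)
    have hd : fderiv ℝ (fun t => ∫ z, c z • F z t ∂μ) =
        fun t => ∫ z, c z • fderiv ℝ (F z) t ∂μ := funext fun t =>
      (hasFDerivAt_integral_param hc hcN hF hb hF'.continuous t).fderiv
    rw [← norm_iteratedFDeriv_fderiv, hd]
    refine ih _ (fun z t => fderiv ℝ (F z) t) hF' (fun m => ?_) t B (fun z => ?_) hcB
    · obtain ⟨C, N, h⟩ := hb (m + 1)
      refine ⟨C, N, fun z t => ?_⟩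
      have := h z t
      rwa [← norm_iteratedFDeriv_fderiv] at this
    · have := hB z
      rwa [← norm_iteratedFDeriv_fderiv] at this

end Differentiation

theorem contDiff_tfShift (φ : 𝓢(EuclideanSpace ℝ ι, ℂ)) :
    ContDiff ℝ ((⊤ : ℕ∞) : WithTop ℕ∞) (Function.uncurry fun z : Phase ι => tfShift z φ) := by
  have h1 : ContDiff ℝ ((⊤ : ℕ∞) : WithTop ℕ∞) fun p : Phase ι × EuclideanSpace ℝ ι =>
      (inner ℝ p.2 p.1.2 : ℝ) := contDiff_snd.inner ℝ contDiff_fst.snd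
  have h2 : ContDiff ℝ ((⊤ : ℕ∞) : WithTop ℕ∞) fun p : Phase ι × EuclideanSpace ℝ ι =>
      φ (p.2 - p.1.1) := (φ.smooth ⊤).comp (contDiff_snd.sub contDiff_fst.fst)
  exact (contDiff_cexp.comp h1).mul h2

/-- Schwartz seminorms are dominated by weighted `L¹` norms of the short-time Fourier transform. -/
theorem seminorm_le_weighted_stft (k n : ℕ) : ∃ C : ℝ, 0 ≤ C ∧ ∀ φ : 𝓢(EuclideanSpace ℝ ι, ℂ),
    SchwartzMap.seminorm ℂ k n φ ≤
      C * ∫ z, (1 + ‖z‖) ^ (k + n) * ‖stftFun (gaussian ι) φ z‖ := by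
  obtain ⟨C, hC, h⟩ := tfShift_seminorm_bound (gaussian ι) k n
  refine ⟨C, hC, fun φ => ?_⟩
  have hI : 0 ≤ ∫ z, (1 + ‖z‖) ^ (k + n) * ‖stftFun (gaussian ι) φ z‖ :=
    integral_nonneg fun z => by positivity
  refine seminorm_le_bound ℂ k n φ (mul_nonneg hC hI) fun t => ?_
  -- The point `t` is fixed from here on, so its weight can be divided out and placed in the
  -- majorant for the derivatives of the shifts; this requires the weight to be nonzero.
  by_cases ht : ‖t‖ ^ k = 0
  · rw [ht, zero_mul]
    exact mul_nonneg hC hI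
  have ht' : 0 < ‖t‖ ^ k := lt_of_le_of_ne (by positivity) (Ne.symm ht)
  have hφ : (φ : EuclideanSpace ℝ ι → ℂ) =
      fun t => ∫ z, stftFun (gaussian ι) φ z • tfShift z (gaussian ι) t := funext fun t =>
    (stftFun_inversion φ.continuous φ.integrable (integrable_stftFun_schwartz φ) t).symm
  have hcN : ∀ N : ℕ, Integrable (fun z => ‖stftFun (gaussian ι) φ z‖ * (1 + ‖z‖) ^ N) :=
    fun N => by simpa only [mul_comm] using integrable_weight_stftFun φ N
  have h1 := norm_iteratedFDeriv_integral_le (continuous_stftFun φ).aestronglyMeasurable hcN n ℂ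
    (fun z => tfShift z (gaussian ι)) (contDiff_tfShift (gaussian ι))
    (fun m => by
      obtain ⟨C, -, h⟩ := tfShift_seminorm_bound (gaussian ι) 0 m
      exact ⟨C, 0 + m, fun z t => by simpa using h z t⟩) t
    (fun z => C * (1 + ‖z‖) ^ (k + n) / ‖t‖ ^ k)
    (fun z => by rw [le_div_iff₀' ht']; exact h z t)
    (by
      refine ((hcN (k + n)).const_mul (C / ‖t‖ ^ k)).congr (Filter.Eventually.of_forall fun z => ?_)
      simp only
      ring)
  rw [← hφ] at h1
  refine (mul_le_mul_of_nonneg_left h1 ht'.le).trans (le_of_eq ?_)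
  rw [← integral_const_mul, ← integral_const_mul]
  congr 1
  funext z
  field_simp

theorem sup_seminorm_le_weighted_stft (s : Finset (ℕ × ℕ)) : ∃ (N : ℕ) (C : ℝ), 0 ≤ C ∧
    ∀ φ : 𝓢(EuclideanSpace ℝ ι, ℂ),
      s.sup (schwartzSeminormFamily ℂ (EuclideanSpace ℝ ι) ℂ) φ ≤
        C * ∫ z, (1 + ‖z‖) ^ N * ‖stftFun (gaussian ι) φ z‖ := by
  choose C hC h using fun p : ℕ × ℕ => seminorm_le_weighted_stft (ι := ι) p.1 p.2
  -- Since `1 + ‖z‖ ≥ 1`, the largest exponent occurring in `s` serves for all of its seminorms, and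
  -- the sum of the constants dominates each of them.
  refine ⟨s.sup fun p => p.1 + p.2, ∑ p ∈ s, C p, Finset.sum_nonneg fun p _ => hC p, fun φ => ?_⟩
  have h0 : ∀ N : ℕ, 0 ≤ ∫ z, (1 + ‖z‖) ^ N * ‖stftFun (gaussian ι) φ z‖ := fun N =>
    integral_nonneg fun z => by positivity
  refine Seminorm.finset_sup_apply_le
    (mul_nonneg (Finset.sum_nonneg fun p _ => hC p) (h0 _)) fun p hp => ?_
  refine (h p φ).trans (mul_le_mul (Finset.single_le_sum (fun p _ => hC p) hp) ?_ (h0 _)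
    (Finset.sum_nonneg fun p _ => hC p))
  refine integral_mono (integrable_weight_stftFun φ _) (integrable_weight_stftFun φ _) fun z => ?_
  have h1 : (1 : ℝ) ≤ 1 + ‖z‖ := by linarith [norm_nonneg z]
  have h2 := Finset.le_sup (f := fun p : ℕ × ℕ => p.1 + p.2) hp
  exact mul_le_mul_of_nonneg_right (pow_le_pow_right₀ h1 h2) (norm_nonneg _)

/-! ### Tempered distributions, the bracket and the norm of `M^∞`. -/

/-- Continuity bounds `u` by finitely many Schwartz seminorms, hence by a single weighted `L¹` norm
of the short-time Fourier transform. This is the hypothesis of `functional_inversion`. -/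
theorem temperedDistribution_le_weighted_stft (u : 𝓢'(EuclideanSpace ℝ ι, ℂ)) :
    ∃ (N : ℕ) (C : ℝ), ∀ φ, ‖u φ‖ ≤ C * ∫ z, (1 + ‖z‖) ^ N * ‖stftFun (gaussian ι) φ z‖ := by
  have hc : Continuous ((normSeminorm ℂ ℂ).comp
      (ContinuousLinearMap.toLinearMap (σ := RingHom.id ℂ) (M := 𝓢(EuclideanSpace ℝ ι, ℂ)) u)) :=
    continuous_norm.comp (ContinuousLinearMap.continuous (σ₁₂ := RingHom.id ℂ)
      (M₁ := 𝓢(EuclideanSpace ℝ ι, ℂ)) u)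
  obtain ⟨s, C, -, hs⟩ := Seminorm.bound_of_continuous
    (schwartz_withSeminorms ℂ (EuclideanSpace ℝ ι) ℂ) _ hc
  obtain ⟨N, D, hD, h⟩ := sup_seminorm_le_weighted_stft (ι := ι) s
  refine ⟨N, C * D, fun φ => ?_⟩
  have h1 : ‖u φ‖ ≤ C * s.sup (schwartzSeminormFamily ℂ (EuclideanSpace ℝ ι) ℂ) φ := hs φ
  rw [mul_assoc]
  exact h1.trans (mul_le_mul_of_nonneg_left (h φ) C.2)

/-- Schwartz functions as functions. -/
def coeLin (ι : Type) [Fintype ι] : 𝓢(EuclideanSpace ℝ ι, ℂ) →ₗ[ℂ] EuclideanSpace ℝ ι → ℂ where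
  toFun φ := φ
  map_add' _ _ := rfl
  map_smul' _ _ := rfl

theorem temperedDistribution_inversion (u : 𝓢'(EuclideanSpace ℝ ι, ℂ)) :
    (Continuous fun z => u (tfShiftS z (gaussian ι))) ∧
      ∀ φ : 𝓢(EuclideanSpace ℝ ι, ℂ),
        ∫ z, stftFun (gaussian ι) φ z * u (tfShiftS z (gaussian ι)) = u φ := by
  obtain ⟨N, C, h⟩ := temperedDistribution_le_weighted_stft u
  exact functional_inversion N (coeLin ι) (fun φ => φ.continuous) (fun φ => φ.integrable)
    (fun φ => integrable_weight_mul_stftFun φ N) (fun φ => integrable_stftFun_schwartz φ)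
    (fun z => tfShiftS z (gaussian ι)) (fun z => tfShiftS_coe z _)
    (ContinuousLinearMap.toLinearMap (σ := RingHom.id ℂ) (M := 𝓢(EuclideanSpace ℝ ι, ℂ)) u) C h

/-- The reflection `(x, ω) ↦ (x, -ω)` of phase space. -/
def conjPhase (z : Phase ι) : Phase ι := (z.1, -z.2)

omit [Fintype ι] in
@[simp] theorem conjPhase_conjPhase (z : Phase ι) : conjPhase (conjPhase z) = z := by
  simp [conjPhase]

theorem continuous_conjPhase : Continuous (conjPhase (ι := ι)) :=
  continuous_fst.prodMk continuous_snd.neg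

theorem measurePreserving_conjPhase : MeasurePreserving (conjPhase (ι := ι)) :=
  (MeasurePreserving.id volume).prod (Measure.measurePreserving_neg volume)

theorem measurableEmbedding_conjPhase : MeasurableEmbedding (conjPhase (ι := ι)) :=
  ((MeasurableEquiv.refl _).prodCongr (MeasurableEquiv.neg _)).measurableEmbedding

theorem integral_conjPhase (h : Phase ι → ℂ) : ∫ z, h (conjPhase z) = ∫ z, h z :=
  measurePreserving_conjPhase.integral_comp measurableEmbedding_conjPhase h

/-- The Gaussian is real, so conjugation only reverses the frequency. This reflection mediates
between the sesquilinear bracket and the bilinear evaluation of distributions. -/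
theorem conj_tfShift_gaussian (z : Phase ι) (t : EuclideanSpace ℝ ι) :
    conj (tfShift z (gaussian ι) t) = tfShift (conjPhase z) (gaussian ι) t := by
  simp only [tfShift, conjPhase, map_mul, conj_gaussian, ← Complex.exp_conj, Complex.conj_ofReal,
    Complex.conj_I, map_ofNat, inner_neg_right]
  congr 2
  push_cast
  ring

theorem conjS_tfShiftS_gaussian (z : Phase ι) :
    conjS (tfShiftS z (gaussian ι)) = tfShiftS (conjPhase z) (gaussian ι) := by
  ext t
  rw [conjS_apply, tfShiftS_apply, tfShiftS_apply, conj_tfShift_gaussian]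

theorem conjS_conjS (φ : 𝓢(EuclideanSpace ℝ ι, ℂ)) : conjS (conjS φ) = φ := by
  ext t
  rw [conjS_apply, conjS_apply, Complex.conj_conj]

theorem stftFun_conj (f : EuclideanSpace ℝ ι → ℂ) (z : Phase ι) :
    stftFun (gaussian ι) (fun t => conj (f t)) z =
      conj (stftFun (gaussian ι) f (conjPhase z)) := by
  rw [stftFun, stftFun, ← integral_conj]
  congr 1
  funext t
  rw [map_mul, conj_tfShift_gaussian, conj_tfShift_gaussian, conj_tfShift_gaussian,
    conjPhase_conjPhase]

theorem stft_eq (u : 𝓢'(EuclideanSpace ℝ ι, ℂ)) (z : Phase ι) :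
    stft (gaussian ι) u z = u (tfShiftS (conjPhase z) (gaussian ι)) := by
  rw [stft, conjS_tfShiftS_gaussian]

theorem continuous_stft (u : 𝓢'(EuclideanSpace ℝ ι, ℂ)) : Continuous (stft (gaussian ι) u) := by
  have h := (temperedDistribution_inversion u).1.comp (continuous_conjPhase (ι := ι))
  have e : stft (gaussian ι) u = (fun z => u (tfShiftS z (gaussian ι))) ∘ conjPhase :=
    funext (stft_eq u)
  rw [e]
  exact h

theorem integral_stft (u : 𝓢'(EuclideanSpace ℝ ι, ℂ)) (φ : 𝓢(EuclideanSpace ℝ ι, ℂ)) :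
    ∫ z, stft (gaussian ι) u z * stftFun (gaussian ι) φ (conjPhase z) = u φ := by
  rw [← (temperedDistribution_inversion u).2 φ, ← integral_conjPhase]
  congr 1
  funext z
  rw [conjPhase_conjPhase, stft_eq, conjPhase_conjPhase, mul_comm]

/-- The bracket with a Schwartz function is the evaluation at the conjugate function. -/
theorem bracket_schwartz (u : 𝓢'(EuclideanSpace ℝ ι, ℂ)) (φ : 𝓢(EuclideanSpace ℝ ι, ℂ)) :
    bracket u φ = u (conjS φ) := by
  rw [← integral_stft, bracket]
  congr 1
  funext z
  have h : (conjS φ : EuclideanSpace ℝ ι → ℂ) = fun t => conj (φ t) := rfl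
  rw [h, stftFun_conj, conjPhase_conjPhase]

theorem eq_zero_of_stft_eq_zero {u : 𝓢'(EuclideanSpace ℝ ι, ℂ)}
    (h : ∀ z, stft (gaussian ι) u z = 0) : u = 0 := by
  ext φ
  rw [← integral_stft]
  simp [h]

/-- The norm is an essential supremum. The bound passes to every point because the short-time
Fourier transform is continuous and sets of full measure are dense. -/
theorem norm_stft_le (u : ModulationSpace ∞ ι) (z : Phase ι) :
    ‖stft (gaussian ι) u.toDist z‖ ≤ ‖u‖ := by
  have h1 : ∀ᵐ z, ‖stft (gaussian ι) u.toDist z‖ ≤ ‖u‖ := by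
    filter_upwards [ae_le_eLpNormEssSup (f := stft (gaussian ι) u.toDist) (μ := volume)] with z hz
    rw [ModulationSpace.norm_def, eLpNorm_exponent_top]
    have h2 := ENNReal.toReal_mono (eLpNorm_exponent_top (f := stft (gaussian ι) u.toDist)
      (μ := volume) ▸ u.memLp.2.ne) hz
    simpa using h2
  have h2 : IsClosed {z | ‖stft (gaussian ι) u.toDist z‖ ≤ ‖u‖} :=
    isClosed_le (continuous_stft _).norm continuous_const
  have h3 := Measure.dense_of_ae h1 z
  rw [h2.closure_eq] at h3
  exact h3

theorem mem_modulationSubmodule_top {u : 𝓢'(EuclideanSpace ℝ ι, ℂ)} {C : ℝ}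
    (h : ∀ z, ‖stft (gaussian ι) u z‖ ≤ C) : u ∈ modulationSubmodule ∞ ι :=
  memLp_top_of_bound (continuous_stft u).aestronglyMeasurable C (Filter.Eventually.of_forall h)

/-! ### Covariant operators on Schwartz space and their action on `M^∞`. -/

section Covariant

/-- Operators on the Schwartz space that intertwine time-frequency shifts up to phase factors. -/
def IsCovariant (S : 𝓢(EuclideanSpace ℝ ι, ℂ) → 𝓢(EuclideanSpace ℝ ι, ℂ)) : Prop :=
  ∃ (L : Phase ι → Phase ι) (c : Phase ι → ℂ), Continuous L ∧ Continuous c ∧ (∀ z, ‖c z‖ = 1) ∧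
    ∀ z φ, S (tfShiftS z φ) = c z • tfShiftS (L z) (S φ)

theorem IsCovariant.comp {S₁ S₂ : 𝓢(EuclideanSpace ℝ ι, ℂ) →L[ℂ] 𝓢(EuclideanSpace ℝ ι, ℂ)}
    (h₁ : IsCovariant S₁) (h₂ : IsCovariant S₂) : IsCovariant (S₁.comp S₂) := by
  obtain ⟨L₁, c₁, hL₁, hc₁, hn₁, h₁⟩ := h₁
  obtain ⟨L₂, c₂, hL₂, hc₂, hn₂, h₂⟩ := h₂
  refine ⟨L₁ ∘ L₂, fun z => c₂ z * c₁ (L₂ z), hL₁.comp hL₂, hc₂.mul (hc₁.comp hL₂),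
    fun z => by rw [norm_mul, hn₁, hn₂, mul_one], fun z φ => ?_⟩
  rw [ContinuousLinearMap.comp_apply, h₂, map_smul, h₁, smul_smul]
  rfl

theorem conjS_tfShiftS (z : Phase ι) (φ : 𝓢(EuclideanSpace ℝ ι, ℂ)) :
    conjS (tfShiftS z φ) = tfShiftS (conjPhase z) (conjS φ) := by
  ext t
  rw [conjS_apply, tfShiftS_apply, tfShiftS_apply]
  simp only [tfShift, conjPhase, map_mul, conjS_apply, ← Complex.exp_conj, Complex.conj_ofReal,
    Complex.conj_I, map_ofNat, inner_neg_right]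
  congr 2
  push_cast
  ring

theorem conjS_smul (c : ℂ) (φ : 𝓢(EuclideanSpace ℝ ι, ℂ)) :
    conjS (c • φ) = conj c • conjS φ := by
  ext t
  rw [conjS_apply, smul_apply, smul_apply, conjS_apply, smul_eq_mul, smul_eq_mul, map_mul]

theorem IsCovariant.conj {S : 𝓢(EuclideanSpace ℝ ι, ℂ) →L[ℂ] 𝓢(EuclideanSpace ℝ ι, ℂ)}
    (h : IsCovariant S) : IsCovariant fun φ => conjS (S (conjS φ)) := by
  obtain ⟨L, c, hL, hc, hn, h⟩ := h
  refine ⟨fun z => conjPhase (L (conjPhase z)), fun z => conj (c (conjPhase z)),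
    continuous_conjPhase.comp (hL.comp continuous_conjPhase),
    Complex.continuous_conj.comp (hc.comp continuous_conjPhase),
    fun z => by rw [RCLike.norm_conj, hn], fun z φ => ?_⟩
  simp only
  rw [conjS_tfShiftS, h, conjS_smul, conjS_tfShiftS]

/-- `S` maps `π(z)φ` to a unimodular multiple of `π(Lz)Sφ`, whose transform is in modulus a
translate of that of `Sφ`. So the `M¹` norms of these images do not depend on `z`. -/
theorem integral_norm_stftFun_covariant {S : 𝓢(EuclideanSpace ℝ ι, ℂ) → 𝓢(EuclideanSpace ℝ ι, ℂ)}
    (hS : IsCovariant S) (z : Phase ι) (φ : 𝓢(EuclideanSpace ℝ ι, ℂ)) :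
    ∫ w, ‖stftFun (gaussian ι) (S (tfShiftS z φ)) w‖ = ∫ w, ‖stftFun (gaussian ι) (S φ) w‖ := by
  obtain ⟨L, c, -, -, hn, h⟩ := hS
  have h1 : ∀ w, ‖stftFun (gaussian ι) (S (tfShiftS z φ)) w‖ =
      ‖stftFun (gaussian ι) (S φ) (w - L z)‖ := fun w => by
    rw [h]
    have e : (⇑(c z • tfShiftS (L z) (S φ)) : EuclideanSpace ℝ ι → ℂ) =
        c z • tfShift (L z) (S φ) := by rw [← tfShiftS_coe]; rfl
    rw [e, stftFun_smul, Pi.smul_apply, norm_smul, hn, one_mul, norm_stftFun_tfShift]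
  simp_rw [h1]
  exact integral_sub_right_eq_self (fun w => ‖stftFun (gaussian ι) (S φ) w‖) (L z)

/-- The composition of a tempered distribution with an operator on the Schwartz space. -/
def compDist (u : 𝓢'(EuclideanSpace ℝ ι, ℂ))
    (R : 𝓢(EuclideanSpace ℝ ι, ℂ) →L[ℂ] 𝓢(EuclideanSpace ℝ ι, ℂ)) : 𝓢'(EuclideanSpace ℝ ι, ℂ) :=
  PointwiseConvergenceCLM.precomp ℂ R u

theorem compDist_apply (u : 𝓢'(EuclideanSpace ℝ ι, ℂ))
    (R : 𝓢(EuclideanSpace ℝ ι, ℂ) →L[ℂ] 𝓢(EuclideanSpace ℝ ι, ℂ))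
    (φ : 𝓢(EuclideanSpace ℝ ι, ℂ)) : compDist u R φ = u (R φ) := rfl

/-- Hölder's inequality for the bracket, read through `bracket_schwartz`. -/
theorem norm_apply_conjS_le (u : ModulationSpace ∞ ι) (φ : 𝓢(EuclideanSpace ℝ ι, ℂ)) :
    ‖u.toDist (conjS φ)‖ ≤ ‖u‖ * ∫ z, ‖stftFun (gaussian ι) φ z‖ := by
  rw [← bracket_schwartz, bracket, ← integral_const_mul]
  refine norm_integral_le_of_norm_le ((integrable_stftFun_schwartz φ).norm.const_mul _)
    (Filter.Eventually.of_forall fun z => ?_)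
  rw [norm_mul, RCLike.norm_conj]
  gcongr
  exact norm_stft_le u z

variable {R : 𝓢(EuclideanSpace ℝ ι, ℂ) →L[ℂ] 𝓢(EuclideanSpace ℝ ι, ℂ)}

/-- The value at `w` is `u` applied to `R (conj π(w)φ)`, which the duality estimate bounds by the
`M¹` norm of its conjugate. As `conjS ∘ R ∘ conjS` is again covariant, this norm is the same for all
`w`, so composition with `R` preserves `M^∞`. -/
theorem norm_stft_compDist_le (hR : IsCovariant R) (u : ModulationSpace ∞ ι) (w : Phase ι) :
    ‖stft (gaussian ι) (compDist u.toDist R) w‖ ≤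
      ‖u‖ * ∫ z, ‖stftFun (gaussian ι) (conjS (R (conjS (gaussian ι)))) z‖ := by
  rw [stft, compDist_apply]
  have h := norm_apply_conjS_le u (conjS (R (conjS (tfShiftS w (gaussian ι)))))
  rw [conjS_conjS] at h
  rwa [integral_norm_stftFun_covariant hR.conj w (gaussian ι)] at h

/-- The composition of an element of `M^∞` with a covariant operator. -/
def compModulation (u : ModulationSpace ∞ ι) (hR : IsCovariant R) : ModulationSpace ∞ ι :=
  ⟨compDist u.toDist R, mem_modulationSubmodule_top (norm_stft_compDist_le hR u)⟩

theorem toDist_compModulation (u : ModulationSpace ∞ ι) (hR : IsCovariant R) :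
    (compModulation u hR).toDist = compDist u.toDist R := rfl

/-- Adjointness of covariant operators, extended from Schwartz functions to `M¹`. -/
theorem bracket_compModulation (u : ModulationSpace ∞ ι) (hR : IsCovariant R)
    {S : 𝓢(EuclideanSpace ℝ ι, ℂ) → 𝓢(EuclideanSpace ℝ ι, ℂ)} (hS : IsCovariant S)
    (hRS : ∀ φ, R (conjS (S φ)) = conjS φ) {Φ Ψ : EuclideanSpace ℝ ι → ℂ}
    (hΦ : Integrable (stftFun (gaussian ι) Φ))
    (hΨ : ∀ y, Ψ y = ∫ z, stftFun (gaussian ι) Φ z * S (tfShiftS z (gaussian ι)) y) :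
    bracket (compModulation u hR).toDist Ψ = bracket u.toDist Φ := by
  set U := compModulation u hR
  have hS' := hS
  obtain ⟨L, c, hL, hc, hn, hS⟩ := hS
  have hK : ∀ z y, S (tfShiftS z (gaussian ι)) y = c z * tfShift (L z) (S (gaussian ι)) y :=
    fun z y => by rw [hS, smul_apply, tfShiftS_apply, smul_eq_mul]
  have hKc : Continuous (Function.uncurry fun z y => S (tfShiftS z (gaussian ι)) y) := by
    have h1 := (continuous_tfShift (S (gaussian ι)).continuous).comp
      ((hL.comp continuous_fst).prodMk continuous_snd :
        Continuous fun p : Phase ι × EuclideanSpace ℝ ι => (L p.1, p.2))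
    have h2 := (hc.comp continuous_fst).mul h1
    refine h2.congr fun p => ?_
    exact (hK p.1 p.2).symm
  -- The functions `S(π(z)φ)` are bounded uniformly in `z`, so the transform can be taken inside the
  -- superposition `hΨ`.
  have hV : ∀ w, stftFun (gaussian ι) Ψ w =
      ∫ z, stftFun (gaussian ι) Φ z * stftFun (gaussian ι) (S (tfShiftS z (gaussian ι))) w := by
    intro w
    rw [← stftFun_integral (K := fun z => S (tfShiftS z (gaussian ι)))
      (M := SchwartzMap.seminorm ℂ 0 0 (S (gaussian ι))) hΦ hKc.aestronglyMeasurable ?_ w]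
    · congr 1
      exact funext hΨ
    · intro z y
      rw [hK, norm_mul, hn, one_mul]
      exact norm_tfShift_le _ _ _
  have hVS : ∀ z w, stftFun (gaussian ι) (S (tfShiftS z (gaussian ι))) w =
      c z * stftFun (gaussian ι) (tfShift (L z) (S (gaussian ι))) w := fun z w => by
    have e : (⇑(S (tfShiftS z (gaussian ι))) : EuclideanSpace ℝ ι → ℂ) =
        c z • tfShift (L z) (S (gaussian ι)) := funext (hK z)
    rw [e, stftFun_smul]
    rfl
  have hVSc : Continuous fun p : Phase ι × Phase ι =>
      stftFun (gaussian ι) (S (tfShiftS p.1 (gaussian ι))) p.2 := by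
    have h1 := (continuous_stftFun_tfShift (S (gaussian ι))).comp
      ((hL.comp continuous_fst).prodMk continuous_snd :
        Continuous fun p : Phase ι × Phase ι => (L p.1, p.2))
    have h2 := (hc.comp continuous_fst).mul h1
    refine h2.congr fun p => ?_
    exact (hVS p.1 p.2).symm
  -- Absolute convergence of the double integral follows from three facts: `VΦ` is integrable, `VU`
  -- is bounded, and the `M¹` norm of `S(π(z)φ)` does not depend on `z`.
  have hint := integrable_prod_kernel (μ := volume) (ν := volume)
    (c := fun z => conj (stftFun (gaussian ι) Φ z))
    (K := fun z w => stft (gaussian ι) U.toDist w *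
      conj (stftFun (gaussian ι) (S (tfShiftS z (gaussian ι))) w))
    (B := fun _ => ‖U‖ * ∫ w, ‖stftFun (gaussian ι) (S (gaussian ι)) w‖)
    (Complex.continuous_conj.comp_aestronglyMeasurable hΦ.1)
    (((continuous_stft U.toDist).comp continuous_snd).mul
      (Complex.continuous_conj.comp hVSc)).aestronglyMeasurable
    (fun z => by
      refine Integrable.bdd_mul (c := ‖U‖) ?_ (continuous_stft U.toDist).aestronglyMeasurable
        (Filter.Eventually.of_forall (norm_stft_le U))
      exact (Complex.conjCLE : ℂ →L[ℝ] ℂ).integrable_comp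
        (integrable_stftFun_schwartz (S (tfShiftS z (gaussian ι)))))
    (fun z => by
      rw [← integral_norm_stftFun_covariant hS' z, ← integral_const_mul]
      refine integral_mono_of_nonneg (Filter.Eventually.of_forall fun w => norm_nonneg _)
        ((integrable_stftFun_schwartz _).norm.const_mul _) (Filter.Eventually.of_forall fun w => ?_)
      simp only [norm_mul, RCLike.norm_conj]
      gcongr
      exact norm_stft_le U w)
    (by simpa only [RCLike.norm_conj] using hΦ.norm.mul_const _)
  calc bracket U.toDist Ψ
      = ∫ w, ∫ z, conj (stftFun (gaussian ι) Φ z) * (stft (gaussian ι) U.toDist w *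
          conj (stftFun (gaussian ι) (S (tfShiftS z (gaussian ι))) w)) := by
        rw [bracket]
        congr 1
        funext w
        rw [hV, ← integral_conj, ← integral_const_mul]
        congr 1
        funext z
        rw [map_mul]
        ring
    _ = ∫ z, ∫ w, conj (stftFun (gaussian ι) Φ z) * (stft (gaussian ι) U.toDist w *
          conj (stftFun (gaussian ι) (S (tfShiftS z (gaussian ι))) w)) :=
        (integral_integral_swap hint).symm
    _ = ∫ z, conj (stftFun (gaussian ι) Φ z) *
          bracket U.toDist (S (tfShiftS z (gaussian ι))) := by
        simp_rw [integral_const_mul]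
        rfl
    _ = bracket u.toDist Φ := by
        rw [bracket]
        congr 1
        funext z
        -- The inner bracket involves only Schwartz functions, where `hRS` gives `U(conj S π(z)φ) =
        -- u(conj π(z)φ)`, the transform of `u` at `z`.
        rw [bracket_schwartz, toDist_compModulation, compDist_apply, hRS, mul_comm]
        rfl

/-- A distribution is determined by its brackets with the images of time-frequency shifts. -/
theorem eq_compDist_of_bracket_eq
    {P : 𝓢(EuclideanSpace ℝ ι, ℂ) →L[ℂ] 𝓢(EuclideanSpace ℝ ι, ℂ)}
    {S : 𝓢(EuclideanSpace ℝ ι, ℂ) → 𝓢(EuclideanSpace ℝ ι, ℂ)}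
    (hPS : ∀ φ, conjS (S φ) = P (conjS φ)) (hRP : ∀ φ, R (P φ) = φ) (hPR : ∀ φ, P (R φ) = φ)
    {u v : 𝓢'(EuclideanSpace ℝ ι, ℂ)}
    (h : ∀ z, bracket v (S (tfShiftS z (gaussian ι))) = bracket u (tfShift z (gaussian ι))) :
    v = compDist u R := by
  -- After composing the difference with `P`, its transform at `z` is the difference of the two
  -- brackets in `h z`, since `P` carries `conj π(z)φ` to the conjugate of `S(π(z)φ)`. Invertibility
  -- of `P` then removes the composition.
  have h0 : compDist (v - compDist u R) P = 0 := eq_zero_of_stft_eq_zero fun z => by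
    have h1 := h z
    rw [← tfShiftS_coe, bracket_schwartz, bracket_schwartz, hPS] at h1
    rw [stft, compDist_apply]
    change v (P _) - u (R (P _)) = 0
    rw [hRP, h1, sub_self]
  have h1 : ∀ φ, (v - compDist u R) φ = 0 := fun φ => by
    rw [← hPR φ]
    exact DFunLike.congr_fun h0 (R φ)
  ext φ
  exact sub_eq_zero.1 (h1 φ)

end Covariant

/-! ### Covariance of coordinate changes and of the partial Fourier transform. -/

/-- Since `By·ω = y·B*ω` and `By - x = B(y - B⁻¹x)`, the shift `(x, ω)` becomes `(B⁻¹x, B*ω)` and no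
phase appears. -/
theorem isCovariant_compCLM (B : EuclideanSpace ℝ ι ≃L[ℝ] EuclideanSpace ℝ ι) :
    IsCovariant (SchwartzMap.compCLMOfContinuousLinearEquiv (F := ℂ) ℂ B) := by
  refine ⟨fun z => (B.symm z.1, ContinuousLinearMap.adjoint (B : EuclideanSpace ℝ ι →L[ℝ] _) z.2),
    fun _ => 1, by fun_prop, continuous_const, fun _ => norm_one, fun z φ => ?_⟩
  ext y
  rw [one_smul, tfShiftS_apply]
  change tfShiftS z φ (B y) = _
  rw [tfShiftS_apply, tfShift, tfShift, ContinuousLinearMap.adjoint_inner_right]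
  change _ = _ * φ (B (y - B.symm z.1))
  rw [map_sub B, B.apply_symm_apply]
  rfl

theorem inner_pair (x y : EuclideanSpace ℝ ι) (z : EuclideanSpace ℝ (ι ⊕ ι)) :
    (inner ℝ (pair x y) z : ℝ) = inner ℝ x (fstL z) + inner ℝ y (sndL z) := by
  simp only [PiLp.inner_apply, Fintype.sum_sum_type]
  rfl

theorem inner_eq_fst_snd (w z : EuclideanSpace ℝ (ι ⊕ ι)) :
    (inner ℝ w z : ℝ) = inner ℝ (fstL w) (fstL z) + inner ℝ (sndL w) (sndL z) := by
  rw [← inner_pair, pair_fst_snd]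

theorem pair_sub (x y : EuclideanSpace ℝ ι) (z : EuclideanSpace ℝ (ι ⊕ ι)) :
    pair x y - z = pair (x - fstL z) (y - sndL z) := by
  conv_lhs => rw [← pair_fst_snd z]
  simp only [pair_eq, map_sub]
  abel

/-- Covariance of the partial Fourier transform. -/
theorem partialFourier_tfShift (φ : EuclideanSpace ℝ (ι ⊕ ι) → ℂ) (z : Phase (ι ⊕ ι))
    (y : EuclideanSpace ℝ (ι ⊕ ι)) :
    partialFourier (tfShift z φ) y =
      Complex.exp (2 * Real.pi * Complex.I * ((inner ℝ (sndL z.2) (sndL z.1) : ℝ) : ℂ)) *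
        tfShift (pair (fstL z.1) (sndL z.2), pair (fstL z.2) (-sndL z.1)) (partialFourier φ) y := by
  -- Substituting `t + x₂` for `t` removes the translation in the second variable. Collecting the
  -- exponents leaves the constant phase `e^{2πi ω₂·x₂}`.
  rw [tfShift, partialFourier_eq, partialFourier_eq, ← integral_const_mul, ← integral_const_mul,
    ← integral_add_right_eq_self _ (sndL z.1)]
  congr 1
  funext t
  simp only [tfShift, smul_eq_mul]
  rw [pair_sub, add_sub_cancel_right]
  have h1 : fstL (y - pair (fstL z.1) (sndL z.2)) = fstL y - fstL z.1 := by
    rw [map_sub, fstL_pair]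
  have h2 : sndL (y - pair (fstL z.1) (sndL z.2)) = sndL y - sndL z.2 := by
    rw [map_sub, sndL_pair]
  rw [h1, h2, ← mul_assoc, ← mul_assoc, ← mul_assoc, ← Complex.exp_add, ← Complex.exp_add,
    ← Complex.exp_add]
  congr 2
  rw [inner_pair, inner_eq_fst_snd y, fstL_pair, sndL_pair]
  simp only [inner_add_left, inner_sub_right, inner_neg_right,
    real_inner_comm (sndL z.1)]
  push_cast
  ring

theorem isCovariant_partialFourierCLM : IsCovariant (partialFourierCLM (ι := ι)) := by
  refine ⟨fun z => (pair (fstL z.1) (sndL z.2), pair (fstL z.2) (-sndL z.1)),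
    fun z => Complex.exp (2 * Real.pi * Complex.I * ((inner ℝ (sndL z.2) (sndL z.1) : ℝ) : ℂ)),
    ?_, by fun_prop, fun z => norm_exp_two_pi _, fun z φ => ?_⟩
  · simp only [pair_eq]
    fun_prop
  · ext y
    rw [smul_apply, tfShiftS_apply, partialFourierCLM_apply, tfShiftS_coe, partialFourier_tfShift]
    rfl

/-- The reflection `(x, t) ↦ (x, -t)`. -/
def reflectEquiv (ι : Type) [Fintype ι] :
    EuclideanSpace ℝ (ι ⊕ ι) ≃L[ℝ] EuclideanSpace ℝ (ι ⊕ ι) :=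
  LinearEquiv.toContinuousLinearEquiv
    { toFun := fun z => inlL (fstL z) + inrL (-sndL z)
      invFun := fun z => inlL (fstL z) + inrL (-sndL z)
      map_add' := fun x y => by simp only [map_add, map_neg]; abel
      map_smul' := fun c x => by simp
      left_inv := fun z => by
        simp only [← pair_eq, fstL_pair, sndL_pair, neg_neg, pair_fst_snd]
      right_inv := fun z => by
        simp only [← pair_eq, fstL_pair, sndL_pair, neg_neg, pair_fst_snd] }

theorem reflectEquiv_apply (z : EuclideanSpace ℝ (ι ⊕ ι)) :
    reflectEquiv ι z = pair (fstL z) (-sndL z) := (pair_eq _ _).symm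

/-- The inverse partial Fourier transform on the Schwartz space. -/
def partialFourierInvCLM :
    𝓢(EuclideanSpace ℝ (ι ⊕ ι), ℂ) →L[ℂ] 𝓢(EuclideanSpace ℝ (ι ⊕ ι), ℂ) :=
  partialFourierCLM.comp (SchwartzMap.compCLMOfContinuousLinearEquiv ℂ (reflectEquiv ι))

theorem partialFourierCLM_eq_fourier (Ψ : 𝓢(EuclideanSpace ℝ (ι ⊕ ι), ℂ))
    (x y : EuclideanSpace ℝ ι) :
    partialFourierCLM Ψ (pair x y) = (𝓕 (sectionS x Ψ) : 𝓢(EuclideanSpace ℝ ι, ℂ)) y := rfl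

theorem partialFourierInvCLM_eq_fourierInv (Ψ : 𝓢(EuclideanSpace ℝ (ι ⊕ ι), ℂ))
    (x y : EuclideanSpace ℝ ι) :
    partialFourierInvCLM Ψ (pair x y) = (𝓕⁻ (sectionS x Ψ) : 𝓢(EuclideanSpace ℝ ι, ℂ)) y := by
  have h1 : partialFourierInvCLM Ψ (pair x y) =
      𝓕 (fun t => Ψ (reflectEquiv ι (pair x t))) y := rfl
  have h2 : (𝓕⁻ (sectionS x Ψ) : 𝓢(EuclideanSpace ℝ ι, ℂ)) y =
      𝓕⁻ (fun t => Ψ (pair x t)) y := by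
    rw [SchwartzMap.fourierInv_coe]
    rfl
  rw [h1, h2, Real.fourierInv_eq_fourier_comp_neg]
  simp only [reflectEquiv_apply, fstL_pair, sndL_pair]

theorem partialFourierCLM_inv (Ψ : 𝓢(EuclideanSpace ℝ (ι ⊕ ι), ℂ)) :
    partialFourierCLM (partialFourierInvCLM Ψ) = Ψ := by
  ext z
  rw [← pair_fst_snd z, partialFourierCLM_eq_fourier]
  have h : sectionS (fstL z) (partialFourierInvCLM Ψ) = 𝓕⁻ (sectionS (fstL z) Ψ) := by
    ext t
    exact partialFourierInvCLM_eq_fourierInv Ψ (fstL z) t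
  rw [h, FourierTransform.fourier_fourierInv_eq]
  rfl

theorem partialFourierInvCLM_fourier (Ψ : 𝓢(EuclideanSpace ℝ (ι ⊕ ι), ℂ)) :
    partialFourierInvCLM (partialFourierCLM Ψ) = Ψ := by
  ext z
  rw [← pair_fst_snd z, partialFourierInvCLM_eq_fourierInv]
  have h : sectionS (fstL z) (partialFourierCLM Ψ) = 𝓕 (sectionS (fstL z) Ψ) := by
    ext t
    exact partialFourierCLM_eq_fourier Ψ (fstL z) t
  rw [h, FourierTransform.fourierInv_fourier_eq]
  rfl

/-- Conjugation changes the sign in the exponential and so exchanges the transform with its inverse.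
-/
theorem conjS_partialFourierCLM (Ψ : 𝓢(EuclideanSpace ℝ (ι ⊕ ι), ℂ)) :
    conjS (partialFourierCLM Ψ) = partialFourierInvCLM (conjS Ψ) := by
  ext z
  rw [conjS_apply, partialFourierCLM_apply]
  change _ = partialFourier (fun z => conj (Ψ (reflectEquiv ι z))) z
  rw [partialFourier_eq, partialFourier_eq, ← integral_conj,
    ← integral_neg_eq_self (fun t : EuclideanSpace ℝ ι => conj _)]
  congr 1
  funext t
  rw [reflectEquiv_apply, fstL_pair, sndL_pair, smul_eq_mul, smul_eq_mul, map_mul,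
    ← Complex.exp_conj]
  simp only [map_mul, map_neg, Complex.conj_ofReal, Complex.conj_I, map_ofNat, inner_neg_left]
  congr 2
  push_cast
  ring

/-! ### The operator `𝓕₂ 𝔗_B` and its superposition formula on `M¹`. -/

section Matrix

variable (B : EuclideanSpace ℝ (ι ⊕ ι) ≃L[ℝ] EuclideanSpace ℝ (ι ⊕ ι))

/-- The operator `𝓕₂ 𝔗_B` on the Schwartz space. -/
def wignerOp : 𝓢(EuclideanSpace ℝ (ι ⊕ ι), ℂ) →L[ℂ] 𝓢(EuclideanSpace ℝ (ι ⊕ ι), ℂ) :=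
  partialFourierCLM.comp (SchwartzMap.compCLMOfContinuousLinearEquiv ℂ B)

/-- The operator `𝔗_{B⁻¹} 𝓕₂` on the Schwartz space. -/
def wignerAdj : 𝓢(EuclideanSpace ℝ (ι ⊕ ι), ℂ) →L[ℂ] 𝓢(EuclideanSpace ℝ (ι ⊕ ι), ℂ) :=
  (SchwartzMap.compCLMOfContinuousLinearEquiv ℂ B.symm).comp partialFourierCLM

/-- The operator `𝓕₂⁻¹ 𝔗_B` on the Schwartz space. -/
def wignerAdjInv : 𝓢(EuclideanSpace ℝ (ι ⊕ ι), ℂ) →L[ℂ] 𝓢(EuclideanSpace ℝ (ι ⊕ ι), ℂ) :=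
  partialFourierInvCLM.comp (SchwartzMap.compCLMOfContinuousLinearEquiv ℂ B)

theorem isCovariant_wignerOp : IsCovariant (wignerOp B) :=
  isCovariant_partialFourierCLM.comp (isCovariant_compCLM B)

theorem isCovariant_wignerAdj : IsCovariant (wignerAdj B) :=
  (isCovariant_compCLM B.symm).comp isCovariant_partialFourierCLM

theorem wignerAdj_inv (φ : 𝓢(EuclideanSpace ℝ (ι ⊕ ι), ℂ)) :
    wignerAdj B (wignerAdjInv B φ) = φ := by
  change SchwartzMap.compCLMOfContinuousLinearEquiv ℂ B.symm
    (partialFourierCLM (partialFourierInvCLM _)) = φ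
  rw [partialFourierCLM_inv]
  ext z
  change φ (B (B.symm z)) = φ z
  rw [B.apply_symm_apply]

theorem wignerAdjInv_adj (φ : 𝓢(EuclideanSpace ℝ (ι ⊕ ι), ℂ)) :
    wignerAdjInv B (wignerAdj B φ) = φ := by
  have h : SchwartzMap.compCLMOfContinuousLinearEquiv ℂ B (wignerAdj B φ) =
      partialFourierCLM φ := by
    ext z
    change partialFourierCLM φ (B.symm (B z)) = _
    rw [B.symm_apply_apply]
  change partialFourierInvCLM (SchwartzMap.compCLMOfContinuousLinearEquiv ℂ B (wignerAdj B φ)) = φ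
  rw [h, partialFourierInvCLM_fourier]

theorem conjS_wignerOp (φ : 𝓢(EuclideanSpace ℝ (ι ⊕ ι), ℂ)) :
    conjS (wignerOp B φ) = wignerAdjInv B (conjS φ) := by
  change conjS (partialFourierCLM _) = _
  rw [conjS_partialFourierCLM]
  rfl

/-- The adjoint relation required by `bracket_compModulation`. It contains no determinant because
`𝔗_{B⁻¹}` is the inverse of `𝔗_B`, which differs from its adjoint by that factor. -/
theorem wignerAdj_conjS_wignerOp (φ : 𝓢(EuclideanSpace ℝ (ι ⊕ ι), ℂ)) :
    wignerAdj B (conjS (wignerOp B φ)) = conjS φ := by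
  rw [conjS_wignerOp, wignerAdj_inv]

theorem wignerOp_apply (φ : 𝓢(EuclideanSpace ℝ (ι ⊕ ι), ℂ)) (y : EuclideanSpace ℝ (ι ⊕ ι)) :
    wignerOp B φ y = partialFourier (fun z => φ (B z)) y := rfl

/-- With `(a, b) = B⁻¹z₁` one has `B(x, t) - z₁ = B(x - a, t - b)`. The shift thus acts on the bound
for sections as a translation in `t`, which leaves its integral unchanged. Uniformity in `z` permits
exchanging the Fourier integral with superpositions over `z`. -/
theorem exists_integral_norm_section_le (φ : 𝓢(EuclideanSpace ℝ (ι ⊕ ι), ℂ)) :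
    ∃ C : ℝ, ∀ (x : EuclideanSpace ℝ ι) (z : Phase (ι ⊕ ι)),
      Integrable (fun t => tfShift z φ (B (pair x t))) ∧
      ∫ t, ‖tfShift z φ (B (pair x t))‖ ≤ C := by
  obtain ⟨C, hC⟩ := norm_schwartz_pair_le (SchwartzMap.compCLMOfContinuousLinearEquiv ℂ B φ)
    (Measure.integrablePower (volume : Measure (EuclideanSpace ℝ ι)))
  have hint := (Measure.integrable_pow_neg_integrablePower
    (volume : Measure (EuclideanSpace ℝ ι))).const_mul C
  refine ⟨∫ t : EuclideanSpace ℝ ι, C * (1 + ‖t‖) ^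
      (-(Measure.integrablePower (volume : Measure (EuclideanSpace ℝ ι)) : ℝ)), fun x z => ?_⟩
  have hb : ∀ t, ‖tfShift z φ (B (pair x t))‖ ≤ C * (1 + ‖t - sndL (B.symm z.1)‖) ^
      (-(Measure.integrablePower (volume : Measure (EuclideanSpace ℝ ι)) : ℝ)) := fun t => by
    have h1 : B (pair x t) - z.1 =
        B (pair (x - fstL (B.symm z.1)) (t - sndL (B.symm z.1))) := by
      rw [← pair_sub, map_sub, B.apply_symm_apply]
    rw [norm_tfShift, h1]
    exact hC _ _
  have hs := hint.comp_sub_right (sndL (B.symm z.1))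
  have hi : Integrable fun t => tfShift z φ (B (pair x t)) := by
    refine hs.mono' (Continuous.aestronglyMeasurable ?_) (Filter.Eventually.of_forall hb)
    have h2 := (tfShiftS z φ).continuous.comp (B.continuous.comp (continuous_pair x))
    rw [tfShiftS_coe] at h2
    exact h2
  refine ⟨hi, (integral_mono hi.norm hs hb).trans (le_of_eq ?_)⟩
  exact integral_sub_right_eq_self (fun t : EuclideanSpace ℝ ι => C * (1 + ‖t‖) ^
      (-(Measure.integrablePower (volume : Measure (EuclideanSpace ℝ ι)) : ℝ))) _

/-- The operator `𝓕₂ 𝔗_B` acts on `M¹` by superposition of its values on time-frequency shifts. -/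
theorem partialFourier_comp_eq_integral {Φ : EuclideanSpace ℝ (ι ⊕ ι) → ℂ} (hc : Continuous Φ)
    (hi : Integrable Φ) (hV : Integrable (stftFun (gaussian (ι ⊕ ι)) Φ))
    (y : EuclideanSpace ℝ (ι ⊕ ι)) :
    partialFourier (fun z => Φ (B z)) y =
      ∫ z, stftFun (gaussian (ι ⊕ ι)) Φ z * wignerOp B (tfShiftS z (gaussian (ι ⊕ ι))) y := by
  obtain ⟨C, hC⟩ := exists_integral_norm_section_le B (gaussian (ι ⊕ ι))
  have hexp : Continuous fun t : EuclideanSpace ℝ ι =>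
      Complex.exp (-(2 * Real.pi * Complex.I) * (inner ℝ t (sndL y) : ℝ)) := by fun_prop
  have hKc : Continuous (Function.uncurry fun (z : Phase (ι ⊕ ι)) (t : EuclideanSpace ℝ ι) =>
      Complex.exp (-(2 * Real.pi * Complex.I) * (inner ℝ t (sndL y) : ℝ)) *
        tfShift z (gaussian (ι ⊕ ι)) (B (pair (fstL y) t))) := by
    have h1 := (continuous_tfShift (gaussian (ι ⊕ ι)).continuous).comp
      (continuous_fst.prodMk (B.continuous.comp ((continuous_pair (fstL y)).comp continuous_snd)) :
        Continuous fun p : Phase (ι ⊕ ι) × EuclideanSpace ℝ ι => (p.1, B (pair (fstL y) p.2)))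
    exact (hexp.comp continuous_snd).mul h1
  have hint := integrable_prod_kernel (μ := volume) (ν := volume) (B := fun _ => C) hV.1
    hKc.aestronglyMeasurable
    (fun z => (hC (fstL y) z).1.bdd_mul (c := 1) hexp.aestronglyMeasurable
      (Filter.Eventually.of_forall fun t => (norm_exp_neg _).le))
    (fun z => by
      simp only [norm_mul, norm_exp_neg, one_mul]
      exact (hC (fstL y) z).2)
    (hV.norm.mul_const C)
  rw [partialFourier_eq]
  calc _ = ∫ t : EuclideanSpace ℝ ι, ∫ z, stftFun (gaussian (ι ⊕ ι)) Φ z *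
          (Complex.exp (-(2 * Real.pi * Complex.I) * (inner ℝ t (sndL y) : ℝ)) *
            tfShift z (gaussian (ι ⊕ ι)) (B (pair (fstL y) t))) := by
        congr 1
        funext t
        rw [← stftFun_inversion hc hi hV (B (pair (fstL y) t)), smul_eq_mul, ← integral_const_mul]
        congr 1
        funext z
        ring
    _ = ∫ z, ∫ t : EuclideanSpace ℝ ι, stftFun (gaussian (ι ⊕ ι)) Φ z *
          (Complex.exp (-(2 * Real.pi * Complex.I) * (inner ℝ t (sndL y) : ℝ)) *
            tfShift z (gaussian (ι ⊕ ι)) (B (pair (fstL y) t))) :=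
        (integral_integral_swap hint).symm
    _ = _ := by
        congr 1
        funext z
        rw [integral_const_mul, wignerOp_apply, partialFourier_eq]
        congr 2
        funext t
        rw [tfShiftS_apply, smul_eq_mul]

end Matrix

/-! ### Elements of `M^∞` synthesized from bounded functions on phase space. -/

section BoundedSymbol

/-- A bounded function on phase space, as an element of `L^∞(ℝ²ᵈ)`. -/
def symbolLp {h : Phase ι → ℂ} {M : ℝ} (hm : Measurable h) (hM : ∀ z, ‖h z‖ ≤ M) :
    Lp ℂ ∞ (volume : Measure (EuclideanSpace ℝ (ι ⊕ ι))) :=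
  MemLp.toLp (fun p => h ((pairEquiv ι).symm p))
    (memLp_top_of_bound (hm.comp (pairEquiv ι).symm.measurable).aestronglyMeasurable M
      (Filter.Eventually.of_forall fun _ => hM _))

/-- The tempered distribution `Ψ ↦ ∫ h(z) VΨ(z) dz` with a bounded function `h`. -/
def synthesisDist {h : Phase ι → ℂ} {M : ℝ} (hm : Measurable h) (hM : ∀ z, ‖h z‖ ≤ M) :
    𝓢'(EuclideanSpace ℝ ι, ℂ) :=
  PointwiseConvergenceCLM.precomp ℂ (stftS ι) (Lp.toTemperedDistribution (symbolLp hm hM))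

theorem synthesisDist_apply {h : Phase ι → ℂ} {M : ℝ} (hm : Measurable h)
    (hM : ∀ z, ‖h z‖ ≤ M) (Ψ : 𝓢(EuclideanSpace ℝ ι, ℂ)) :
    synthesisDist hm hM Ψ = ∫ z, h z * stftFun (gaussian ι) Ψ z := by
  have h1 : synthesisDist hm hM Ψ = ∫ p, stftS ι Ψ p * h ((pairEquiv ι).symm p) := by
    change Lp.toTemperedDistribution (symbolLp hm hM) (stftS ι Ψ) = _
    rw [Lp.toTemperedDistribution_apply]
    refine integral_congr_ae ?_
    have h2 : symbolLp hm hM =ᵐ[volume] fun p => h ((pairEquiv ι).symm p) := MemLp.coeFn_toLp _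
    filter_upwards [h2] with p hp
    rw [hp, smul_eq_mul]
  rw [h1, ← measurePreserving_pairEquiv.integral_comp' (fun p => stftS ι Ψ p * _)]
  congr 1
  funext z
  rw [(pairEquiv ι).symm_apply_apply, stftFun_eq_stftS, mul_comm]
  rfl

variable {h : Phase ι → ℂ} {M : ℝ}

theorem stft_synthesisDist (hm : Measurable h) (hM : ∀ z, ‖h z‖ ≤ M)
    (w : Phase ι) : stft (gaussian ι) (synthesisDist hm hM) w =
      ∫ z, h z * stftFun (gaussian ι) (tfShift (conjPhase w) (gaussian ι)) z := by
  rw [stft_eq, synthesisDist_apply, tfShiftS_coe]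

theorem integral_norm_stftFun_tfShift (w : Phase ι) :
    ∫ z, ‖stftFun (gaussian ι) (tfShift w (gaussian ι)) z‖ =
      ∫ z, ‖stftFun (gaussian ι) (gaussian ι) z‖ := by
  simp_rw [norm_stftFun_tfShift]
  exact integral_sub_right_eq_self (fun z => ‖stftFun (gaussian ι) (gaussian ι) z‖) w

theorem integrable_stftFun_tfShift (w : Phase ι) :
    Integrable (stftFun (gaussian ι) (tfShift w (gaussian ι))) := by
  rw [← tfShiftS_coe]
  exact integrable_stftFun_schwartz _

theorem integrable_synthesis_kernel (hm : Measurable h) (hM : ∀ z, ‖h z‖ ≤ M)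
    (w : Phase ι) :
    Integrable fun z => h z * stftFun (gaussian ι) (tfShift w (gaussian ι)) z :=
  (integrable_stftFun_tfShift w).bdd_mul (c := M) hm.aestronglyMeasurable
    (Filter.Eventually.of_forall hM)

theorem integral_norm_synthesis_kernel_le (hm : Measurable h) (hM : ∀ z, ‖h z‖ ≤ M)
    (w : Phase ι) :
    ∫ z, ‖h z * stftFun (gaussian ι) (tfShift w (gaussian ι)) z‖ ≤
      M * ∫ z, ‖stftFun (gaussian ι) (gaussian ι) z‖ := by
  rw [← integral_norm_stftFun_tfShift w, ← integral_const_mul]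
  refine integral_mono (integrable_synthesis_kernel hm hM w).norm
    ((integrable_stftFun_tfShift w).norm.const_mul M) fun z => ?_
  simp only [norm_mul]
  gcongr
  exact hM z

/-- The element of `M^∞` synthesized from a bounded function on phase space. -/
def synthesis (hm : Measurable h) (hM : ∀ z, ‖h z‖ ≤ M) : ModulationSpace ∞ ι :=
  ⟨synthesisDist hm hM, mem_modulationSubmodule_top
    (C := M * ∫ z, ‖stftFun (gaussian ι) (gaussian ι) z‖) fun w => by
      rw [stft_synthesisDist]
      exact (norm_integral_le_integral_norm _).trans (integral_norm_synthesis_kernel_le hm hM _)⟩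

/-- The conjugate makes the bracket linear in `Φ`: after a reflection it is the integral of `VΦ(w)`
against the synthesized distribution evaluated at `π(w)φ`. Fubini and the reproducing formula then
eliminate `w`. So `h` serves as a coefficient function even though it need not be the short-time
Fourier transform of the distribution. -/
theorem bracket_synthesis (hm : Measurable h) (hM : ∀ z, ‖h z‖ ≤ M)
    {Φ : EuclideanSpace ℝ ι → ℂ} (hc : Continuous Φ) (hi : Integrable Φ)
    (hV : Integrable (stftFun (gaussian ι) Φ)) :
    bracket (synthesis hm hM).toDist (fun t => conj (Φ t)) =
      ∫ z, h z * stftFun (gaussian ι) Φ z := by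
  have hint := integrable_prod_kernel (μ := volume) (ν := volume)
    (K := fun w z => h z * stftFun (gaussian ι) (tfShift w (gaussian ι)) z) hV.1
    ((hm.comp measurable_snd).aestronglyMeasurable.mul
      (continuous_stftFun_tfShift (gaussian ι)).aestronglyMeasurable)
    (integrable_synthesis_kernel hm hM) (integral_norm_synthesis_kernel_le hm hM)
    (hV.norm.mul_const _)
  calc bracket (synthesis hm hM).toDist (fun t => conj (Φ t))
      = ∫ w, (fun w => (∫ z, h z * stftFun (gaussian ι) (tfShift w (gaussian ι)) z) *
          stftFun (gaussian ι) Φ w) (conjPhase w) := by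
        rw [bracket]
        congr 1
        funext w
        rw [stftFun_conj, Complex.conj_conj]
        congr 1
        exact stft_synthesisDist hm hM w
    _ = ∫ w, (∫ z, h z * stftFun (gaussian ι) (tfShift w (gaussian ι)) z) *
          stftFun (gaussian ι) Φ w :=
        integral_conjPhase fun w =>
          (∫ z, h z * stftFun (gaussian ι) (tfShift w (gaussian ι)) z) * stftFun (gaussian ι) Φ w
    _ = ∫ w, ∫ z, stftFun (gaussian ι) Φ w *
          (h z * stftFun (gaussian ι) (tfShift w (gaussian ι)) z) := by
        simp_rw [integral_const_mul, mul_comm]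
    _ = ∫ z, ∫ w, stftFun (gaussian ι) Φ w *
          (h z * stftFun (gaussian ι) (tfShift w (gaussian ι)) z) := integral_integral_swap hint
    _ = _ := by
        congr 1
        funext z
        rw [← stftFun_reproducing hc hi hV z, ← integral_const_mul]
        congr 1
        funext w
        ring

end BoundedSymbol

/-! ### Tensor products and the doubled phase space. -/

section Tensor

/-- The exponentials and the normalizations both multiply, as `2^{2d/4}` is the square of `2^{d/4}`.
This is what makes shifts and short-time Fourier transforms on `ℝ²ᵈ` factor. -/
theorem gaussian_pair (s t : EuclideanSpace ℝ ι) :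
    gaussian (ι ⊕ ι) (pair s t) = gaussian ι s * gaussian ι t := by
  rw [gaussian_apply, gaussian_apply, gaussian_apply, ← Complex.ofReal_mul, norm_pair_sq]
  congr 1
  rw [mul_mul_mul_comm, ← Real.rpow_add two_pos, ← Real.exp_add, Fintype.card_sum]
  congr 2
  · push_cast; ring
  · ring

theorem tfShift_pair (z w : Phase ι) (s t : EuclideanSpace ℝ ι) :
    tfShift (pair z.1 w.1, pair z.2 w.2) (gaussian (ι ⊕ ι)) (pair s t) =
      tfShift z (gaussian ι) s * tfShift w (gaussian ι) t := by
  simp only [tfShift]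
  rw [pair_sub, fstL_pair, sndL_pair, gaussian_pair, inner_pair, fstL_pair, sndL_pair]
  push_cast
  rw [mul_add, Complex.exp_add]
  ring

theorem integrable_pair_iff {F : EuclideanSpace ℝ (ι ⊕ ι) → ℂ} :
    Integrable (fun z : Phase ι => F (pair z.1 z.2)) ↔ Integrable F :=
  measurePreserving_pairEquiv.integrable_comp_emb (pairEquiv ι).measurableEmbedding

theorem integral_pair (F : EuclideanSpace ℝ (ι ⊕ ι) → ℂ) :
    ∫ z : Phase ι, F (pair z.1 z.2) = ∫ p, F p :=
  measurePreserving_pairEquiv.integral_comp' F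

theorem continuous_tensor {a b : EuclideanSpace ℝ ι → ℂ} (ha : Continuous a) (hb : Continuous b) :
    Continuous (tensor a b) :=
  (ha.comp fstL.continuous).mul (hb.comp sndL.continuous)

theorem integrable_tensor {a b : EuclideanSpace ℝ ι → ℂ} (ha : Integrable a) (hb : Integrable b) :
    Integrable (tensor a b) :=
  integrable_pair_iff.1 (ha.mul_prod hb)

theorem stftFun_tensor (a b : EuclideanSpace ℝ ι → ℂ) (z w : Phase ι) :
    stftFun (gaussian (ι ⊕ ι)) (tensor a b) (pair z.1 w.1, pair z.2 w.2) =
      stftFun (gaussian ι) a z * stftFun (gaussian ι) b w := by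
  rw [stftFun, stftFun, stftFun, ← integral_prod_mul, ← integral_pair]
  congr 1
  funext p
  rw [tfShift_pair, map_mul, tensor, fstL_pair, sndL_pair]
  ring

/-- The identification of a pair of points of phase space with a point of the doubled phase
space. -/
def phaseEquiv (ι : Type) [Fintype ι] : Phase ι × Phase ι ≃ᵐ Phase (ι ⊕ ι) where
  toFun p := (pair p.1.1 p.2.1, pair p.1.2 p.2.2)
  invFun q := ((fstL q.1, fstL q.2), (sndL q.1, sndL q.2))
  left_inv _ := rfl
  right_inv q := Prod.ext (pair_fst_snd q.1) (pair_fst_snd q.2)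
  measurable_toFun := by
    have h : Continuous fun p : Phase ι × Phase ι => (pair p.1.1 p.2.1, pair p.1.2 p.2.2) := by
      simp only [pair_eq]
      fun_prop
    exact h.measurable
  measurable_invFun := by
    have h : Continuous fun q : Phase (ι ⊕ ι) =>
      (((fstL q.1, fstL q.2), (sndL q.1, sndL q.2)) : Phase ι × Phase ι) := by fun_prop
    exact h.measurable

theorem measurePreserving_prod_shuffle {α β γ δ : Type*} [MeasureSpace α] [MeasureSpace β]
    [MeasureSpace γ] [MeasureSpace δ] [SFinite (volume : Measure α)] [SFinite (volume : Measure β)]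
    [SFinite (volume : Measure γ)] [SFinite (volume : Measure δ)] :
    MeasurePreserving (fun p : (α × β) × (γ × δ) => ((p.1.1, p.2.1), (p.1.2, p.2.2))) := by
  have h1 : MeasurePreserving (MeasurableEquiv.prodAssoc : (α × β) × (γ × δ) ≃ᵐ _) :=
    volume_preserving_prodAssoc
  have h2 : MeasurePreserving (MeasurableEquiv.prodAssoc.symm : β × (γ × δ) ≃ᵐ (β × γ) × δ) :=
    volume_preserving_prodAssoc.symm _
  have h3 : MeasurePreserving (Prod.swap : β × γ → γ × β) := Measure.measurePreserving_swap
  have h4 : MeasurePreserving (MeasurableEquiv.prodAssoc : (γ × β) × δ ≃ᵐ γ × (β × δ)) :=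
    volume_preserving_prodAssoc
  have h5 : MeasurePreserving (MeasurableEquiv.prodAssoc.symm : α × (γ × (β × δ)) ≃ᵐ _) :=
    volume_preserving_prodAssoc.symm _
  have h6 := h4.comp ((h3.prod (MeasurePreserving.id (volume : Measure δ))).comp h2)
  exact h5.comp (((MeasurePreserving.id (volume : Measure α)).prod h6).comp h1)

theorem measurePreserving_phaseEquiv : MeasurePreserving (phaseEquiv ι) :=
  (measurePreserving_pairEquiv.prod measurePreserving_pairEquiv).comp
    measurePreserving_prod_shuffle

theorem integrable_stftFun_tensor {a b : EuclideanSpace ℝ ι → ℂ}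
    (ha : Integrable (stftFun (gaussian ι) a)) (hb : Integrable (stftFun (gaussian ι) b)) :
    Integrable (stftFun (gaussian (ι ⊕ ι)) (tensor a b)) := by
  refine (measurePreserving_phaseEquiv.integrable_comp_emb
    (phaseEquiv ι).measurableEmbedding).1 ((ha.mul_prod hb).congr
      (Filter.Eventually.of_forall fun p => ?_))
  exact (stftFun_tensor a b p.1 p.2).symm

theorem integrable_stftFun_conj {f : EuclideanSpace ℝ ι → ℂ}
    (hf : Integrable (stftFun (gaussian ι) f)) :
    Integrable (stftFun (gaussian ι) fun t => conj (f t)) := by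
  have h1 := (measurePreserving_conjPhase.integrable_comp_emb
    (measurableEmbedding_conjPhase (ι := ι))).2 hf
  refine ((Complex.conjCLE : ℂ →L[ℝ] ℂ).integrable_comp h1).congr
    (Filter.Eventually.of_forall fun z => ?_)
  exact (stftFun_conj f z).symm

end Tensor

/-! ### Matrix coefficients of `T` and the kernel theorem. -/

section Operator

namespace M1

theorem continuous (f : M1 ι) : Continuous f := f.2.1

/-- Elements of `M¹` as functions. -/
def coeLin (ι : Type) [Fintype ι] : M1 ι →ₗ[ℂ] EuclideanSpace ℝ ι → ℂ where
  toFun f := f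
  map_add' _ _ := rfl
  map_smul' _ _ := rfl

/-- The time-frequency shifts of the Gaussian as elements of `M¹`. -/
def shift (z : Phase ι) : M1 ι :=
  ⟨tfShift z (gaussian ι), by
    rw [← tfShiftS_coe]
    exact ⟨(tfShiftS z (gaussian ι)).continuous, (tfShiftS z (gaussian ι)).integrable,
      integrable_stftFun_schwartz _⟩⟩

theorem shift_apply (z : Phase ι) (t : EuclideanSpace ℝ ι) :
    shift z t = tfShift z (gaussian ι) t := rfl

theorem norm_shift (z : Phase ι) :
    ‖shift z‖ = ∫ w, ‖stftFun (gaussian ι) (gaussian ι) w‖ :=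
  integral_norm_stftFun_tfShift z

end M1

variable (T : M1 ι →L[ℂ] ModulationSpace ∞ ι)

/-- The coefficient functional `f ↦ V(T f)(w)` on `M¹`. -/
def stftCoeff (w : Phase ι) : M1 ι →ₗ[ℂ] ℂ where
  toFun f := stft (gaussian ι) (T f).toDist w
  map_add' f g := by rw [map_add, map_add, stft_add]; rfl
  map_smul' a f := by rw [map_smul, map_smul, stft_smul]; rfl

theorem norm_stftCoeff_le (w : Phase ι) (f : M1 ι) : ‖stftCoeff T w f‖ ≤ ‖T‖ * ‖f‖ :=
  (norm_stft_le (T f) w).trans (T.le_opNorm f)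

/-- Boundedness of `T` makes `f ↦ V(Tf)(w)` bounded on `M¹`, so `functional_inversion` applies with
the trivial weight, `N = 0`. -/
theorem stftCoeff_inversion (w : Phase ι) :
    (Continuous fun z => stftCoeff T w (M1.shift z)) ∧
      ∀ f : M1 ι, ∫ z, stftFun (gaussian ι) f z * stftCoeff T w (M1.shift z) =
        stftCoeff T w f := by
  refine functional_inversion 0 (M1.coeLin ι) M1.continuous M1.integrable (fun f => ?_)
    M1.integrable_stft M1.shift (fun z => rfl) (stftCoeff T w) ‖T‖ (fun f => ?_)
  · refine f.integrable_stft.congr (Filter.Eventually.of_forall fun z => ?_)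
    simp only [weight, pow_zero, one_mul]
    rfl
  · simp only [pow_zero, one_mul]
    exact norm_stftCoeff_le T w f

/-- The matrix coefficients of `T` with respect to time-frequency shifts. -/
def matrixCoeff (q : Phase (ι ⊕ ι)) : ℂ :=
  stftCoeff T (conjPhase ((phaseEquiv ι).symm q).1) (M1.shift ((phaseEquiv ι).symm q).2)

/-- A Carathéodory function: continuity in `w`, as for every short-time Fourier transform, together
with measurability in `z` gives joint measurability without any joint continuity. -/
theorem measurable_uncurry_stftCoeff :
    Measurable fun p : Phase ι × Phase ι => stftCoeff T p.1 (M1.shift p.2) := by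
  have h1 : ∀ z, Continuous fun w => stftCoeff T w (M1.shift z) :=
    fun z => continuous_stft (T (M1.shift z)).toDist
  have h2 : ∀ w, Measurable fun z => stftCoeff T w (M1.shift z) :=
    fun w => (stftCoeff_inversion T w).1.measurable
  exact measurable_uncurry_of_continuous_of_measurable (u := fun w z => stftCoeff T w (M1.shift z))
    h1 h2

theorem measurable_conjPhase_phaseEquiv {u : Phase ι → Phase ι → ℂ}
    (hu : Measurable fun p : Phase ι × Phase ι => u p.1 p.2) :
    Measurable fun q : Phase (ι ⊕ ι) =>
      u (conjPhase ((phaseEquiv ι).symm q).1) ((phaseEquiv ι).symm q).2 := by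
  have h1 : Measurable fun p : Phase ι × Phase ι => conjPhase p.1 :=
    Measurable.comp (g := conjPhase) continuous_conjPhase.measurable measurable_fst
  have h2 : Measurable fun p : Phase ι × Phase ι => u (conjPhase p.1) p.2 :=
    hu.comp (Measurable.prodMk h1 measurable_snd)
  exact h2.comp (phaseEquiv ι).symm.measurable

theorem measurable_matrixCoeff : Measurable (matrixCoeff T) :=
  measurable_conjPhase_phaseEquiv (u := fun w z => stftCoeff T w (M1.shift z))
    (measurable_uncurry_stftCoeff T)

theorem norm_matrixCoeff_le (q : Phase (ι ⊕ ι)) :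
    ‖matrixCoeff T q‖ ≤ ‖T‖ * ∫ w, ‖stftFun (gaussian ι) (gaussian ι) w‖ := by
  rw [← M1.norm_shift ((phaseEquiv ι).symm q).2]
  exact norm_stftCoeff_le T _ _

/-- The kernel theorem for `M¹` and `M^∞`. -/
theorem exists_isIntegralOp : ∃ k, IsIntegralOp T k := by
  refine ⟨synthesis (measurable_matrixCoeff T) (norm_matrixCoeff_le T), fun f g => ?_⟩
  have hVg := integrable_stftFun_conj g.integrable_stft
  have hgi : Integrable fun t => conj (g t) :=
    (Complex.conjCLE : ℂ →L[ℝ] ℂ).integrable_comp g.integrable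
  have hgc : Continuous fun t => conj (g t) := Complex.continuous_conj.comp g.continuous
  -- `bracket_synthesis` pairs with the conjugate of a function, so `g ⊗ conj f` is written as the
  -- conjugate of `conj g ⊗ f`.
  have h1 := bracket_synthesis (measurable_matrixCoeff T) (norm_matrixCoeff_le T)
    (continuous_tensor hgc f.continuous) (integrable_tensor hgi f.integrable)
    (integrable_stftFun_tensor hVg f.integrable_stft)
  have h2 : (fun t => conj (tensor (fun t => conj (g t)) f t)) =
      tensor g fun t => conj (f t) := by
    funext t
    simp only [tensor, map_mul, Complex.conj_conj]
  rw [h2] at h1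
  rw [h1, ← measurePreserving_phaseEquiv.integral_comp' fun q => matrixCoeff T q * _]
  have h3 : ∀ p : Phase ι × Phase ι, matrixCoeff T (phaseEquiv ι p) *
      stftFun (gaussian (ι ⊕ ι)) (tensor (fun t => conj (g t)) f) (phaseEquiv ι p) =
      stftFun (gaussian ι) (fun t => conj (g t)) p.1 *
        (stftFun (gaussian ι) f p.2 * stftCoeff T (conjPhase p.1) (M1.shift p.2)) := fun p => by
    have e : phaseEquiv ι p = (pair p.1.1 p.2.1, pair p.1.2 p.2.2) := rfl
    rw [matrixCoeff, (phaseEquiv ι).symm_apply_apply, e, stftFun_tensor]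
    ring
  simp_rw [h3]
  have hint : Integrable (fun p : Phase ι × Phase ι =>
      stftFun (gaussian ι) (fun t => conj (g t)) p.1 *
        (stftFun (gaussian ι) f p.2 * stftCoeff T (conjPhase p.1) (M1.shift p.2))) := by
    have hb := (hVg.mul_prod f.integrable_stft).bdd_mul
      (c := ‖T‖ * ∫ w, ‖stftFun (gaussian ι) (gaussian ι) w‖)
      ((measurable_matrixCoeff T).comp (phaseEquiv ι).measurable).aestronglyMeasurable
      (Filter.Eventually.of_forall fun p => norm_matrixCoeff_le T _)
    refine hb.congr (Filter.Eventually.of_forall fun p => ?_)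
    simp only [Function.comp_apply]
    rw [matrixCoeff, (phaseEquiv ι).symm_apply_apply]
    ring
  have h4 := integral_prod _ hint
  refine Eq.trans ?_ h4.symm
  -- Integration over the second point reassembles `f` and leaves `V(Tf)` at the reflected first
  -- point. The reflection built into `matrixCoeff` cancels the one produced by `conj g`.
  simp only [integral_const_mul, (stftCoeff_inversion T _).2 f]
  rw [← integral_conjPhase, bracket]
  congr 1
  funext z
  rw [stftFun_conj, conjPhase_conjPhase, mul_comm]
  rfl

/-! ### Symbols, spreading functions and their relation to the kernel. -/

section Representation

variable [DecidableEq ι] (A : GL (ι ⊕ ι) ℝ)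

theorem matrixWigner_schwartz_superposition (f g : M1 ι) (y : EuclideanSpace ℝ (ι ⊕ ι)) :
    matrixWigner A g f y =
      ∫ z, stftFun (gaussian (ι ⊕ ι)) (tensor g fun t => conj (f t)) z *
        wignerOp (matrixEquiv A) (tfShiftS z (gaussian (ι ⊕ ι))) y :=
  partialFourier_comp_eq_integral (matrixEquiv A)
    (continuous_tensor g.continuous (Complex.continuous_conj.comp f.continuous))
    (integrable_tensor g.integrable ((Complex.conjCLE : ℂ →L[ℝ] ℂ).integrable_comp f.integrable))
    (integrable_stftFun_tensor g.integrable_stft (integrable_stftFun_conj f.integrable_stft)) y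

/-- The symbol `k ∘ 𝔗_{A⁻¹} 𝓕₂ = |det A| 𝓕₂ 𝔗_A k` of the operator with kernel `k`. -/
def symbolOfKernel (k : ModulationSpace ∞ (ι ⊕ ι)) : ModulationSpace ∞ (ι ⊕ ι) :=
  compModulation k (isCovariant_wignerAdj (matrixEquiv A))

theorem bracket_symbolOfKernel (k : ModulationSpace ∞ (ι ⊕ ι)) (f g : M1 ι) :
    bracket (symbolOfKernel A k).toDist (matrixWigner A g f) =
      bracket k.toDist (tensor g fun t => conj (f t)) :=
  bracket_compModulation k _ (isCovariant_wignerOp (matrixEquiv A))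
    (wignerAdj_conjS_wignerOp (matrixEquiv A))
    (integrable_stftFun_tensor g.integrable_stft (integrable_stftFun_conj f.integrable_stft))
    (matrixWigner_schwartz_superposition A f g)

/-- Duality defines `𝔗_A k` with the factor `|det A|⁻¹`; the scalar `|det A|` cancels it and leaves
plain composition with `𝔗_{A⁻¹} 𝓕₂`. -/
theorem compDist_wignerAdj_eq (k : 𝓢'(EuclideanSpace ℝ (ι ⊕ ι), ℂ)) :
    compDist k (wignerAdj (matrixEquiv A)) =
      ((|(A : Matrix (ι ⊕ ι) (ι ⊕ ι) ℝ).det| : ℝ) : ℂ) •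
        partialFourierDist (coordChangeDist A k) := by
  ext Ψ
  have h : (A : Matrix (ι ⊕ ι) (ι ⊕ ι) ℝ).det ≠ 0 := A.det.ne_zero
  change k _ = _ * (coordChangeDist A k (partialFourierCLM Ψ))
  rw [coordChangeDist_apply, ← mul_assoc, ← Complex.ofReal_mul, mul_inv_cancel₀ (abs_ne_zero.2 h),
    Complex.ofReal_one, one_mul, matrixEquiv_inv]
  rfl

-- The Gaussian of `ℝ²ᵈ` is a product, so its shifts are products of shifts; the frequency of `f` is
-- reversed to offset the conjugation. Identities tested only on `g ⊗ conj f` therefore reach every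
-- shift, which gives uniqueness.
omit [DecidableEq ι] in
theorem exists_shift_tensor (z : Phase (ι ⊕ ι)) : ∃ f g : M1 ι,
    (tensor g fun t => conj (f t)) = tfShift z (gaussian (ι ⊕ ι)) := by
  refine ⟨M1.shift (conjPhase (sndL z.1, sndL z.2)), M1.shift (fstL z.1, fstL z.2), ?_⟩
  funext y
  have h := tfShift_pair (fstL z.1, fstL z.2) (sndL z.1, sndL z.2) (fstL y) (sndL y)
  simp only [pair_fst_snd] at h
  rw [tensor, M1.shift_apply, M1.shift_apply, conj_tfShift_gaussian, conjPhase_conjPhase]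
  exact h.symm

/-- When `g ⊗ conj f = π(z)φ`, the two representations of `⟨Tf, g⟩` equate the bracket of `k` with
`π(z)φ` and that of `σ` with `𝓕₂ 𝔗_A π(z)φ`. As `z` varies these values determine `σ`. -/
theorem symbol_unique {T : M1 ι →L[ℂ] ModulationSpace ∞ ι} {k σ : ModulationSpace ∞ (ι ⊕ ι)}
    (hk : IsIntegralOp T k) (hσ : IsPseudodiffOp A T σ) :
    σ.toDist = ((|(A : Matrix (ι ⊕ ι) (ι ⊕ ι) ℝ).det| : ℝ) : ℂ) •
        partialFourierDist (coordChangeDist A k.toDist) := by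
  rw [← compDist_wignerAdj_eq]
  refine eq_compDist_of_bracket_eq (S := wignerOp (matrixEquiv A))
    (conjS_wignerOp (matrixEquiv A)) (wignerAdj_inv (matrixEquiv A))
    (wignerAdjInv_adj (matrixEquiv A)) fun z => ?_
  obtain ⟨f, g, hfg⟩ := exists_shift_tensor z
  rw [← hfg, ← hk f g, hσ f g]
  congr 1
  funext y
  rw [wignerOp_apply, tfShiftS_coe, ← hfg]
  rfl

theorem matrixEquiv_matrixST (z : EuclideanSpace ℝ (ι ⊕ ι)) :
    matrixEquiv (matrixST ι) z = pair (sndL z) (sndL z - fstL z) := by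
  ext i
  rw [matrixEquiv_apply, Fintype.sum_sum_type]
  rcases i with i | i
  · simp [matrixST, Matrix.one_apply, pair]
    rfl
  · simp [matrixST, Matrix.one_apply, Matrix.neg_apply, pair]
    rw [add_comm, ← sub_eq_add_neg]
    rfl

/-- `A_ST` sends `(x, t)` to `(t, t - x)`, so the integrand is `g(t) conj f(t - x)` times the
exponential. This is `V_f g`, and spreading functions become the symbols for `A_ST`. -/
theorem matrixWigner_matrixST (f g : EuclideanSpace ℝ ι → ℂ) :
    matrixWigner (matrixST ι) g f =
      fun z => conj (∫ t, tfShift (fstL z, sndL z) f t * conj (g t)) := by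
  funext z
  rw [matrixWigner, partialFourier_eq, ← integral_conj]
  congr 1
  funext t
  rw [coordChange, matrixEquiv_matrixST, tensor, tfShift]
  simp only [fstL_pair, sndL_pair, smul_eq_mul, map_mul, ← Complex.exp_conj, Complex.conj_ofReal,
    Complex.conj_I, map_ofNat, Complex.conj_conj]
  have h : -(2 * (Real.pi : ℂ) * Complex.I) * ((inner ℝ t (sndL z) : ℝ) : ℂ) =
      2 * Real.pi * -Complex.I * ((inner ℝ t (sndL z) : ℝ) : ℂ) := by ring
  rw [h]
  ring

theorem isSpreadingOp_iff (F : ModulationSpace ∞ (ι ⊕ ι)) :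
    IsSpreadingOp T F ↔ IsPseudodiffOp (matrixST ι) T F := by
  simp only [IsSpreadingOp, IsPseudodiffOp, matrixWigner_matrixST]

theorem abs_det_matrixST : |((matrixST ι : GL (ι ⊕ ι) ℝ) : Matrix (ι ⊕ ι) (ι ⊕ ι) ℝ).det| = 1 := by
  have h : ((matrixST ι : GL (ι ⊕ ι) ℝ) : Matrix (ι ⊕ ι) (ι ⊕ ι) ℝ) =
    Matrix.fromBlocks 0 1 (-1) 1 := rfl
  rw [h, Matrix.det_fromBlocks_one₂₂]
  simp

theorem isPseudodiffOp_symbolOfKernel {T : M1 ι →L[ℂ] ModulationSpace ∞ ι}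
    {k : ModulationSpace ∞ (ι ⊕ ι)} (hk : IsIntegralOp T k) :
    IsPseudodiffOp A T (symbolOfKernel A k) := fun f g => by
  rw [hk f g, bracket_symbolOfKernel]

end Representation

end Operator

end MatrixWigner

end

open MatrixWigner

theorem mainTheorem2 (d : ℕ) (A : GL (Fin d ⊕ Fin d) ℝ)
    (T : M1 (Fin d) →L[ℂ] ModulationSpace ∞ (Fin d)) :
    (∃ k σ F : ModulationSpace ∞ (Fin d ⊕ Fin d),
      IsIntegralOp T k ∧ IsPseudodiffOp A T σ ∧ IsSpreadingOp T F) ∧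
    (∀ k σ F : ModulationSpace ∞ (Fin d ⊕ Fin d),
      IsIntegralOp T k → IsPseudodiffOp A T σ → IsSpreadingOp T F →
        σ.toDist = ((|(A : Matrix (Fin d ⊕ Fin d) (Fin d ⊕ Fin d) ℝ).det| : ℝ) : ℂ) •
            partialFourierDist (coordChangeDist A k.toDist) ∧
        F.toDist = partialFourierDist (coordChangeDist (matrixST (Fin d)) k.toDist)) := by
  refine ⟨?_, fun k σ F hk hσ hF => ⟨symbol_unique A hk hσ, ?_⟩⟩
  · obtain ⟨k, hk⟩ := exists_isIntegralOp T
    exact ⟨k, symbolOfKernel A k, symbolOfKernel (matrixST (Fin d)) k, hk,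
      isPseudodiffOp_symbolOfKernel A hk,
      (isSpreadingOp_iff T _).2 (isPseudodiffOp_symbolOfKernel _ hk)⟩
  -- The spreading relation is the symbol relation for `A_ST`, where `|det A_ST| = 1` removes the
  -- scalar.
  · have h := symbol_unique (matrixST (Fin d)) hk ((isSpreadingOp_iff T F).1 hF)
    rwa [abs_det_matrixST, Complex.ofReal_one, one_smul] at h
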